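/- Let $n\in\{2,3\}$, identify $\Gamma_\infty=\{x\in\mathbb R^n:x_n=0\}$ with $\mathbb R^{n-1}$, and let $\Gamma\subset\Gamma_\infty$ be non-empty, bounded and relatively open (otherwise arbitrary). Let $k>0$ and $s\in\mathbb R$. *Spaces.* $H^s(\mathbb R^{n-1})$ is the Bessel potential space of tempered distributions, with norm $\|u\|_{H^s_k(\mathbb R^{n-1})}=\|(k^2-\Delta)^{s/2}u\|_{L^2}$, i.e. $\|u\|_{H^s_k(\mathbb R^{n-1})}^2=\int_{\mathbb R^{n-1}}(k^2+|\xi|^2)^s|\hat u(\xi)|^2\,d\xi$ with the unitary Fourier transform; $H^s_{\overline\Gamma}=\{u\in H^s(\mathbb R^{n-1}):\operatorname{supp}u\subset\overline\Gamma\}$; and $H^s(\Gamma)=\{U|_\Gamma:U\in H^s(\mathbb R^{n-1})\}$ with norm $\|g\|_{H^s_k(\Gamma)}=\inf\{\|U\|_{H^s_k(\mathbb R^{n-1})}:U\in H^s(\mathbb R^{n-1}),\ U|_\Gamma=g\}$. *Operator.* Let $\Phi(x,y)=\frac{e^{ik|x-y|}}{4\pi|x-y|}$ if $n=3$ and $\Phi(x,y)=\frac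 i4H^{(1)}_0(k|x-y|)$ if $n=2$. Let $U^\pm=\{x\in\mathbb R^n:\pm x_n>0\}$ and let $\mathscr D_{1,\Gamma}$ be the set of all $\chi\in C_0^\infty(\mathbb R^n)$ with $\chi=1$ in a neighbourhood of $\Gamma$. For $\varphi\in H^{1/2}_{\overline\Gamma}$ the double-layer potential is $\mathcal D_k\varphi(x)=\langle\varphi,\partial_{y_n}(\rho\,\Phi(x,\cdot))|_{\Gamma_\infty}\rangle$ (bilinear pairing) for $x\in\mathbb R^n\setminus\overline\Gamma$, where $\rho\in\mathscr D_{1,\Gamma}$ is arbitrary with $x\notin\operatorname{supp}\rho$. The hypersingular operator is $T_k\varphi=\partial_n^\pm(\chi\mathcal D_k\varphi)|_\Gamma\in H^{-1/2}(\Gamma)$ for $\varphi\in H^{1/2}_{\overline\Gamma}$, where $\chi\in\mathscr D_{1,\Gamma}$ and the sign are arbitrary, and where for $w\in L^2(U^\pm)$ with $\nabla w,\Delta w\in L^2(U^\pm)$ the normal derivative $\partial_n^\pm w\in H^{-1/2}(\Gamma_\infty)$ is defined weakly by $\langle\partial_n^\pm w,v|_{\Gamma_\infty}\rangle=\mp\int_{U^\pm}(\nabla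 w\cdot\nabla v+v\,\Delta w)\,dx$, $v\in C_0^\infty(\mathbb R^n)$. *Theorem.* For every $s\in\mathbb R$ and $k>0$, $T_k$ defines a bounded linear operator $T_k:H^s_{\overline\Gamma}\to H^{s-1}(\Gamma)$. That is, there is exactly one linear operator $T:H^s_{\overline\Gamma}\to H^{s-1}(\Gamma)$ such that 1. $T\varphi=T_k\varphi$ for every $\varphi\in H^s_{\overline\Gamma}\cap H^{1/2}_{\overline\Gamma}$; and 2. $T$ is the extension of $T_k$ by continuity: for every bounded open $\Omega\subset\Gamma_\infty$ with $\overline\Gamma\subset\Omega$, every $\varphi\in H^s_{\overline\Gamma}$ and all $\varphi_j\in C_0^\infty(\Omega)$ with $\varphi_j\to\varphi$ in $H^s(\mathbb R^{n-1})$, one has $(T_k\varphi_j)|_\Gamma\to T\varphi$ in $H^{s-1}(\Gamma)$, where $T_k\varphi_j$ is formed on the screen $\Omega$. This operator, again denoted $T_k$, satisfies $$\|T_k\varphi\|_{H^{s-1}_k(\Gamma)}\le\tfrac12\,\|\varphi\|_{H^s_k(\mathbb R^{n-1})},\qquad\varphi\in H^s_{\overline\Gamma}.$$ -/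

import Mathlib

open MeasureTheory TopologicalSpace Filter Topology
open scoped SchwartzMap Distributions ContDiff ENNReal FourierTransform

namespace Screen

noncomputable section

/-! ### The ambient space

With `d = n - 1`, the hyperplane `Γ_∞ = {x_n = 0}` of `ℝⁿ` is identified with
`Hyp d = ℝ^{n-1}`, and `ℝⁿ` with `Amb d = ℝ^{n-1} × ℝ`, so that a point is
`x = (x̃, x_n)`. Only the smooth structure and the Lebesgue measure of the product are used;
Euclidean distances in `ℝⁿ` are written out by `edist2`. -/

/-- `ℝ^{n-1}` with its Euclidean norm, `n = d + 1`. -/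
abbrev Hyp (d : ℕ) : Type := EuclideanSpace ℝ (Fin d)

/-- `ℝⁿ = ℝ^{n-1} × ℝ`, `n = d + 1`. -/
abbrev Amb (d : ℕ) : Type := Hyp d × ℝ

/-- Euclidean distance in `ℝⁿ`. -/
def edist2 {d : ℕ} (x y : Amb d) : ℝ := Real.sqrt (‖x.1 - y.1‖ ^ 2 + (x.2 - y.2) ^ 2)

/-- The standard basis of `ℝⁿ`; `none` is the normal direction `e_n`. -/
def dir {d : ℕ} : Option (Fin d) → Amb d
  | some i => (EuclideanSpace.single i 1, 0)
  | none => (0, 1)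

/-- The half-spaces `U^±`, for `σ = ±1`. -/
def halfSpace (d : ℕ) (σ : ℤˣ) : Opens (Amb d) :=
  ⟨{y | 0 < ((σ : ℤ) : ℝ) * y.2}, isOpen_lt continuous_const (continuous_const.mul continuous_snd)⟩

/-! ### Test functions and distributions

Distributions on `Ω` are the continuous linear functionals on `𝓓(Ω, ℂ)` and tempered distributions
those on `𝓢`; all pairings are bilinear. -/

/-- Distributions on an open set `Ω ⊆ ℝ^{n-1}`. -/
abbrev Dist {d : ℕ} (Ω : Opens (Hyp d)) : Type := 𝓓(Ω, ℂ) →L[ℂ] ℂ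

/-- A test function as a Schwartz function. -/
def testSchwartz {d : ℕ} (Ω : Opens (Hyp d)) (v : 𝓓(Ω, ℂ)) : 𝓢(Hyp d, ℂ) :=
  v.hasCompactSupport.toSchwartzMap v.contDiff

theorem continuous_testSchwartz {d : ℕ} (Ω : Opens (Hyp d)) (K : Compacts (Hyp d))
    (hK : (K : Set (Hyp d)) ⊆ Ω) :
    Continuous (testSchwartz Ω ∘ TestFunction.ofSupportedIn (n := ⊤) (F := ℂ) hK) := by
  let L : 𝓓^{⊤}_{K}(Hyp d, ℂ) →ₗ[ℝ] 𝓢(Hyp d, ℂ) :=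
    { toFun := testSchwartz Ω ∘ TestFunction.ofSupportedIn hK
      map_add' := fun _ _ => rfl
      map_smul' := fun _ _ => rfl }
  change Continuous L
  obtain ⟨R, hR⟩ := K.isCompact.isBounded.exists_norm_le
  refine WithSeminorms.continuous_of_isBounded (𝕝 := ℝ) (𝕝₂ := ℝ)
    (ContDiffMapSupportedIn.withSeminorms ℝ (Hyp d) ℂ ⊤ K) (schwartz_withSeminorms ℝ (Hyp d) ℂ) L ?_
  rintro ⟨p, q⟩
  refine ⟨{q}, (max R 0 ^ p).toNNReal, fun f => ?_⟩
  rw [Finset.sup_singleton]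
  refine SchwartzMap.seminorm_le_bound ℝ p q _ (by positivity) fun x => ?_
  have hx := ContDiffMapSupportedIn.norm_iteratedFDeriv_apply_le_seminorm_top ℝ
    (f := f) (i := q) (x := x)
  have hc : (((max R 0 ^ p).toNNReal : ℝ)) = max R 0 ^ p := Real.coe_toNNReal _ (by positivity)
  change ‖x‖ ^ p * ‖iteratedFDeriv ℝ q f x‖ ≤ ((max R 0 ^ p).toNNReal : ℝ) *
    ContDiffMapSupportedIn.seminorm ℝ (Hyp d) ℂ ⊤ K q f
  rw [hc]
  by_cases hxK : x ∈ K
  · gcongr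
    exact (hR x hxK).trans (le_max_left _ _)
  · have h0 : iteratedFDeriv ℝ q f x = 0 := by
      by_contra h
      exact hxK (f.tsupport_subset (support_iteratedFDeriv_subset q h))
    rw [h0, norm_zero, mul_zero]
    positivity

/-- The continuous inclusion `𝓓(Ω) → 𝓢(ℝ^{n-1})`. -/
def testSchwartzCLM {d : ℕ} (Ω : Opens (Hyp d)) : 𝓓(Ω, ℂ) →L[ℂ] 𝓢(Hyp d, ℂ) :=
  TestFunction.mkCLM ℂ (testSchwartz Ω) (fun _ _ => rfl) (fun _ _ => rfl)
    (continuous_testSchwartz Ω)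

/-- The tempered distribution given by a test function. -/
def testTempered {d : ℕ} (Ω : Opens (Hyp d)) (v : 𝓓(Ω, ℂ)) : 𝓢'(Hyp d, ℂ) :=
  (testSchwartz Ω v : 𝓢'(Hyp d, ℂ))

/-- Restriction of a tempered distribution to `Ω`. -/
def restrict {d : ℕ} (Ω : Opens (Hyp d)) : 𝓢'(Hyp d, ℂ) →ₗ[ℂ] Dist Ω where
  toFun U :=
    { toFun := fun v => U (testSchwartzCLM Ω v)
      map_add' := fun v w => by simp
      map_smul' := fun c v => by simp
      cont := by
        have h : Continuous fun w : 𝓢(Hyp d, ℂ) => U w := U.continuous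
        exact h.comp (testSchwartzCLM Ω).continuous }
  map_add' _ _ := rfl
  map_smul' _ _ := rfl

/-- Restriction of a distribution from `Ω` to a smaller open set `Γ ⊆ Ω`. -/
def restrictTo {d : ℕ} {Ω : Opens (Hyp d)} (Γ : Opens (Hyp d)) (g : Dist Ω) : Dist Γ :=
  g.comp (TestFunction.monoCLM ℂ)

/-! ### Sobolev spaces -/

/-- `H^s(ℝ^{n-1})`. -/
def sobolev (d : ℕ) (s : ℝ) : Submodule ℂ 𝓢'(Hyp d, ℂ) where
  carrier := {u | TemperedDistribution.MemSobolev s 2 u}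
  add_mem' hu hv := hu.add hv
  zero_mem' := TemperedDistribution.memSobolev_fun_zero _ _ s 2
  smul_mem' c _ hu := hu.smul c

/-- The Bessel potential operator `(k² - Δ)^{s/2}`. Its symbol is `(k² + |ξ|²)^{s/2}` in terms of
the angular frequency `ξ`, which is `2π` times the variable of Mathlib's Fourier transform. -/
def bessel (d : ℕ) (k s : ℝ) : 𝓢'(Hyp d, ℂ) →L[ℂ] 𝓢'(Hyp d, ℂ) :=
  TemperedDistribution.fourierMultiplierCLM ℂ
    (fun ξ : Hyp d => (((k ^ 2 + ‖(2 * Real.pi) • ξ‖ ^ 2) ^ (s / 2) : ℝ) : ℂ))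

/-- The norm `‖u‖_{H^s_k(ℝ^{n-1})} = ‖(k² - Δ)^{s/2} u‖_{L²}` (infinite if
`(k² - Δ)^{s/2} u` is not in `L²`). -/
def sobolevNorm {d : ℕ} (k s : ℝ) (u : 𝓢'(Hyp d, ℂ)) : ℝ≥0∞ :=
  ⨅ (f : Lp ℂ 2 (volume : Measure (Hyp d))) (_ : bessel d k s u = (f : 𝓢'(Hyp d, ℂ))), ‖f‖ₑ

/-- The `k`-dependent norm is finite on `H^s(ℝ^{n-1})`. -/
theorem sobolevNorm_lt_top {d : ℕ} {k s : ℝ} (hk : 0 < k) {u : 𝓢'(Hyp d, ℂ)}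
    (hu : u ∈ sobolev d s) : sobolevNorm k s u < ⊤ := by
  have hsym : (fun ξ : Hyp d => (((k ^ 2 + ‖(2 * Real.pi) • ξ‖ ^ 2) ^ (s / 2) : ℝ) : ℂ)) =
      fun ξ : Hyp d =>
        (((k ^ 2) ^ (s / 2) * (1 + ‖(2 * Real.pi / k) • ξ‖ ^ 2) ^ (s / 2) : ℝ) : ℂ) := by
    ext ξ
    rw [← Real.mul_rpow (by positivity) (by positivity)]
    congr 3
    simp only [norm_smul, mul_pow, Real.norm_eq_abs, sq_abs, div_pow]
    field_simp
  have htg : (fun ξ : Hyp d =>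
      (((k ^ 2 + ‖(2 * Real.pi) • ξ‖ ^ 2) ^ (s / 2) : ℝ) : ℂ)).HasTemperateGrowth := by
    rw [hsym]
    have h1 := (Function.hasTemperateGrowth_one_add_norm_sq_rpow (Hyp d) (s / 2)).comp
      (((2 * Real.pi / k) • ContinuousLinearMap.id ℝ (Hyp d)).hasTemperateGrowth)
    have h2 : (fun ξ : Hyp d => (1 + ‖(2 * Real.pi / k) • ξ‖ ^ 2) ^ (s / 2)).HasTemperateGrowth := h1
    fun_prop
  have hmem : TemperedDistribution.MemSobolev 0 2 (bessel d k s u) := by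
    have h := TemperedDistribution.MemSobolev.fourierMultiplierCLM_of_bounded (s := 0)
      (f := TemperedDistribution.besselPotential (Hyp d) ℂ s u)
      (g := fun ξ : Hyp d => (((k ^ 2 + ‖(2 * Real.pi) • ξ‖ ^ 2) ^ (s / 2) : ℝ) : ℂ) *
        (((1 + ‖ξ‖ ^ 2) ^ (-s / 2) : ℝ) : ℂ)) (by simpa using (show TemperedDistribution.MemSobolev s 2 u from hu))
      (by fun_prop) ?_
    · rw [TemperedDistribution.besselPotential,
        TemperedDistribution.fourierMultiplierCLM_fourierMultiplierCLM_apply (by fun_prop)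
        (by fun_prop)] at h
      have hfun : ((fun ξ : Hyp d => (((1 + ‖ξ‖ ^ 2) ^ (s / 2) : ℝ) : ℂ)) * fun ξ : Hyp d =>
          (((k ^ 2 + ‖(2 * Real.pi) • ξ‖ ^ 2) ^ (s / 2) : ℝ) : ℂ) *
            (((1 + ‖ξ‖ ^ 2) ^ (-s / 2) : ℝ) : ℂ)) =
          fun ξ : Hyp d => (((k ^ 2 + ‖(2 * Real.pi) • ξ‖ ^ 2) ^ (s / 2) : ℝ) : ℂ) := by
        ext ξ
        rw [Pi.mul_apply, mul_left_comm, ← Complex.ofReal_mul ((1 + ‖ξ‖ ^ 2) ^ (s / 2)),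
          ← Real.rpow_add (by positivity), show s / 2 + -s / 2 = 0 by ring]
        simp
      rw [hfun] at h
      exact h
    · set a := min (k ^ 2) ((2 * Real.pi) ^ 2) with ha
      set b := max (k ^ 2) ((2 * Real.pi) ^ 2) with hb
      have ha0 : 0 < a := lt_min (by positivity) (by positivity)
      have hb0 : 0 < b := lt_max_of_lt_left (by positivity)
      refine ⟨max (a ^ (s / 2)) (b ^ (s / 2)), fun ξ => ?_⟩
      have hpos : (0 : ℝ) < 1 + ‖ξ‖ ^ 2 := by positivity
      have e : k ^ 2 + ‖(2 * Real.pi) • ξ‖ ^ 2 = k ^ 2 + (2 * Real.pi) ^ 2 * ‖ξ‖ ^ 2 := by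
        simp only [norm_smul, mul_pow, Real.norm_eq_abs, sq_abs]
      have l1 : a * (1 + ‖ξ‖ ^ 2) ≤ k ^ 2 + ‖(2 * Real.pi) • ξ‖ ^ 2 := by
        rw [e]
        nlinarith [min_le_left (k ^ 2) ((2 * Real.pi) ^ 2), min_le_right (k ^ 2) ((2 * Real.pi) ^ 2),
          mul_le_mul_of_nonneg_right (min_le_right (k ^ 2) ((2 * Real.pi) ^ 2)) (sq_nonneg ‖ξ‖)]
      have l2 : k ^ 2 + ‖(2 * Real.pi) • ξ‖ ^ 2 ≤ b * (1 + ‖ξ‖ ^ 2) := by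
        rw [e]
        nlinarith [le_max_left (k ^ 2) ((2 * Real.pi) ^ 2),
          mul_le_mul_of_nonneg_right (le_max_right (k ^ 2) ((2 * Real.pi) ^ 2)) (sq_nonneg ‖ξ‖)]
      rw [← Complex.ofReal_mul, Complex.norm_real, Real.norm_of_nonneg (by positivity),
        neg_div, Real.rpow_neg hpos.le, ← div_eq_mul_inv, div_le_iff₀ (by positivity)]
      rcases le_total 0 (s / 2) with hs | hs
      · calc _ ≤ (b * (1 + ‖ξ‖ ^ 2)) ^ (s / 2) := Real.rpow_le_rpow (by positivity) l2 hs
          _ = b ^ (s / 2) * (1 + ‖ξ‖ ^ 2) ^ (s / 2) := Real.mul_rpow hb0.le hpos.le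
          _ ≤ _ := by gcongr; exact le_max_right _ _
      · calc _ ≤ (a * (1 + ‖ξ‖ ^ 2)) ^ (s / 2) :=
              Real.rpow_le_rpow_of_nonpos (by positivity) l1 hs
          _ = a ^ (s / 2) * (1 + ‖ξ‖ ^ 2) ^ (s / 2) := Real.mul_rpow ha0.le hpos.le
          _ ≤ _ := by gcongr; exact le_max_left _ _
  obtain ⟨f, hf⟩ := TemperedDistribution.memSobolev_zero_iff.1 hmem
  exact (iInf₂_le f hf).trans_lt enorm_lt_top

/-- `H^s_F`, the elements of `H^s(ℝ^{n-1})` whose support lies in `F`. -/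
def sobolevSupp {d : ℕ} (s : ℝ) (F : Set (Hyp d)) : Submodule ℂ 𝓢'(Hyp d, ℂ) where
  carrier := {u | u ∈ sobolev d s ∧ Distribution.dsupport u ⊆ F}
  add_mem' {u v} hu hv := by
    refine ⟨add_mem hu.1 hv.1, fun x hx => ?_⟩
    by_contra hxF
    obtain ⟨a, ha, hao, hxa⟩ := (Distribution.notMem_dsupport_iff x).1 fun h => hxF (hu.2 h)
    obtain ⟨b, hb, hbo, hxb⟩ := (Distribution.notMem_dsupport_iff x).1 fun h => hxF (hv.2 h)
    refine (Distribution.notMem_dsupport_iff x).2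
      ⟨a ∩ b, fun w hw => ?_, hao.inter hbo, hxa, hxb⟩ hx
    have h1 := ha w (hw.trans Set.inter_subset_left)
    have h2 := hb w (hw.trans Set.inter_subset_right)
    simp [h1, h2]
  zero_mem' := by
    refine ⟨zero_mem _, fun x hx => ?_⟩
    exact absurd hx ((Distribution.notMem_dsupport_iff x).2
      ⟨Set.univ, fun _ _ => rfl, isOpen_univ, trivial⟩)
  smul_mem' c u hu := by
    refine ⟨Submodule.smul_mem _ c hu.1, fun x hx => ?_⟩
    by_contra hxF
    obtain ⟨a, ha, hao, hxa⟩ := (Distribution.notMem_dsupport_iff x).1 fun h => hxF (hu.2 h)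
    refine (Distribution.notMem_dsupport_iff x).2 ⟨a, fun w hw => ?_, hao, hxa⟩ hx
    have h1 := ha w hw
    simp [h1]

/-- `H^s(Γ)`, the restrictions to `Γ` of elements of `H^s(ℝ^{n-1})`. -/
def sobolevOn {d : ℕ} (s : ℝ) (Γ : Opens (Hyp d)) : Submodule ℂ (Dist Γ) :=
  (sobolev d s).map (restrict Γ)

/-- The quotient norm `‖g‖_{H^s_k(Γ)}`, the infimum of `‖U‖_{H^s_k(ℝ^{n-1})}` over all extensions
`U ∈ H^s(ℝ^{n-1})` of `g` (infinite if there are none). -/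
def sobolevOnNorm {d : ℕ} (k s : ℝ) (Γ : Opens (Hyp d)) (g : Dist Γ) : ℝ≥0∞ :=
  ⨅ (U : 𝓢'(Hyp d, ℂ)) (_ : U ∈ sobolev d s ∧ restrict Γ U = g), sobolevNorm k s U

/-! ### The fundamental solution -/

/-- The Hankel function `H_0^{(1)}(r) = J_0(r) + i Y_0(r)`, `r > 0`, by its classical integral
representation `H_0^{(1)}(r) = -(2i/π) ∫_1^∞ e^{irt} (t² - 1)^{-1/2} dt`, where the path of
integration is turned to `t = 1 + iτ`, `τ > 0`, which makes the integral absolutely convergent. -/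
def hankel (r : ℝ) : ℂ :=
  (2 / Real.pi : ℝ) * Complex.exp (Complex.I * r) *
    ∫ τ in Set.Ioi (0 : ℝ),
      Complex.exp (-(r * τ : ℝ)) * (2 * Complex.I * τ - (τ : ℂ) ^ 2) ^ (-(1 / 2) : ℂ)

/-- The fundamental solution `Φ(x, y)` of `Δ u + k² u = 0` in `ℝⁿ`, for `n = 3` (`d = 2`) and
`n = 2` (`d = 1`). -/
def fundSol {d : ℕ} (k : ℝ) (x y : Amb d) : ℂ :=
  if d = 2 then Complex.exp (Complex.I * (k * edist2 x y : ℝ)) / (4 * Real.pi * edist2 x y : ℝ)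
  else Complex.I / 4 * hankel (k * edist2 x y)

/-! ### Neumann traces, the double-layer potential and the hypersingular operator -/

theorem isClosedEmbedding_slice (d : ℕ) :
    IsClosedEmbedding (fun x : Hyp d => ((x, 0) : Amb d)) := by
  refine (Isometry.of_dist_eq fun x y => ?_).isClosedEmbedding
  simp [Prod.dist_eq]

/-- The trace `x̃ ↦ v(x̃, 0)` of a test function `v ∈ 𝓓(ℝⁿ)` on `Γ_∞`. -/
def traceTest {d : ℕ} (v : 𝓓((⊤ : Opens (Amb d)), ℂ)) : 𝓢(Hyp d, ℂ) :=
  HasCompactSupport.toSchwartzMap (f := fun x : Hyp d => v (x, 0))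
    (v.hasCompactSupport.comp_isClosedEmbedding (isClosedEmbedding_slice d))
    (v.contDiff.comp (contDiff_id.prodMk contDiff_const))

/-- `w ∈ L²(U^±)` has the weak gradient `G ∈ L²(U^±)` and the weak Laplacian `f ∈ L²(U^±)`;
so `w ∈ W^1(U^±; Δ)`. -/
structure HasWeakGradLaplacian {d : ℕ} (σ : ℤˣ) (w : Amb d → ℂ)
    (G : Option (Fin d) → Amb d → ℂ) (f : Amb d → ℂ) : Prop where
  memLp : MemLp w 2 (volume.restrict (halfSpace d σ))
  memLp_grad : ∀ j, MemLp (G j) 2 (volume.restrict (halfSpace d σ))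
  memLp_laplacian : MemLp f 2 (volume.restrict (halfSpace d σ))
  grad : ∀ j, ∀ v : 𝓓(halfSpace d σ, ℂ),
    ∫ y in halfSpace d σ, w y * fderiv ℝ v y (dir j) = -∫ y in halfSpace d σ, G j y * v y
  laplacian : ∀ v : 𝓓(halfSpace d σ, ℂ),
    ∫ y in halfSpace d σ, ∑ j, G j y * fderiv ℝ v y (dir j) = -∫ y in halfSpace d σ, f y * v y

/-- `w ∈ W^1(U^±; Δ)` and its normal derivative `∂_n^± w ∈ H^{-1/2}(Γ_∞)`, in the direction `e_n`
on both sides, is `h`: Green's first identity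
`⟨∂_n^± w, γ^± v⟩ = ∓ ∫_{U^±} (∇w · ∇v + v Δw)` holds for all `v ∈ 𝓓(ℝⁿ)`, whose restrictions
are dense in `W^1(U^±)`. -/
def IsNormalDeriv {d : ℕ} (σ : ℤˣ) (w : Amb d → ℂ) (h : 𝓢'(Hyp d, ℂ)) : Prop :=
  h ∈ sobolev d (-(1 / 2)) ∧ ∃ G f, HasWeakGradLaplacian σ w G f ∧
    ∀ v : 𝓓((⊤ : Opens (Amb d)), ℂ),
      h (traceTest v) = -((σ : ℤ) : ℂ) *
        ∫ y in halfSpace d σ, ((∑ j, G j y * fderiv ℝ v y (dir j)) + v y * f y)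

/-- `𝓓_{1,Γ}(ℝⁿ)`, the test functions on `ℝⁿ` equal to `1` in a neighbourhood of `Γ`. -/
def cutoffs {d : ℕ} (Γ : Opens (Hyp d)) : Set 𝓓((⊤ : Opens (Amb d)), ℂ) :=
  {χ | ∀ᶠ y in 𝓝ˢ ((Γ : Set (Hyp d)) ×ˢ ({0} : Set ℝ)), χ y = 1}

/-- `u = 𝒟_k φ` in `D = ℝⁿ \ closure Γ`, the double-layer potential: `u(x)` is `φ` applied to
`∂_n (ρ Φ(x, ·))` on `Γ_∞`, for every `ρ ∈ 𝓓_{1,Γ}(ℝⁿ)` whose support does not contain `x`. -/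
def IsDoubleLayer {d : ℕ} (k : ℝ) (Γ : Opens (Hyp d)) (φ : 𝓢'(Hyp d, ℂ)) (u : Amb d → ℂ) : Prop :=
  ∀ x : Amb d, x ∉ closure (Γ : Set (Hyp d)) ×ˢ ({0} : Set ℝ) →
    ∀ ρ ∈ cutoffs Γ, x ∉ tsupport ρ →
      ∃ θ : 𝓢(Hyp d, ℂ),
        (∀ y, θ y = deriv (fun t : ℝ => ρ (y, t) * fundSol k x (y, t)) 0) ∧ u x = φ θ

/-- `g = T_k φ` for `φ ∈ H^{1/2}_{closure Γ}`, that is `g = ∂_n^±(χ 𝒟_k φ)|_Γ` for all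
`χ ∈ 𝓓_{1,Γ}(ℝⁿ)` and both choices of the sign. -/
def IsHypersingular {d : ℕ} (k : ℝ) (Γ : Opens (Hyp d)) (φ : 𝓢'(Hyp d, ℂ)) (g : Dist Γ) : Prop :=
  ∃ u : Amb d → ℂ, IsDoubleLayer k Γ φ u ∧ ∀ χ ∈ cutoffs Γ, ∀ σ : ℤˣ,
    ∃ h : 𝓢'(Hyp d, ℂ), IsNormalDeriv σ (fun y => χ y * u y) h ∧ restrict Γ h = g

/-- `T` is the hypersingular operator `T_k` on `H^s_{closure Γ}`: it agrees with the definition by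
normal derivatives on `H^{1/2}_{closure Γ} ∩ H^s_{closure Γ}`, and it is its continuous extension:
whenever smooth `φ_j`, supported in a bounded open neighbourhood `Ω` of `closure Γ`, tend to `φ` in
`H^s`, then the `T_k φ_j` on the screen `Ω`, restricted to `Γ`, tend to `T φ` in
`H^{s-1}(Γ)`. -/
structure IsHypersingularOperator {d : ℕ} (k s : ℝ) (Γ : Opens (Hyp d))
    (T : sobolevSupp s (closure (Γ : Set (Hyp d))) →ₗ[ℂ] sobolevOn (s - 1) Γ) : Prop where
  eq_trace : ∀ φ : sobolevSupp s (closure (Γ : Set (Hyp d))), (φ : 𝓢'(Hyp d, ℂ)) ∈ sobolev d (1 / 2) →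
    IsHypersingular k Γ (φ : 𝓢'(Hyp d, ℂ)) (T φ : Dist Γ)
  extension : ∀ φ : sobolevSupp s (closure (Γ : Set (Hyp d))), ∀ Ω : Opens (Hyp d),
    Bornology.IsBounded (Ω : Set (Hyp d)) →
    closure (Γ : Set (Hyp d)) ⊆ Ω → ∀ ψ : ℕ → 𝓓(Ω, ℂ),
    Tendsto (fun j => sobolevNorm k s (testTempered Ω (ψ j) - (φ : 𝓢'(Hyp d, ℂ)))) atTop (𝓝 0) →
    ∃ g : ℕ → Dist Ω, (∀ j, IsHypersingular k Ω (testTempered Ω (ψ j)) (g j)) ∧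
      Tendsto (fun j => sobolevOnNorm k (s - 1) Γ (restrictTo Γ (g j) - (T φ : Dist Γ))) atTop (𝓝 0)

end

end Screen

/-!
On the Fourier side `T_k` is multiplication by `-Λ/2`, followed by restriction to `Γ`, where
`Λ(ξ) = √(|2πξ|² - k²)` with the branch `-i√(k² - |2πξ|²)` for `|2πξ| < k` (`symbol`). Since
`|Λ(ξ)| ≤ (k² + |2πξ|²)^{1/2}`, this multiplier has norm at most `1/2` from `H^s_k` to `H^{s-1}_k`,
and restriction does not increase the norm; this is the bound (`sobolevNorm_symbol_le`). What has
to be shown is that the multiplier is the operator defined by normal derivatives, and that the two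
properties of the theorem single it out.

*The kernel.* Taking the Fourier transform in the tangential variables turns `∂_{y_n} Φ(x, ·)` on
`Γ_∞` into `± e^{-|x_n| Λ} / 2` (`fourierInv_exp_symbol`, `deriv_fundSol`). For the equation
`κ² u - Δ u = 0` with `κ > 0` this is a superposition of Gaussians (`fourierInv_exp_realSymbol`).
Both sides are holomorphic in `κ` for `Re κ > 0` (`fourierInv_exp_complexSymbol`), because `Φ` is a
function of `κ|x - y|` that is holomorphic off the closed negative half-line: an elementary one for
`n = 3` and the Macdonald function `K_0` for `n = 2`, to which the Hankel function is related by
`hankel_eq_macdonald`. The value `κ = -ik` is then reached as a limit (`tendsto_complexSymbol`).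

*The potential.* An element `φ` of `H^{1/2}` supported in `closure Γ` is an integrable function, so
in `U^±` its double-layer potential is `±1/2` times the superposition `halfField` of the plane waves
`e^{2πi ξ·x̃ - |x_n| Λ(ξ)}` with the density `a = φ̂`. On the half-space, Parseval's identity in the
tangential variables (`setIntegral_halfField_mul`) moves every pairing with a compactly supported
function to the Fourier side, where integration by parts is done on single plane waves. This gives
the weak gradient and Laplacian of `χ 𝒟_k φ` and Green's identity, with the boundary term `Λ a`
(`setIntegral_cutoff_green`). Hence `∂_n^±(χ 𝒟_k φ)` has the density `-Λ a / 2` on `Γ`, from both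
sides (`isNormalDeriv_cutoff`, `isHypersingular_restrict`). Square integrability of the gradient near
`Γ_∞` is where `φ ∈ H^{1/2}` enters: the squares of the plane waves, integrated in `x_n` over a
layer, decay like `|ξ|⁻¹`.

*The extension.* Sobolev spaces of all orders are described by weighted square integrable Fourier
densities (`HasFourierDensity`), and the multiplier is defined on all of them. Test functions on
`Ω ⊇ closure Γ` have densities of every order, so the `T_k φ_j` are given by the same multiplier and
the bound yields convergence (`isHypersingularOperator_of_multiplier`). For uniqueness, test
functions on `Ω` are dense in `H^s_{closure Γ}`: approximate the density, transform back and cut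
off, multiplication by the cut-off being bounded on `H^s` (`exists_tendsto_testTempered`). On a
bounded screen `T_k φ_j` is determined by its definition (`IsHypersingular.unique`), and limits in
`H^{s-1}(Γ)` are limits of distributions, so the values of the extension are determined as well.
-/

namespace Screen

noncomputable section

/-! ### Integrals of Cauchy–Schlömilch type and the Macdonald function -/

theorem image_mul_sub_div_Ioi {α β : ℝ} (hα : 0 < α) (hβ : 0 < β) :
    (fun s : ℝ => α * s - β / s) '' Set.Ioi 0 = Set.univ := by
  refine Set.eq_univ_of_forall fun w => ?_
  have h0 : 0 ≤ w ^ 2 + 4 * α * β := by positivity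
  have hlt : |w| < Real.sqrt (w ^ 2 + 4 * α * β) := by
    rw [← Real.sqrt_sq_eq_abs]
    exact Real.sqrt_lt_sqrt (sq_nonneg _) (by nlinarith [mul_pos hα hβ])
  have hpos : 0 < w + Real.sqrt (w ^ 2 + 4 * α * β) := by linarith [neg_abs_le w]
  refine ⟨(w + Real.sqrt (w ^ 2 + 4 * α * β)) / (2 * α), by simp only [Set.mem_Ioi]; positivity, ?_⟩
  have hs := Real.sq_sqrt h0
  generalize Real.sqrt (w ^ 2 + 4 * α * β) = q at *
  simp only
  field_simp
  nlinarith

theorem hasDerivAt_mul_sub_div (α β : ℝ) {s : ℝ} (hs : s ≠ 0) :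
    HasDerivAt (fun s : ℝ => α * s - β / s) (α + β / s ^ 2) s := by
  have h := ((hasDerivAt_id s).const_mul α).sub ((hasDerivAt_inv hs).const_mul β)
  exact h.congr_deriv (by rw [mul_one, mul_neg, sub_neg_eq_add, div_eq_mul_inv])

theorem injOn_mul_sub_div {α β : ℝ} (hα : 0 < α) (hβ : 0 < β) :
    Set.InjOn (fun s : ℝ => α * s - β / s) (Set.Ioi 0) := by
  intro s hs t ht h
  have hs' : 0 < s := hs
  have ht' : 0 < t := ht
  simp only at h
  have h1 : (s - t) * (α * s * t + β) = 0 := by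
    field_simp at h
    linear_combination h
  rcases mul_eq_zero.1 h1 with h2 | h2
  · linarith
  · have : 0 < α * s * t + β := by positivity
    linarith

/-- The Cauchy–Schlömilch substitution `w = α s - β / s`. -/
theorem integral_Ioi_cauchySchlomilch {α β : ℝ} (hα : 0 < α) (hβ : 0 < β) (f : ℝ → ℝ) :
    ∫ s in Set.Ioi (0 : ℝ), (α + β / s ^ 2) * f (α * s - β / s) = ∫ w, f w := by
  have h := integral_image_eq_integral_abs_deriv_smul measurableSet_Ioi
    (fun s (hs : s ∈ Set.Ioi (0 : ℝ)) =>
      (hasDerivAt_mul_sub_div α β (ne_of_gt hs)).hasDerivWithinAt)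
    (injOn_mul_sub_div hα hβ) f
  rw [image_mul_sub_div_Ioi hα hβ, setIntegral_univ] at h
  rw [h]
  refine setIntegral_congr_fun measurableSet_Ioi fun s hs => ?_
  have hs' : 0 < s := hs
  simp only [smul_eq_mul]
  rw [abs_of_pos (by positivity)]

theorem integrableOn_Ioi_cauchySchlomilch {α β : ℝ} (hα : 0 < α) (hβ : 0 < β) {f : ℝ → ℝ}
    (hf : Integrable f) :
    IntegrableOn (fun s => (α + β / s ^ 2) * f (α * s - β / s)) (Set.Ioi (0 : ℝ)) := by
  have h := integrableOn_image_iff_integrableOn_abs_deriv_smul measurableSet_Ioi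
    (fun s (hs : s ∈ Set.Ioi (0 : ℝ)) =>
      (hasDerivAt_mul_sub_div α β (ne_of_gt hs)).hasDerivWithinAt)
    (injOn_mul_sub_div hα hβ) f
  rw [image_mul_sub_div_Ioi hα hβ, integrableOn_univ] at h
  refine (h.1 hf).congr_fun (fun s hs => ?_) measurableSet_Ioi
  have hs' : 0 < s := hs
  simp only [smul_eq_mul]
  rw [abs_of_pos (by positivity)]

theorem exp_neg_sq_mul_sub_div {α β s : ℝ} (hs : 0 < s) :
    Real.exp (-(α * s - β / s) ^ 2) =
      Real.exp (2 * α * β) * Real.exp (-(α ^ 2 * s ^ 2) - β ^ 2 / s ^ 2) := by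
  rw [← Real.exp_add]
  congr 1
  field_simp
  ring

theorem integrableOn_exp_neg_sq_sub_div_sq {α : ℝ} (hα : 0 < α) (β : ℝ) :
    IntegrableOn (fun s : ℝ => Real.exp (-(α ^ 2 * s ^ 2) - β ^ 2 / s ^ 2)) (Set.Ioi 0) := by
  have h : Integrable fun s : ℝ => Real.exp (-(α ^ 2) * s ^ 2) :=
    integrable_exp_neg_mul_sq (by positivity)
  refine h.integrableOn.mono' ?_ (ae_of_all _ fun s => ?_)
  · exact Measurable.aestronglyMeasurable (by fun_prop)
  · rw [Real.norm_eq_abs, Real.abs_exp]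
    refine Real.exp_le_exp.2 ?_
    have : 0 ≤ β ^ 2 / s ^ 2 := by positivity
    linarith

/-- The exponent is invariant under `s ↦ β / (α s)`, which exchanges the two integrals. -/
theorem integral_div_sq_mul_exp_eq {α β : ℝ} (hα : 0 < α) (hβ : 0 < β) :
    ∫ s in Set.Ioi (0 : ℝ), β / s ^ 2 * Real.exp (-(α ^ 2 * s ^ 2) - β ^ 2 / s ^ 2) =
      ∫ s in Set.Ioi (0 : ℝ), α * Real.exp (-(α ^ 2 * s ^ 2) - β ^ 2 / s ^ 2) := by
  have himg : (fun s : ℝ => (β / α) * s⁻¹) '' Set.Ioi 0 = Set.Ioi 0 := by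
    ext t
    constructor
    · rintro ⟨s, hs, rfl⟩
      have hs' : 0 < s := hs
      simp only [Set.mem_Ioi]; positivity
    · intro ht
      have ht' : 0 < t := ht
      exact ⟨(β / α) * t⁻¹, by simp only [Set.mem_Ioi]; positivity, by simp only; field_simp⟩
  have h := integral_image_eq_integral_abs_deriv_smul (s := Set.Ioi (0 : ℝ)) measurableSet_Ioi
    (f := fun s : ℝ => (β / α) * s⁻¹) (f' := fun s => (β / α) * (-(s ^ 2)⁻¹))
    (fun s hs => ((hasDerivAt_inv (ne_of_gt hs)).const_mul (β / α)).hasDerivWithinAt)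
    (fun s hs t ht hst => by
      have : β / α ≠ 0 := by positivity
      exact inv_injective (mul_left_cancel₀ this hst))
    (fun s => α * Real.exp (-(α ^ 2 * s ^ 2) - β ^ 2 / s ^ 2))
  rw [himg] at h
  rw [h]
  refine setIntegral_congr_fun measurableSet_Ioi fun s hs => ?_
  have hs' : 0 < s := hs
  simp only [smul_eq_mul]
  rw [mul_neg, abs_neg, abs_of_pos (by positivity), ← mul_assoc]
  congr 1
  · field_simp
  · congr 1
    field_simp
    ring

/-- The subordination integral: it writes `e^{-xΛ} / Λ` as a superposition of Gaussians in `Λ`. -/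
theorem integral_exp_neg_sq_sub_div_sq {α β : ℝ} (hα : 0 < α) (hβ : 0 < β) :
    ∫ s in Set.Ioi (0 : ℝ), Real.exp (-(α ^ 2 * s ^ 2) - β ^ 2 / s ^ 2) =
      Real.sqrt Real.pi / (2 * α) * Real.exp (-(2 * α * β)) := by
  have h1 := integral_Ioi_cauchySchlomilch hα hβ fun w => Real.exp (-w ^ 2)
  have hgi : Integrable fun w : ℝ => Real.exp (-w ^ 2) := by
    simpa using integrable_exp_neg_mul_sq (b := 1) one_pos
  have hI := integrableOn_Ioi_cauchySchlomilch hα hβ hgi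
  have hg : ∫ w : ℝ, Real.exp (-w ^ 2) = Real.sqrt Real.pi := by
    simpa using integral_gaussian 1
  have hi := integrableOn_exp_neg_sq_sub_div_sq hα β
  have e1 : ∀ s ∈ Set.Ioi (0 : ℝ), (α + β / s ^ 2) * Real.exp (-(α * s - β / s) ^ 2) =
      Real.exp (2 * α * β) * (α * Real.exp (-(α ^ 2 * s ^ 2) - β ^ 2 / s ^ 2) +
        β / s ^ 2 * Real.exp (-(α ^ 2 * s ^ 2) - β ^ 2 / s ^ 2)) := fun s hs => by
    rw [exp_neg_sq_mul_sub_div hs]; ring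
  have hi2 : IntegrableOn (fun s : ℝ => β / s ^ 2 *
      Real.exp (-(α ^ 2 * s ^ 2) - β ^ 2 / s ^ 2)) (Set.Ioi 0) := by
    refine IntegrableOn.congr_fun
      ((hI.const_mul (Real.exp (-(2 * α * β)))).sub (hi.const_mul α) :) (fun s hs => ?_)
      measurableSet_Ioi
    simp only [Pi.sub_apply]
    rw [e1 s hs, ← mul_assoc, ← Real.exp_add]
    simp
  rw [setIntegral_congr_fun measurableSet_Ioi e1, integral_const_mul,
    integral_add (hi.const_mul α) hi2, integral_div_sq_mul_exp_eq hα hβ, hg,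
    integral_const_mul] at h1
  rw [Real.exp_neg]
  have := Real.exp_pos (2 * α * β)
  generalize (∫ s in Set.Ioi (0 : ℝ), _ : ℝ) = A at *
  generalize Real.exp (2 * α * β) = B at *
  field_simp
  linarith

theorem integral_inv_sq_mul_exp {α β : ℝ} (hα : 0 < α) (hβ : 0 < β) :
    ∫ s in Set.Ioi (0 : ℝ), (s ^ 2)⁻¹ * Real.exp (-(α ^ 2 * s ^ 2) - β ^ 2 / s ^ 2) =
      Real.sqrt Real.pi / (2 * β) * Real.exp (-(2 * α * β)) := by
  have h := integral_div_sq_mul_exp_eq hα hβ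
  rw [integral_const_mul, integral_exp_neg_sq_sub_div_sq hα hβ] at h
  simp_rw [div_eq_mul_inv, mul_assoc β, integral_const_mul] at h
  have h' := congrArg (fun x => β⁻¹ * x) h
  simp only [inv_mul_cancel_left₀ hβ.ne'] at h'
  simp_rw [div_eq_mul_inv]
  rw [h']
  field_simp

/-- The Macdonald function `K_0`, by the integral representation
`K_0(z) = 2 e^{-z} ∫_0^∞ e^{-w²} (w² + 2z)^{-1/2} dw`, which converges for every `z` off the closed
negative half-line. -/
def macdonald (z : ℂ) : ℂ :=
  2 * Complex.exp (-z) *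
    ∫ w in Set.Ioi (0 : ℝ), Complex.exp (-(w : ℂ) ^ 2) * ((w : ℂ) ^ 2 + 2 * z) ^ (-(1 / 2) : ℂ)

/-- On the positive half-line, `K_0` is the integral over the heat kernel; the substitution
`w = α s - β / s` turns `w² + 4αβ` into `(α s + β / s)²`. -/
theorem macdonald_ofReal {α β : ℝ} (hα : 0 < α) (hβ : 0 < β) :
    macdonald ((2 * α * β : ℝ) : ℂ) =
      ((∫ s in Set.Ioi (0 : ℝ), s⁻¹ * Real.exp (-(α ^ 2 * s ^ 2) - β ^ 2 / s ^ 2) : ℝ) : ℂ) := by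
  set f : ℝ → ℝ := fun w => Real.exp (-w ^ 2) * (w ^ 2 + 2 * (2 * α * β)) ^ (-(1 / 2) : ℝ) with hf
  have h1 := integral_Ioi_cauchySchlomilch hα hβ f
  have e1 : ∀ s ∈ Set.Ioi (0 : ℝ), (α + β / s ^ 2) * f (α * s - β / s) =
      Real.exp (2 * α * β) * (s⁻¹ * Real.exp (-(α ^ 2 * s ^ 2) - β ^ 2 / s ^ 2)) := fun s hs => by
    have hs' : 0 < s := hs
    have e2 : (α * s - β / s) ^ 2 + 2 * (2 * α * β) = (α * s + β / s) ^ 2 := by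
      field_simp; ring
    have e3 : ((α * s + β / s) ^ 2) ^ (-(1 / 2) : ℝ) = (α * s + β / s)⁻¹ := by
      rw [← Real.rpow_natCast, ← Real.rpow_mul (by positivity)]
      norm_num
      rw [Real.rpow_neg_one]
    simp only [hf]
    rw [e2, e3, exp_neg_sq_mul_sub_div hs]
    have : α * s + β / s = s * (α + β / s ^ 2) := by field_simp
    rw [this]
    have : 0 < α + β / s ^ 2 := by positivity
    field_simp
  have h2 : ∫ w, f w = 2 * ∫ w in Set.Ioi (0 : ℝ), f w := by
    rw [← integral_comp_abs]
    simp only [hf, sq_abs]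
  rw [setIntegral_congr_fun measurableSet_Ioi e1, integral_const_mul, h2] at h1
  have h3 : ∫ s in Set.Ioi (0 : ℝ), s⁻¹ * Real.exp (-(α ^ 2 * s ^ 2) - β ^ 2 / s ^ 2) =
      2 * Real.exp (-(2 * α * β)) * ∫ w in Set.Ioi (0 : ℝ), f w := by
    rw [Real.exp_neg]
    have := Real.exp_pos (2 * α * β)
    generalize Real.exp (2 * α * β) = B at *
    rw [mul_assoc, mul_left_comm, ← h1, inv_mul_cancel_left₀ this.ne']
  rw [h3, macdonald]
  push_cast
  congr 1
  rw [← integral_complex_ofReal]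
  refine setIntegral_congr_fun measurableSet_Ioi fun w hw => ?_
  have hw' : 0 < w := hw
  simp only [hf]
  rw [Complex.ofReal_mul, Complex.ofReal_cpow (by positivity)]
  push_cast
  rfl

/-- `(2ir - w²)^{-1/2} = -i (w² - 2ir)^{-1/2}` for the principal branch. -/
theorem neg_cpow_neg_half {y : ℂ} (hy : y.im < 0) :
    (-y) ^ (-(1 / 2) : ℂ) = -Complex.I * y ^ (-(1 / 2) : ℂ) := by
  have hy0 : y ≠ 0 := by rintro rfl; simp at hy
  rw [Complex.cpow_def_of_ne_zero (neg_ne_zero.2 hy0), Complex.cpow_def_of_ne_zero hy0]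
  have : Complex.log (-y) = Complex.log y + Real.pi * Complex.I := by
    simp only [Complex.log, norm_neg, Complex.arg_neg_eq_arg_add_pi_of_im_neg hy]
    push_cast; ring
  rw [this, add_mul, Complex.exp_add, mul_comm]
  congr 1
  rw [show (Real.pi : ℂ) * Complex.I * (-(1 / 2)) = -(Real.pi / 2 * Complex.I) by ring,
    Complex.exp_neg, Complex.exp_pi_div_two_mul_I, Complex.inv_I]

/-- `(i/4) H_0^{(1)}(r) = (1/2π) K_0(-ir)`, by the substitution `τ = w² / r`. -/
theorem hankel_eq_macdonald {r : ℝ} (hr : 0 < r) :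
    Complex.I / 4 * hankel r = (2 * Real.pi)⁻¹ * macdonald (-Complex.I * r) := by
  have himg : (fun w : ℝ => w ^ 2 / r) '' Set.Ioi 0 = Set.Ioi 0 := by
    ext t
    constructor
    · rintro ⟨s, hs, rfl⟩
      have hs' : 0 < s := hs
      simp only [Set.mem_Ioi]; positivity
    · intro ht
      have ht' : 0 < t := ht
      refine ⟨Real.sqrt (r * t), by simp only [Set.mem_Ioi]; positivity, ?_⟩
      simp only
      rw [Real.sq_sqrt (by positivity)]
      field_simp
  have h := integral_image_eq_integral_abs_deriv_smul (s := Set.Ioi (0 : ℝ)) measurableSet_Ioi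
    (f := fun w : ℝ => w ^ 2 / r) (f' := fun w => 2 * w / r)
    (fun w hw => (((hasDerivAt_pow 2 w).div_const r).congr_deriv (by simp)).hasDerivWithinAt)
    (fun s hs t ht hst => by
      have hs' : 0 < s := hs
      have ht' : 0 < t := ht
      have : s ^ 2 = t ^ 2 := by
        simp only at hst
        field_simp at hst
        exact hst
      exact (pow_left_inj₀ hs'.le ht'.le two_ne_zero).1 this)
    (fun τ : ℝ => Complex.exp (-(r * τ : ℝ)) *
      (2 * Complex.I * τ - (τ : ℂ) ^ 2) ^ (-(1 / 2) : ℂ))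
  rw [himg] at h
  rw [hankel, macdonald, h]
  have e : ∀ w ∈ Set.Ioi (0 : ℝ), |2 * w / r| • (Complex.exp (-(r * (w ^ 2 / r) : ℝ)) *
      (2 * Complex.I * ((w ^ 2 / r : ℝ) : ℂ) - ((w ^ 2 / r : ℝ) : ℂ) ^ 2) ^ (-(1 / 2) : ℂ)) =
      (-2 * Complex.I) * (Complex.exp (-(w : ℂ) ^ 2) *
        ((w : ℂ) ^ 2 + 2 * (-Complex.I * r)) ^ (-(1 / 2) : ℂ)) := fun w hw => by
    have hw' : 0 < w := hw
    set y : ℂ := (w : ℂ) ^ 2 + 2 * (-Complex.I * r) with hy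
    have hyim : y.im < 0 := by
      have : y.im = -(2 * r) := by
        rw [hy, ← Complex.ofReal_pow, Complex.add_im, Complex.ofReal_im]; simp
      rw [this]; linarith
    have hy0 : y ≠ 0 := by intro h; rw [h] at hyim; simp at hyim
    have hrC : (r : ℂ) ≠ 0 := by exact_mod_cast hr.ne'
    have e1 : 2 * Complex.I * ((w ^ 2 / r : ℝ) : ℂ) - ((w ^ 2 / r : ℝ) : ℂ) ^ 2 =
        (((w / r) ^ 2 : ℝ) : ℂ) * (-y) := by
      rw [hy]; push_cast; field_simp; ring
    have e2 : ((((w / r) ^ 2 : ℝ) : ℂ) * (-y)) ^ (-(1 / 2) : ℂ) =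
        ((r / w : ℝ) : ℂ) * (-y) ^ (-(1 / 2) : ℂ) := by
      rw [Complex.cpow_def_of_ne_zero (mul_ne_zero (by
          exact_mod_cast (by positivity : (w / r) ^ 2 ≠ 0)) (neg_ne_zero.2 hy0)),
        Complex.log_ofReal_mul (by positivity) (neg_ne_zero.2 hy0), add_mul, Complex.exp_add,
        Complex.cpow_def_of_ne_zero (neg_ne_zero.2 hy0)]
      congr 1
      rw [Real.log_pow, ← Complex.ofReal_one, ← Complex.ofReal_ofNat, ← Complex.ofReal_div,
        ← Complex.ofReal_neg, ← Complex.ofReal_mul, ← Complex.ofReal_exp]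
      congr 1
      rw [show ((2 : ℕ) : ℝ) * Real.log (w / r) * -(1 / 2) = -Real.log (w / r) by push_cast; ring,
        Real.exp_neg, Real.exp_log (by positivity), inv_div]
    rw [e1, e2, neg_cpow_neg_half hyim, abs_of_pos (by positivity), Complex.real_smul]
    have e3 : r * (w ^ 2 / r) = w ^ 2 := by field_simp
    have hwC : (w : ℂ) ≠ 0 := by exact_mod_cast hw'.ne'
    rw [e3]
    push_cast
    field_simp
  rw [setIntegral_congr_fun measurableSet_Ioi e, integral_const_mul]
  have hpi : (Real.pi : ℂ) ≠ 0 := by exact_mod_cast Real.pi_ne_zero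
  rw [show -(-Complex.I * (r : ℂ)) = Complex.I * r by ring]
  generalize (∫ w in Set.Ioi (0 : ℝ), _ : ℂ) = A
  push_cast
  field_simp
  rw [Complex.I_sq]
  ring

/-! ### Holomorphic dependence of integrals on a parameter -/

/-- An integral whose integrand is holomorphic in a parameter and locally uniformly dominated is
holomorphic in the parameter: Cauchy's estimate dominates the derivative of the integrand. -/
theorem differentiableOn_integral_of_dominated {α : Type*} [MeasurableSpace α] {μ : Measure α}
    {U : Set ℂ} (hU : IsOpen U) {F : ℂ → α → ℂ} (hm : ∀ z ∈ U, AEStronglyMeasurable (F z) μ)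
    (hd : ∀ᵐ a ∂μ, DifferentiableOn ℂ (fun z => F z a) U)
    (hb : ∀ z₀ ∈ U, ∃ ε > 0, ∃ bound : α → ℝ, Integrable bound μ ∧
      ∀ᵐ a ∂μ, ∀ z ∈ Metric.ball z₀ ε, ‖F z a‖ ≤ bound a) :
    DifferentiableOn ℂ (fun z => ∫ a, F z a ∂μ) U := by
  intro z₀ hz₀
  obtain ⟨ε₁, hε₁, bound, hbi, hbd⟩ := hb z₀ hz₀
  obtain ⟨ε₂, hε₂, hball⟩ := Metric.isOpen_iff.1 hU z₀ hz₀
  set ε := min ε₁ ε₂ with hε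
  have hε0 : 0 < ε := lt_min hε₁ hε₂
  have hsub : Metric.ball z₀ ε ⊆ U := (Metric.ball_subset_ball (min_le_right _ _)).trans hball
  have hnear : ∀ z ∈ Metric.ball z₀ (ε / 2), Metric.closedBall z (ε / 4) ⊆ Metric.ball z₀ ε := by
    intro z hz w hw
    rw [Metric.mem_ball] at hz ⊢
    rw [Metric.mem_closedBall] at hw
    linarith [dist_triangle w z z₀]
  have hderiv : ∀ᵐ a ∂μ, ∀ z ∈ Metric.ball z₀ (ε / 2),
      HasDerivAt (fun z => F z a) (deriv (fun z => F z a) z) z := by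
    filter_upwards [hd] with a ha z hz
    have hzU : z ∈ U := hsub (Metric.ball_subset_ball (by linarith) hz)
    exact ((ha z hzU).differentiableAt (hU.mem_nhds hzU)).hasDerivAt
  refine (hasDerivAt_integral_of_dominated_loc_of_deriv_le (μ := μ)
    (F' := fun z a => deriv (fun z => F z a) z) (bound := fun a => bound a / (ε / 4))
    (Metric.ball_mem_nhds z₀ (half_pos hε0)) ?_ ?_ ?_ ?_ (hbi.div_const _)
    hderiv).2.differentiableAt.differentiableWithinAt
  · filter_upwards [hU.mem_nhds hz₀] with z hz using hm z hz
  · exact hbi.mono' (hm z₀ hz₀) (hbd.mono fun a ha => ha z₀ (Metric.mem_ball_self hε₁))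
  · -- the derivative is an almost everywhere limit of difference quotients
    set u : ℕ → ℂ := fun n => z₀ + ((ε / 2 * (n + 1 : ℝ)⁻¹ : ℝ) : ℂ) with hu
    have hpos : ∀ n : ℕ, 0 < ε / 2 * (n + 1 : ℝ)⁻¹ := fun n => by positivity
    have huU : ∀ n, u n ∈ U := fun n => hsub (by
      rw [Metric.mem_ball, hu, dist_eq_norm, add_sub_cancel_left, Complex.norm_real,
        Real.norm_of_nonneg (hpos n).le]
      have : ((n : ℝ) + 1)⁻¹ ≤ 1 := inv_le_one_of_one_le₀ (by linarith [n.cast_nonneg (α := ℝ)])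
      nlinarith)
    have hlim : Tendsto u atTop (𝓝[≠] z₀) := by
      refine tendsto_nhdsWithin_iff.2 ⟨?_, Eventually.of_forall fun n => ?_⟩
      · have h1 : Tendsto (fun n : ℕ => ε / 2 * (n + 1 : ℝ)⁻¹) atTop (𝓝 (ε / 2 * 0)) :=
          (tendsto_inv_atTop_zero.comp (tendsto_atTop_add_const_right _ 1
            tendsto_natCast_atTop_atTop)).const_mul _
        have h2 := (Complex.continuous_ofReal.tendsto _).comp h1
        simpa [hu, Function.comp_def] using h2.const_add z₀
      · have : ((ε / 2 * (n + 1 : ℝ)⁻¹ : ℝ) : ℂ) ≠ 0 := by exact_mod_cast (hpos n).ne'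
        simpa only [hu, Set.mem_compl_iff, Set.mem_singleton_iff, add_eq_left] using this
    refine aestronglyMeasurable_of_tendsto_ae (u := atTop)
      (f := fun n a => slope (fun z => F z a) z₀ (u n)) (fun n => ?_) ?_
    · simp only [slope_def_module]
      exact ((hm _ (huU n)).sub (hm _ hz₀)).const_smul (u n - z₀)⁻¹
    · filter_upwards [hderiv] with a ha
      exact (hasDerivAt_iff_tendsto_slope.1
        (ha z₀ (Metric.mem_ball_self (half_pos hε0)))).comp hlim
  · filter_upwards [hd, hbd] with a ha hba z hz
    refine Complex.norm_deriv_le_of_forall_mem_sphere_norm_le (by positivity) ?_ fun w hw => ?_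
    · exact (ha.mono ((hnear z hz).trans hsub)).diffContOnCl_ball subset_rfl
    · exact hba w (Metric.ball_subset_ball (min_le_left _ _)
        (hnear z hz (Metric.sphere_subset_closedBall hw)))

theorem add_two_mul_mem_slitPlane {z : ℂ} (hz : z ∈ Complex.slitPlane) (w : ℝ) :
    (w : ℂ) ^ 2 + 2 * z ∈ Complex.slitPlane := by
  have hre : ((w : ℂ) ^ 2 + 2 * z).re = w ^ 2 + 2 * z.re := by
    rw [← Complex.ofReal_pow, Complex.add_re, Complex.ofReal_re]; simp
  have him : ((w : ℂ) ^ 2 + 2 * z).im = 2 * z.im := by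
    rw [← Complex.ofReal_pow, Complex.add_im, Complex.ofReal_im]; simp
  rw [Complex.mem_slitPlane_iff, hre, him] at *
  rcases hz with h | h
  · left; positivity
  · right; simpa using h

theorem differentiableOn_macdonald : DifferentiableOn ℂ macdonald Complex.slitPlane := by
  have hE : DifferentiableOn ℂ (fun z : ℂ => 2 * Complex.exp (-z)) Complex.slitPlane := by fun_prop
  refine hE.mul ?_
  refine differentiableOn_integral_of_dominated
    (F := fun z (w : ℝ) => Complex.exp (-(w : ℂ) ^ 2) * ((w : ℂ) ^ 2 + 2 * z) ^ (-(1 / 2) : ℂ))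
    Complex.isOpen_slitPlane (fun z hz => ?_) (ae_of_all _ fun w z hz => ?_) (fun z₀ hz₀ => ?_)
  · refine Continuous.aestronglyMeasurable ?_
    refine Continuous.mul (by fun_prop) (continuous_iff_continuousAt.2 fun w => ?_)
    exact ContinuousAt.cpow (by fun_prop) continuousAt_const (add_two_mul_mem_slitPlane hz w)
  · refine DifferentiableAt.differentiableWithinAt ?_
    refine DifferentiableAt.const_mul ?_ _
    exact DifferentiableAt.cpow (by fun_prop) (by fun_prop) (add_two_mul_mem_slitPlane hz w)
  · obtain ⟨δ, hδ, hball⟩ := Metric.isOpen_iff.1 Complex.isOpen_slitPlane z₀ hz₀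
    refine ⟨δ / 2, half_pos hδ, fun w => Real.exp (-1 * w ^ 2) * δ ^ (-(1 / 2) : ℝ),
      ((integrable_exp_neg_mul_sq one_pos).mul_const _).integrableOn,
      ae_of_all _ fun w z hz => ?_⟩
    -- `-w²/2` is off the slit plane, hence at distance at least `δ` from `z₀`
    have hfar : δ ≤ ‖((-(w ^ 2 / 2) : ℝ) : ℂ) - z₀‖ := by
      by_contra! h
      have := hball (a := ((-(w ^ 2 / 2) : ℝ) : ℂ)) (by rwa [Metric.mem_ball, dist_eq_norm])
      rw [Complex.ofReal_mem_slitPlane] at this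
      linarith [sq_nonneg w]
    have hz' : ‖z - z₀‖ < δ / 2 := by rwa [Metric.mem_ball, dist_eq_norm] at hz
    have e : (w : ℂ) ^ 2 + 2 * z = -2 * ((((-(w ^ 2 / 2) : ℝ) : ℂ) - z₀) - (z - z₀)) := by
      push_cast; ring
    have hlow : δ ≤ ‖(w : ℂ) ^ 2 + 2 * z‖ := by
      rw [e, norm_mul]
      have := norm_sub_norm_le (((-(w ^ 2 / 2) : ℝ) : ℂ) - z₀) (z - z₀)
      rw [norm_neg, Complex.norm_ofNat]
      linarith
    rw [norm_mul, Complex.norm_exp]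
    refine mul_le_mul ?_ ?_ (norm_nonneg _) (Real.exp_pos _).le
    · rw [← Complex.ofReal_pow, Complex.neg_re, Complex.ofReal_re]; simp
    · rw [show (-(1 / 2) : ℂ) = ((-(1 / 2) : ℝ) : ℂ) by push_cast; rfl, Complex.norm_cpow_real]
      exact Real.rpow_le_rpow_of_nonpos hδ hlow (by norm_num)

/-- The radial profile of the fundamental solution: with `ρ = |x - y|`, the fundamental solution of
`κ² - Δ` in `ℝ^{d+1}` is `κ^{d-1} profile d (κ ρ)`. -/
def profile (d : ℕ) (z : ℂ) : ℂ :=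
  if d = 2 then Complex.exp (-z) / (4 * Real.pi * z) else (2 * Real.pi : ℂ)⁻¹ * macdonald z

theorem differentiableOn_profile (d : ℕ) : DifferentiableOn ℂ (profile d) Complex.slitPlane := by
  have hpi : (Real.pi : ℂ) ≠ 0 := by exact_mod_cast Real.pi_ne_zero
  by_cases h : d = 2
  · have : profile d = fun z => Complex.exp (-z) / (4 * Real.pi * z) := by
      ext z; simp only [profile, if_pos h]
    rw [this]
    refine DifferentiableOn.div (by fun_prop) (by fun_prop) fun z hz => ?_
    have := Complex.slitPlane_ne_zero hz
    simp [hpi, this]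
  · have : profile d = fun z => (2 * Real.pi : ℂ)⁻¹ * macdonald z := by
      ext z; simp only [profile, if_neg h]
    rw [this]
    exact differentiableOn_macdonald.const_mul _

theorem neg_I_mul_mem_slitPlane {r : ℝ} (hr : 0 < r) : -Complex.I * r ∈ Complex.slitPlane := by
  rw [Complex.mem_slitPlane_iff]
  right
  simpa using hr.ne'

/-- The fundamental solution as a function of the distance. -/
theorem fundSol_eq_profile {d : ℕ} (hd : d = 1 ∨ d = 2) {k : ℝ} (hk : 0 < k) {x y : Amb d}
    (hxy : 0 < edist2 x y) :
    fundSol k x y =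
      (-Complex.I * k) ^ (d - 1) * profile d (-Complex.I * (k * edist2 x y : ℝ)) := by
  have hpi : (Real.pi : ℂ) ≠ 0 := by exact_mod_cast Real.pi_ne_zero
  have hk' : (k : ℂ) ≠ 0 := by exact_mod_cast hk.ne'
  have hr : ((edist2 x y : ℝ) : ℂ) ≠ 0 := by exact_mod_cast hxy.ne'
  rcases hd with rfl | rfl
  · rw [fundSol, if_neg (by norm_num), hankel_eq_macdonald (by positivity), profile,
      if_neg (by norm_num)]
    simp
  · rw [fundSol, if_pos rfl, profile, if_pos rfl]
    simp only [Nat.add_one_sub_one, pow_one, neg_mul, neg_neg]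
    generalize Complex.exp _ = X
    push_cast
    have := Complex.I_ne_zero
    field_simp

/-! ### The Fourier representation of the normal derivative of the fundamental solution -/

theorem integrable_exp_neg_mul_norm {d : ℕ} {c : ℝ} (hc : 0 < c) :
    Integrable fun ξ : Hyp d => Real.exp (-(c * ‖ξ‖)) := by
  have h := (integrable_one_add_norm (E := Hyp d) (μ := volume) (r := ((d + 1 : ℕ) : ℝ))
    (by simp)).const_mul (Real.exp c * ((d + 1).factorial / c ^ (d + 1)))
  refine h.mono' (Continuous.aestronglyMeasurable (by fun_prop)) (ae_of_all _ fun ξ => ?_)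
  have hy : 0 < 1 + ‖ξ‖ := by positivity
  have h1 := Real.pow_div_factorial_le_exp (c * (1 + ‖ξ‖)) (by positivity) (d + 1)
  rw [Real.norm_eq_abs, Real.abs_exp, Real.rpow_neg hy.le, Real.rpow_natCast]
  have e : Real.exp (c * (1 + ‖ξ‖)) = Real.exp c * Real.exp (c * ‖ξ‖) := by
    rw [← Real.exp_add]; ring_nf
  rw [e, mul_pow, div_le_iff₀ (by positivity)] at h1
  rw [Real.exp_neg, ← div_eq_mul_inv, le_div_iff₀ (by positivity), ← div_eq_inv_mul,
    div_le_iff₀ (by positivity)]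
  have hcp : 0 < c ^ (d + 1) := by positivity
  calc (1 + ‖ξ‖) ^ (d + 1) = (c ^ (d + 1) * (1 + ‖ξ‖) ^ (d + 1)) / c ^ (d + 1) := by field_simp
    _ ≤ (Real.exp c * Real.exp (c * ‖ξ‖) * (d + 1).factorial) / c ^ (d + 1) := by gcongr
    _ = _ := by ring

theorem norm_fourierChar_smul (t : ℝ) (z : ℂ) : ‖Real.fourierChar t • z‖ = ‖z‖ := by
  rw [Circle.smul_def, norm_smul, Circle.norm_coe, one_mul]

/-- `√(4π²|ξ|² + κ²)` for real `κ`. -/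
def realSymbol {d : ℕ} (κ : ℝ) (ξ : Hyp d) : ℝ := Real.sqrt ((2 * Real.pi * ‖ξ‖) ^ 2 + κ ^ 2)

theorem realSymbol_pos {d : ℕ} {κ : ℝ} (hκ : 0 < κ) (ξ : Hyp d) : 0 < realSymbol κ ξ :=
  Real.sqrt_pos.2 (by positivity)

theorem sq_realSymbol {d : ℕ} (κ : ℝ) (ξ : Hyp d) :
    realSymbol κ ξ ^ 2 = (2 * Real.pi * ‖ξ‖) ^ 2 + κ ^ 2 := Real.sq_sqrt (by positivity)

theorem le_realSymbol {d : ℕ} (κ : ℝ) (ξ : Hyp d) : 2 * Real.pi * ‖ξ‖ ≤ realSymbol κ ξ :=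
  Real.le_sqrt_of_sq_le (by nlinarith [sq_nonneg κ])

theorem le_realSymbol' {d : ℕ} (κ : ℝ) (ξ : Hyp d) : κ ≤ realSymbol κ ξ :=
  Real.le_sqrt_of_sq_le (by nlinarith [sq_nonneg (2 * Real.pi * ‖ξ‖)])

theorem continuous_realSymbol {d : ℕ} (κ : ℝ) : Continuous (realSymbol (d := d) κ) := by
  unfold realSymbol; fun_prop

theorem integrable_exp_realSymbol {d : ℕ} (κ : ℝ) {x : ℝ} (hx : 0 < x) :
    Integrable fun ξ : Hyp d => Real.exp (-(x * realSymbol κ ξ)) := by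
  have h := integrable_exp_neg_mul_norm (d := d) (c := x * (2 * Real.pi)) (by positivity)
  refine h.mono' (Continuous.aestronglyMeasurable ?_) (ae_of_all _ fun ξ => ?_)
  · have := continuous_realSymbol (d := d) κ
    fun_prop
  · rw [Real.norm_eq_abs, Real.abs_exp]
    refine Real.exp_le_exp.2 (neg_le_neg ?_)
    rw [mul_assoc]
    exact mul_le_mul_of_nonneg_left (le_realSymbol κ ξ) hx.le

theorem integrable_exp_realSymbol_div {d : ℕ} {κ : ℝ} (hκ : 0 < κ) {x : ℝ} (hx : 0 < x) :
    Integrable fun ξ : Hyp d => Real.exp (-(x * realSymbol κ ξ)) / (2 * realSymbol κ ξ) := by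
  have hc := continuous_realSymbol (d := d) κ
  refine ((integrable_exp_realSymbol (d := d) κ hx).div_const (2 * κ)).mono'
    (Continuous.aestronglyMeasurable ?_) (ae_of_all _ fun ξ => ?_)
  · exact Continuous.div (by fun_prop) (by fun_prop) fun ξ => by
      have := realSymbol_pos hκ ξ; positivity
  · have h1 := realSymbol_pos hκ ξ
    have h2 := le_realSymbol' κ ξ
    rw [Real.norm_of_nonneg (by positivity)]
    gcongr

theorem fourierInv_gaussian {d : ℕ} {s : ℝ} (hs : 0 < s) (y : Hyp d) :
    ∫ ξ : Hyp d, Real.fourierChar (inner ℝ ξ y) •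
        ((Real.exp (-((2 * Real.pi * ‖ξ‖) ^ 2 * s ^ 2)) : ℝ) : ℂ) =
      (((1 / (4 * Real.pi * s ^ 2)) ^ ((d : ℝ) / 2) *
        Real.exp (-(‖y‖ ^ 2 / (4 * s ^ 2))) : ℝ) : ℂ) := by
  have hb : 0 < ((4 * Real.pi ^ 2 * s ^ 2 : ℝ) : ℂ).re := by
    rw [Complex.ofReal_re]; positivity
  have h := fourier_gaussian_innerProductSpace hb (-y)
  rw [← Real.fourierInv_eq_fourier_neg, Real.fourierInv_eq] at h
  have hsC : (s : ℂ) ≠ 0 := by exact_mod_cast hs.ne'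
  have hpi : (Real.pi : ℂ) ≠ 0 := by exact_mod_cast Real.pi_ne_zero
  rw [show (∫ ξ : Hyp d, Real.fourierChar (inner ℝ ξ y) •
      ((Real.exp (-((2 * Real.pi * ‖ξ‖) ^ 2 * s ^ 2)) : ℝ) : ℂ)) =
      ∫ ξ : Hyp d, Real.fourierChar (inner ℝ ξ y) •
        Complex.exp (-((4 * Real.pi ^ 2 * s ^ 2 : ℝ) : ℂ) * ‖ξ‖ ^ 2) from ?_, h]
  · rw [Complex.ofReal_mul ((1 / (4 * Real.pi * s ^ 2)) ^ ((d : ℝ) / 2)),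
      Complex.ofReal_cpow (by positivity), Complex.ofReal_exp]
    simp only [finrank_euclideanSpace, Fintype.card_fin, norm_neg]
    congr 1
    · push_cast
      congr 1
      field_simp
    · congr 1
      push_cast
      field_simp
  · congr 1
    ext ξ
    congr 1
    rw [Complex.ofReal_exp]
    congr 1
    push_cast
    ring

/-- The heat kernel representation of the fundamental solution of `κ² - Δ` in `ℝ^{d+1}` at distance
`ρ`, with `s²` the time variable. -/
def heatIntegral (d : ℕ) (κ ρ : ℝ) : ℝ :=
  ∫ s in Set.Ioi (0 : ℝ), (Real.sqrt Real.pi)⁻¹ * (1 / (4 * Real.pi * s ^ 2)) ^ ((d : ℝ) / 2) *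
    Real.exp (-(κ ^ 2 * s ^ 2) - (ρ / 2) ^ 2 / s ^ 2)

theorem exp_realSymbol_div_eq {d : ℕ} {κ : ℝ} (hκ : 0 < κ) {x : ℝ} (hx : 0 < x) (ξ : Hyp d) :
    Real.exp (-(x * realSymbol κ ξ)) / (2 * realSymbol κ ξ) =
      ∫ s in Set.Ioi (0 : ℝ), (Real.sqrt Real.pi)⁻¹ *
        Real.exp (-(realSymbol κ ξ ^ 2 * s ^ 2) - (x / 2) ^ 2 / s ^ 2) := by
  have hΛ := realSymbol_pos hκ ξ
  rw [integral_const_mul, integral_exp_neg_sq_sub_div_sq hΛ (half_pos hx)]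
  have : Real.sqrt Real.pi ≠ 0 := by positivity
  rw [show -(x * realSymbol κ ξ) = -(2 * realSymbol κ ξ * (x / 2)) by ring]
  field_simp

/-- The partial Fourier transform of the fundamental solution of `κ² - Δ` is `e^{-xΛ} / (2Λ)`, for
real `κ`: both sides are superpositions of Gaussians. -/
theorem fourierInv_exp_realSymbol_div {d : ℕ} {κ : ℝ} (hκ : 0 < κ) {x : ℝ} (hx : 0 < x)
    (y : Hyp d) :
    ∫ ξ : Hyp d, Real.fourierChar (inner ℝ ξ y) •
        ((Real.exp (-(x * realSymbol κ ξ)) / (2 * realSymbol κ ξ) : ℝ) : ℂ) =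
      (heatIntegral d κ (Real.sqrt (‖y‖ ^ 2 + x ^ 2)) : ℂ) := by
  set G : Hyp d → ℝ → ℝ := fun ξ s => (Real.sqrt Real.pi)⁻¹ *
    Real.exp (-(realSymbol κ ξ ^ 2 * s ^ 2) - (x / 2) ^ 2 / s ^ 2) with hG
  have hGnn : ∀ ξ s, 0 ≤ G ξ s := fun ξ s => by simp only [hG]; positivity
  have hGi : ∀ ξ, IntegrableOn (G ξ) (Set.Ioi 0) := fun ξ =>
    (integrableOn_exp_neg_sq_sub_div_sq (realSymbol_pos hκ ξ) (x / 2)).const_mul _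
  have hc := continuous_realSymbol (d := d) κ
  have hGm : Measurable (Function.uncurry G) := by
    have := hc.measurable
    simp only [hG, Function.uncurry_def]
    fun_prop
  have hGp : Integrable (Function.uncurry G) (volume.prod (volume.restrict (Set.Ioi 0))) := by
    refine (integrable_prod_iff hGm.aestronglyMeasurable).2 ⟨ae_of_all _ hGi, ?_⟩
    refine (integrable_exp_realSymbol_div (d := d) hκ hx).congr (ae_of_all _ fun ξ => ?_)
    simp only [Function.uncurry_apply_pair]
    rw [exp_realSymbol_div_eq hκ hx]
    refine integral_congr_ae (ae_of_all _ fun s => ?_)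
    simp only [Real.norm_of_nonneg (hGnn ξ s)]
    rfl
  have hFp : Integrable (Function.uncurry fun (ξ : Hyp d) (s : ℝ) =>
      Real.fourierChar (inner ℝ ξ y) • (G ξ s : ℂ)) (volume.prod (volume.restrict (Set.Ioi 0))) := by
    refine hGp.mono' ?_ (ae_of_all _ fun p => ?_)
    · have h1 : Measurable fun p : Hyp d × ℝ => ((Function.uncurry G p : ℝ) : ℂ) :=
        Complex.measurable_ofReal.comp hGm
      have h2 : Continuous fun p : Hyp d × ℝ => ((Real.fourierChar (inner ℝ p.1 y) : Circle) : ℂ) := by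
        fun_prop
      exact (h2.measurable.mul h1).aestronglyMeasurable
    · simp only [Function.uncurry_def, norm_fourierChar_smul, Complex.norm_real,
        Real.norm_of_nonneg (hGnn _ _), le_refl]
  have e1 : ∀ ξ : Hyp d, Real.fourierChar (inner ℝ ξ y) •
      ((Real.exp (-(x * realSymbol κ ξ)) / (2 * realSymbol κ ξ) : ℝ) : ℂ) =
      ∫ s in Set.Ioi (0 : ℝ), Real.fourierChar (inner ℝ ξ y) • (G ξ s : ℂ) := fun ξ => by
    rw [exp_realSymbol_div_eq hκ hx, ← integral_complex_ofReal, Circle.smul_def, ← integral_smul]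
    rfl
  simp_rw [e1]
  rw [integral_integral_swap hFp, heatIntegral, ← integral_complex_ofReal]
  refine setIntegral_congr_fun measurableSet_Ioi fun s hs => ?_
  have hs' : 0 < s := hs
  have e2 : ∀ ξ : Hyp d, Real.fourierChar (inner ℝ ξ y) • (G ξ s : ℂ) =
      (((Real.sqrt Real.pi)⁻¹ * Real.exp (-(κ ^ 2 * s ^ 2) - (x / 2) ^ 2 / s ^ 2) : ℝ) : ℂ) *
        (Real.fourierChar (inner ℝ ξ y) •
          ((Real.exp (-((2 * Real.pi * ‖ξ‖) ^ 2 * s ^ 2)) : ℝ) : ℂ)) := fun ξ => by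
    rw [mul_smul_comm, ← Complex.ofReal_mul, mul_assoc, ← Real.exp_add]
    simp only [hG]
    rw [sq_realSymbol, show -(((2 * Real.pi * ‖ξ‖) ^ 2 + κ ^ 2) * s ^ 2) - (x / 2) ^ 2 / s ^ 2 =
      -(κ ^ 2 * s ^ 2) - (x / 2) ^ 2 / s ^ 2 + -((2 * Real.pi * ‖ξ‖) ^ 2 * s ^ 2) by ring]
  simp only [e2]
  rw [integral_const_mul, fourierInv_gaussian hs', ← Complex.ofReal_mul]
  congr 1
  rw [div_pow (Real.sqrt _), Real.sq_sqrt (by positivity)]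
  have e3 : Real.exp (-(κ ^ 2 * s ^ 2) - (‖y‖ ^ 2 + x ^ 2) / 2 ^ 2 / s ^ 2) =
      Real.exp (-(κ ^ 2 * s ^ 2) - (x / 2) ^ 2 / s ^ 2) *
        Real.exp (-(‖y‖ ^ 2 / (4 * s ^ 2))) := by
    rw [← Real.exp_add]
    congr 1
    field_simp
    ring
  rw [e3]
  ring

/-- The heat kernel integral is a Macdonald function for `d = 1` and elementary for `d = 2`. -/
theorem heatIntegral_eq_profile {d : ℕ} (hd : d = 1 ∨ d = 2) {κ ρ : ℝ} (hκ : 0 < κ) (hρ : 0 < ρ) :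
    (heatIntegral d κ ρ : ℂ) = (κ : ℂ) ^ (d - 1) * profile d ((κ * ρ : ℝ) : ℂ) := by
  have hpi := Real.pi_pos
  have hsq : Real.sqrt Real.pi * Real.sqrt Real.pi = Real.pi := Real.mul_self_sqrt hpi.le
  have hsq0 : Real.sqrt Real.pi ≠ 0 := by positivity
  rcases hd with rfl | rfl
  · rw [profile, if_neg (by norm_num), show κ * ρ = 2 * κ * (ρ / 2) by ring,
      macdonald_ofReal hκ (half_pos hρ), Nat.sub_self, pow_zero, one_mul]
    rw [show (2 * Real.pi : ℂ)⁻¹ = (((2 * Real.pi)⁻¹ : ℝ) : ℂ) by push_cast; rfl,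
      ← Complex.ofReal_mul, ← integral_const_mul, heatIntegral]
    congr 1
    refine setIntegral_congr_fun measurableSet_Ioi fun s hs => ?_
    have hs' : 0 < s := hs
    rw [← mul_assoc]
    congr 1
    rw [show ((1 : ℕ) : ℝ) / 2 = 1 / 2 by norm_num, ← Real.sqrt_eq_rpow,
      show 1 / (4 * Real.pi * s ^ 2) = (1 / (2 * Real.sqrt Real.pi * s)) ^ 2 by
        field_simp; rw [Real.sq_sqrt hpi.le]; ring,
      Real.sqrt_sq (by positivity)]
    field_simp
    linear_combination (-1 : ℝ) * hsq
  · rw [profile, if_pos rfl]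
    have h := integral_inv_sq_mul_exp hκ (half_pos hρ)
    have e : heatIntegral 2 κ ρ = ((Real.sqrt Real.pi)⁻¹ * (1 / (4 * Real.pi))) *
        ∫ s in Set.Ioi (0 : ℝ), (s ^ 2)⁻¹ *
          Real.exp (-(κ ^ 2 * s ^ 2) - (ρ / 2) ^ 2 / s ^ 2) := by
      rw [heatIntegral, ← integral_const_mul]
      refine setIntegral_congr_fun measurableSet_Ioi fun s hs => ?_
      have hs' : 0 < s := hs
      rw [show ((2 : ℕ) : ℝ) / 2 = 1 by norm_num, Real.rpow_one, ← mul_assoc]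
      congr 1
      field_simp
    rw [e, h, show 2 * κ * (ρ / 2) = κ * ρ by ring]
    have hκC : (κ : ℂ) ≠ 0 := by exact_mod_cast hκ.ne'
    have hρC : (ρ : ℂ) ≠ 0 := by exact_mod_cast hρ.ne'
    have hpiC : (Real.pi : ℂ) ≠ 0 := by exact_mod_cast hpi.ne'
    have hsqC : ((Real.sqrt Real.pi : ℝ) : ℂ) ≠ 0 := by exact_mod_cast hsq0
    push_cast
    field_simp

theorem hasDerivAt_sqrt_add_sq {c x : ℝ} (hx : 0 < x) :
    HasDerivAt (fun t : ℝ => Real.sqrt (c ^ 2 + t ^ 2)) (x / Real.sqrt (c ^ 2 + x ^ 2)) x := by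
  have h0 : c ^ 2 + x ^ 2 ≠ 0 := by positivity
  have h := ((hasDerivAt_pow 2 x).const_add (c ^ 2)).sqrt h0
  refine h.congr_deriv ?_
  have : Real.sqrt (c ^ 2 + x ^ 2) ≠ 0 := by positivity
  field_simp
  norm_num

/-- The formula of `fourierInv_exp_realSymbol_div`, differentiated in `x`. -/
theorem fourierInv_exp_realSymbol {d : ℕ} (hd : d = 1 ∨ d = 2) {κ : ℝ} (hκ : 0 < κ) {x : ℝ}
    (hx : 0 < x) (y : Hyp d) :
    ∫ ξ : Hyp d, Real.fourierChar (inner ℝ ξ y) • ((Real.exp (-(x * realSymbol κ ξ)) : ℝ) : ℂ) =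
      -2 * (κ : ℂ) ^ d * deriv (profile d) (κ * Real.sqrt (‖y‖ ^ 2 + x ^ 2) : ℝ) *
        (x / Real.sqrt (‖y‖ ^ 2 + x ^ 2) : ℝ) := by
  have hc := continuous_realSymbol (d := d) κ
  set F : ℝ → Hyp d → ℂ := fun t ξ => Real.fourierChar (inner ℝ ξ y) •
    ((Real.exp (-(t * realSymbol κ ξ)) / (2 * realSymbol κ ξ) : ℝ) : ℂ) with hF
  set F' : ℝ → Hyp d → ℂ := fun t ξ => Real.fourierChar (inner ℝ ξ y) •
    ((-(Real.exp (-(t * realSymbol κ ξ)) / 2) : ℝ) : ℂ) with hF'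
  have hFc : ∀ t, Continuous (F t) := fun t => by
    have h1 : Continuous fun ξ : Hyp d =>
        Real.exp (-(t * realSymbol κ ξ)) / (2 * realSymbol κ ξ) :=
      Continuous.div (by fun_prop) (by fun_prop) fun ξ => by
        have := realSymbol_pos hκ ξ; positivity
    simp only [hF, Circle.smul_def]
    fun_prop
  have hd1 : HasDerivAt (fun t => ∫ ξ, F t ξ) (∫ ξ, F' x ξ) x := by
    refine (hasDerivAt_integral_of_dominated_loc_of_deriv_le (μ := volume) (F' := F')
      (bound := fun ξ => Real.exp (-(x / 2 * realSymbol κ ξ)))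
      (Metric.ball_mem_nhds x (half_pos hx)) (Eventually.of_forall fun t =>
        (hFc t).aestronglyMeasurable) ?_ ?_ ?_ (integrable_exp_realSymbol κ (half_pos hx)) ?_).2
    · refine (integrable_exp_realSymbol_div (d := d) hκ hx).mono' (hFc x).aestronglyMeasurable
        (ae_of_all _ fun ξ => ?_)
      have := realSymbol_pos hκ ξ
      rw [hF, norm_fourierChar_smul, Complex.norm_real, Real.norm_of_nonneg (by positivity)]
    · refine Continuous.aestronglyMeasurable ?_
      simp only [hF', Circle.smul_def]
      fun_prop
    · refine ae_of_all _ fun ξ t ht => ?_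
      have hΛ := realSymbol_pos hκ ξ
      rw [hF', norm_fourierChar_smul, Complex.norm_real, norm_neg,
        Real.norm_of_nonneg (by positivity)]
      have hE : Real.exp (-(t * realSymbol κ ξ)) ≤ Real.exp (-(x / 2 * realSymbol κ ξ)) := by
        refine Real.exp_le_exp.2 (neg_le_neg (mul_le_mul_of_nonneg_right ?_ hΛ.le))
        rw [Metric.mem_ball, Real.dist_eq] at ht
        linarith [neg_abs_le (t - x)]
      linarith [Real.exp_pos (-(t * realSymbol κ ξ))]
    · refine ae_of_all _ fun ξ t _ => ?_
      have hΛ := realSymbol_pos hκ ξ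
      have h1 : HasDerivAt (fun t : ℝ => Real.exp (-(t * realSymbol κ ξ)) / (2 * realSymbol κ ξ))
          (-(Real.exp (-(t * realSymbol κ ξ)) / 2)) t := by
        have := ((((hasDerivAt_id t).mul_const (realSymbol κ ξ)).neg).exp).div_const
          (2 * realSymbol κ ξ)
        refine this.congr_deriv ?_
        simp only [id_eq, Pi.neg_apply]
        field_simp
      simp only [hF, hF', Circle.smul_def, smul_eq_mul]
      exact h1.ofReal_comp.const_mul _
  set ρ := Real.sqrt (‖y‖ ^ 2 + x ^ 2) with hρ
  have hρ0 : 0 < ρ := Real.sqrt_pos.2 (by positivity)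
  have hmem : ((κ * ρ : ℝ) : ℂ) ∈ Complex.slitPlane :=
    Complex.ofReal_mem_slitPlane.2 (by positivity)
  have hd2 : HasDerivAt (fun t => ∫ ξ, F t ξ)
      ((κ : ℂ) ^ (d - 1) * (((κ * (x / ρ) : ℝ) : ℂ) • deriv (profile d) (κ * ρ : ℝ))) x := by
    have h1 : HasDerivAt (fun t : ℝ => ((κ * Real.sqrt (‖y‖ ^ 2 + t ^ 2) : ℝ) : ℂ))
        ((κ * (x / ρ) : ℝ) : ℂ) x := ((hasDerivAt_sqrt_add_sq hx).const_mul κ).ofReal_comp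
    have h2 : HasDerivAt (profile d) (deriv (profile d) (κ * ρ : ℝ)) (κ * ρ : ℝ) :=
      ((differentiableOn_profile d _ hmem).differentiableAt
        (Complex.isOpen_slitPlane.mem_nhds hmem)).hasDerivAt
    have h3 := (HasDerivAt.scomp x h2 h1).const_mul ((κ : ℂ) ^ (d - 1))
    refine h3.congr_of_eventuallyEq ?_
    filter_upwards [lt_mem_nhds hx] with t ht
    simp only [hF]
    rw [fourierInv_exp_realSymbol_div hκ ht, heatIntegral_eq_profile hd hκ
      (Real.sqrt_pos.2 (by positivity))]
    rfl
  have h := hd1.unique hd2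
  have e : ∫ ξ : Hyp d, Real.fourierChar (inner ℝ ξ y) •
      ((Real.exp (-(x * realSymbol κ ξ)) : ℝ) : ℂ) = -2 * ∫ ξ, F' x ξ := by
    rw [← integral_const_mul]
    congr 1
    ext ξ
    simp only [hF', Circle.smul_def, smul_eq_mul]
    push_cast
    ring
  rw [e, h]
  have hd' : (κ : ℂ) ^ d = (κ : ℂ) ^ (d - 1) * κ := by
    rw [← pow_succ]; congr 1; omega
  rw [hd', smul_eq_mul]
  push_cast
  ring

/-- `√(4π²|ξ|² + κ²)`, the branch with non-negative real part, for complex `κ`. -/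
def complexSymbol {d : ℕ} (κ : ℂ) (ξ : Hyp d) : ℂ :=
  ((((2 * Real.pi * ‖ξ‖) ^ 2 : ℝ) : ℂ) + κ ^ 2) ^ (1 / 2 : ℂ)

theorem sq_cpow_half (z : ℂ) : (z ^ (1 / 2 : ℂ)) ^ 2 = z := by
  rw [one_div]; exact Complex.cpow_ofNat_inv_pow z 2

theorem re_cpow_half_nonneg (z : ℂ) : 0 ≤ (z ^ (1 / 2 : ℂ)).re := by
  by_cases hz : z = 0
  · simp [hz]
  rw [Complex.cpow_def_of_ne_zero hz, Complex.exp_re]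
  refine mul_nonneg (Real.exp_pos _).le (Real.cos_nonneg_of_mem_Icc ?_)
  have e : (Complex.log z * (1 / 2)).im = Complex.arg z / 2 := by
    rw [show Complex.log z * (1 / 2) = Complex.log z / ((2 : ℝ) : ℂ) by push_cast; ring,
      Complex.div_ofReal_im, Complex.log_im]
  rw [e]
  have h1 := Complex.neg_pi_lt_arg z
  have h2 := Complex.arg_le_pi z
  exact ⟨by linarith, by linarith⟩

theorem sq_re_sub_sq_im (c : ℂ) : c.re ^ 2 - c.im ^ 2 = (c ^ 2).re := by
  rw [sq c, Complex.mul_re]; ring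

theorem le_re_complexSymbol {d : ℕ} (κ : ℂ) (ξ : Hyp d) :
    2 * Real.pi * ‖ξ‖ - ‖κ‖ ≤ (complexSymbol κ ξ).re := by
  have h0 := re_cpow_half_nonneg ((((2 * Real.pi * ‖ξ‖) ^ 2 : ℝ) : ℂ) + κ ^ 2)
  have h1 := sq_re_sub_sq_im (complexSymbol κ ξ)
  rw [complexSymbol, sq_cpow_half, Complex.add_re, Complex.ofReal_re] at h1
  change 0 ≤ (complexSymbol κ ξ).re at h0
  change (complexSymbol κ ξ).re ^ 2 - (complexSymbol κ ξ).im ^ 2 = _ at h1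
  have h2 : -(‖κ‖ ^ 2) ≤ (κ ^ 2).re := by
    rw [← norm_pow]; exact (abs_le.1 (Complex.abs_re_le_norm _)).1
  have hr : 0 ≤ 2 * Real.pi * ‖ξ‖ := by positivity
  by_contra! hlt
  nlinarith [norm_nonneg κ, sq_nonneg (complexSymbol κ ξ).im]

theorem add_sq_mem_slitPlane {κ : ℂ} (hκ : 0 < κ.re) (r : ℝ) :
    ((r ^ 2 : ℝ) : ℂ) + κ ^ 2 ∈ Complex.slitPlane := by
  rw [Complex.mem_slitPlane_iff, Complex.add_re, Complex.add_im, Complex.ofReal_re,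
    Complex.ofReal_im, sq κ, Complex.mul_re, Complex.mul_im]
  by_cases h : κ.im = 0
  · left; rw [h]; nlinarith [sq_nonneg r]
  · right
    have : κ.re * κ.im ≠ 0 := mul_ne_zero hκ.ne' h
    intro h'
    apply this
    linarith [h']

theorem complexSymbol_ofReal {d : ℕ} {κ : ℝ} (ξ : Hyp d) :
    complexSymbol (κ : ℂ) ξ = (realSymbol κ ξ : ℂ) := by
  rw [complexSymbol, realSymbol, Real.sqrt_eq_rpow, Complex.ofReal_cpow (by positivity)]
  push_cast
  rfl

theorem continuous_complexSymbol {d : ℕ} {κ : ℂ} (hκ : 0 < κ.re) :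
    Continuous fun ξ : Hyp d => complexSymbol κ ξ := by
  unfold complexSymbol
  refine continuous_iff_continuousAt.2 fun ξ => ?_
  exact ContinuousAt.cpow (by fun_prop) continuousAt_const (add_sq_mem_slitPlane hκ _)

theorem norm_exp_complexSymbol_le {d : ℕ} {κ : ℂ} {x M : ℝ} (hx : 0 < x) (hM : ‖κ‖ ≤ M)
    (ξ : Hyp d) (y : Hyp d) :
    ‖Real.fourierChar (inner ℝ ξ y) • Complex.exp (-(x * complexSymbol κ ξ))‖ ≤
      Real.exp (x * M) * Real.exp (-(x * (2 * Real.pi) * ‖ξ‖)) := by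
  rw [norm_fourierChar_smul, Complex.norm_exp, ← Real.exp_add]
  refine Real.exp_le_exp.2 ?_
  rw [Complex.neg_re, Complex.re_ofReal_mul]
  have := le_re_complexSymbol κ ξ
  nlinarith

theorem isPreconnected_re_pos : IsPreconnected {κ : ℂ | 0 < κ.re} :=
  (convex_halfSpace_re_gt 0).isPreconnected

theorem ofReal_mul_mem_slitPlane {κ : ℂ} (hκ : 0 < κ.re) {ρ : ℝ} (hρ : 0 < ρ) :
    κ * (ρ : ℂ) ∈ Complex.slitPlane := by
  rw [Complex.mem_slitPlane_iff]
  left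
  rw [Complex.re_mul_ofReal]
  positivity

/-- Both sides are holomorphic in `κ` for `Re κ > 0` and agree for `κ > 0`. -/
theorem fourierInv_exp_complexSymbol {d : ℕ} (hd : d = 1 ∨ d = 2) {κ : ℂ} (hκ : 0 < κ.re) {x : ℝ}
    (hx : 0 < x) (y : Hyp d) :
    ∫ ξ : Hyp d, Real.fourierChar (inner ℝ ξ y) • Complex.exp (-(x * complexSymbol κ ξ)) =
      -2 * κ ^ d * deriv (profile d) (κ * (Real.sqrt (‖y‖ ^ 2 + x ^ 2) : ℝ)) *
        (x / Real.sqrt (‖y‖ ^ 2 + x ^ 2) : ℝ) := by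
  set ρ := Real.sqrt (‖y‖ ^ 2 + x ^ 2) with hρ
  have hρ0 : 0 < ρ := Real.sqrt_pos.2 (by positivity)
  set U : Set ℂ := {κ : ℂ | 0 < κ.re} with hU
  have hUo : IsOpen U := isOpen_lt continuous_const Complex.continuous_re
  have hL : DifferentiableOn ℂ (fun κ : ℂ => ∫ ξ : Hyp d, Real.fourierChar (inner ℝ ξ y) •
      Complex.exp (-(x * complexSymbol κ ξ))) U := by
    refine differentiableOn_integral_of_dominated hUo (fun κ hκ => ?_)
      (ae_of_all _ fun ξ κ hκ => ?_) fun κ₀ hκ₀ => ?_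
    · have := continuous_complexSymbol (d := d) hκ
      refine Continuous.aestronglyMeasurable ?_
      simp only [Circle.smul_def]
      fun_prop
    · refine DifferentiableAt.differentiableWithinAt ?_
      simp only [Circle.smul_def, complexSymbol, smul_eq_mul]
      refine DifferentiableAt.const_mul (DifferentiableAt.cexp (DifferentiableAt.neg
        (DifferentiableAt.const_mul ?_ _))) _
      exact DifferentiableAt.cpow (by fun_prop) (by fun_prop) (add_sq_mem_slitPlane hκ _)
    · refine ⟨1, one_pos, fun ξ => Real.exp (x * (‖κ₀‖ + 1)) *
        Real.exp (-(x * (2 * Real.pi) * ‖ξ‖)),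
        (integrable_exp_neg_mul_norm (by positivity)).const_mul _, ae_of_all _ fun ξ κ hκ => ?_⟩
      refine norm_exp_complexSymbol_le hx ?_ ξ y
      rw [Metric.mem_ball, dist_eq_norm] at hκ
      linarith [norm_sub_norm_le κ κ₀]
  have hR : DifferentiableOn ℂ (fun κ : ℂ => -2 * κ ^ d * deriv (profile d) (κ * ρ) *
      (x / ρ : ℝ)) U := by
    have h1 : DifferentiableOn ℂ (deriv (profile d)) Complex.slitPlane :=
      (differentiableOn_profile d).deriv Complex.isOpen_slitPlane
    have h2 : DifferentiableOn ℂ (fun κ : ℂ => deriv (profile d) (κ * ρ)) U :=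
      h1.comp (by fun_prop) fun κ hκ => ofReal_mul_mem_slitPlane hκ hρ0
    fun_prop
  have hreal : ∀ t : ℝ, 0 < t → ∫ ξ : Hyp d, Real.fourierChar (inner ℝ ξ y) •
      Complex.exp (-(x * complexSymbol (t : ℂ) ξ)) =
      -2 * (t : ℂ) ^ d * deriv (profile d) (t * ρ) * (x / ρ : ℝ) := fun t ht => by
    have h := fourierInv_exp_realSymbol hd ht hx y
    rw [← hρ, Complex.ofReal_mul] at h
    rw [← h]
    congr 1
    ext ξ
    rw [complexSymbol_ofReal, Complex.ofReal_exp]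
    push_cast
    rfl
  refine (hL.analyticOnNhd hUo).eqOn_of_preconnected_of_frequently_eq (hR.analyticOnNhd hUo)
    isPreconnected_re_pos (z₀ := 1) (by simp [hU]) ?_ hκ
  -- the identity on real `κ` suffices, since these accumulate at `1`
  set u : ℕ → ℂ := fun n => ((1 + ((n : ℝ) + 1)⁻¹ : ℝ) : ℂ) with hu
  have hlim : Tendsto u atTop (𝓝[≠] 1) := by
    refine tendsto_nhdsWithin_iff.2 ⟨?_, Eventually.of_forall fun n => ?_⟩
    · have h1 : Tendsto (fun n : ℕ => 1 + ((n : ℝ) + 1)⁻¹) atTop (𝓝 (1 + 0)) :=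
        (tendsto_inv_atTop_zero.comp (tendsto_atTop_add_const_right _ 1
          tendsto_natCast_atTop_atTop)).const_add _
      have h2 := (Complex.continuous_ofReal.tendsto _).comp h1
      simpa [hu, Function.comp_def] using h2
    · have h3 : (0 : ℝ) < ((n : ℝ) + 1)⁻¹ := by positivity
      have h4 : (1 + ((n : ℝ) + 1)⁻¹ : ℝ) ≠ 1 := by linarith
      simp only [hu, Set.mem_compl_iff, Set.mem_singleton_iff]
      exact_mod_cast h4
  exact hlim.frequently (Frequently.of_forall fun n => hreal _ (by positivity))

/-- The symbol `Λ(ξ) = -i Z(ξ)`, with `Z(ξ) = √(k² - |2πξ|²)` for `|2πξ| ≤ k` and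
`Z(ξ) = i √(|2πξ|² - k²)` otherwise, so that `e^{iZt} = e^{-Λt}`. `Real.sqrt` vanishes on negative
arguments, so one of the two summands is always zero. -/
def symbol {d : ℕ} (k : ℝ) (ξ : Hyp d) : ℂ :=
  (Real.sqrt ((2 * Real.pi * ‖ξ‖) ^ 2 - k ^ 2) : ℂ) -
    (Real.sqrt (k ^ 2 - (2 * Real.pi * ‖ξ‖) ^ 2) : ℂ) * Complex.I

/-- The principal square root in the lower half-plane; the right-hand side is continuous up to the
negative half-line. -/
theorem cpow_half_of_im_neg {z : ℂ} (hz : z.im < 0) :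
    z ^ (1 / 2 : ℂ) = (Real.sqrt ((‖z‖ + z.re) / 2) : ℂ) -
      (Real.sqrt ((‖z‖ - z.re) / 2) : ℂ) * Complex.I := by
  have hlt : |z.re| < ‖z‖ := Complex.abs_re_lt_norm.2 hz.ne
  have hp : 0 < (‖z‖ + z.re) / 2 := by linarith [neg_abs_le z.re]
  have hm : 0 < (‖z‖ - z.re) / 2 := by linarith [le_abs_self z.re]
  set A := Real.sqrt ((‖z‖ + z.re) / 2) with hA
  set B := Real.sqrt ((‖z‖ - z.re) / 2) with hB
  have hA0 : 0 < A := Real.sqrt_pos.2 hp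
  have hA2 : A ^ 2 = (‖z‖ + z.re) / 2 := Real.sq_sqrt hp.le
  have hB2 : B ^ 2 = (‖z‖ - z.re) / 2 := Real.sq_sqrt hm.le
  have hAB : 2 * (A * B) = -z.im := by
    have h1 : (2 * (A * B)) ^ 2 = (-z.im) ^ 2 := by
      have := Complex.sq_norm z
      rw [Complex.normSq_apply] at this
      calc (2 * (A * B)) ^ 2 = 4 * (A ^ 2 * B ^ 2) := by ring
        _ = _ := by rw [hA2, hB2]; linear_combination this
    exact (pow_left_inj₀ (by positivity) (by linarith) two_ne_zero).1 h1
  have hsq : (z ^ (1 / 2 : ℂ)) ^ 2 = ((A : ℂ) - B * Complex.I) ^ 2 := by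
    rw [sq_cpow_half]
    apply Complex.ext
    · have : (((A : ℂ) - B * Complex.I) ^ 2).re = A ^ 2 - B ^ 2 := by
        simp [sq]
      rw [this, hA2, hB2]; ring
    · have : (((A : ℂ) - B * Complex.I) ^ 2).im = -(2 * (A * B)) := by
        simp [sq]; ring
      rw [this, hAB]; ring
  -- the sign is fixed by the real part
  rcases sq_eq_sq_iff_eq_or_eq_neg.1 hsq with h | h
  · exact h
  · have h1 := re_cpow_half_nonneg z
    rw [h] at h1
    simp at h1
    linarith

/-- Limiting absorption: `Λ` is the limit of the symbols for `κ = ε - ik`, which lie in the lower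
half-plane and so determine the branch `-i√(k² - |2πξ|²)` for `|2πξ| < k`. -/
theorem tendsto_complexSymbol {d : ℕ} {k : ℝ} (hk : 0 < k) (ξ : Hyp d) :
    Tendsto (fun ε : ℝ => complexSymbol (ε - Complex.I * k) ξ) (𝓝[>] 0) (𝓝 (symbol k ξ)) := by
  set r := 2 * Real.pi * ‖ξ‖ with hr
  set z : ℝ → ℂ := fun ε => ((r ^ 2 : ℝ) : ℂ) + (ε - Complex.I * k) ^ 2 with hz
  have him : ∀ ε : ℝ, (z ε).im = -(2 * ε * k) := fun ε => by
    simp only [hz]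
    rw [Complex.add_im, Complex.ofReal_im, sq, Complex.mul_im]
    simp
    ring
  have hzc : Continuous z := by fun_prop
  have hz0 : z 0 = ((r ^ 2 - k ^ 2 : ℝ) : ℂ) := by
    simp only [hz]
    push_cast
    rw [show ((0 : ℂ) - Complex.I * k) ^ 2 = Complex.I ^ 2 * k ^ 2 by ring, Complex.I_sq]
    ring
  -- unlike the principal root, `L` is continuous at the negative real number `r² - k²`
  set L : ℂ → ℂ := fun z => (Real.sqrt ((‖z‖ + z.re) / 2) : ℂ) -
      (Real.sqrt ((‖z‖ - z.re) / 2) : ℂ) * Complex.I with hL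
  have hLc : Continuous L := by fun_prop
  have hlim : L (z 0) = symbol k ξ := by
    rw [hz0]
    simp only [hL, symbol, Complex.norm_real, Complex.ofReal_re, Real.norm_eq_abs, ← hr]
    rcases le_total 0 (r ^ 2 - k ^ 2) with h | h
    · rw [abs_of_nonneg h, sub_self, zero_div, Real.sqrt_zero,
        Real.sqrt_eq_zero_of_nonpos (by linarith : k ^ 2 - r ^ 2 ≤ 0)]
      congr 3
      ring
    · rw [abs_of_nonpos h, neg_add_cancel, zero_div, Real.sqrt_zero,
        Real.sqrt_eq_zero_of_nonpos h]
      congr 4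
      ring
  have h1 : Tendsto (fun ε => L (z ε)) (𝓝[>] 0) (𝓝 (symbol k ξ)) := by
    rw [← hlim]
    exact ((hLc.comp hzc).tendsto 0).mono_left nhdsWithin_le_nhds
  refine h1.congr' ?_
  filter_upwards [self_mem_nhdsWithin] with ε hε
  have hε' : 0 < ε := hε
  rw [complexSymbol, cpow_half_of_im_neg]
  change (z ε).im < 0
  rw [him]
  have : 0 < 2 * ε * k := by positivity
  linarith

/-- The Weyl representation, differentiated in the normal direction: the inverse Fourier transform
of `e^{-xΛ}` is `-2` times the derivative in `x` of the fundamental solution at `(y, x)`. -/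
theorem fourierInv_exp_symbol {d : ℕ} (hd : d = 1 ∨ d = 2) {k : ℝ} (hk : 0 < k) {x : ℝ}
    (hx : 0 < x) (y : Hyp d) :
    ∫ ξ : Hyp d, Real.fourierChar (inner ℝ ξ y) • Complex.exp (-(x * symbol k ξ)) =
      -2 * (-Complex.I * k) ^ d *
        deriv (profile d) (-Complex.I * (k * Real.sqrt (‖y‖ ^ 2 + x ^ 2) : ℝ)) *
        (x / Real.sqrt (‖y‖ ^ 2 + x ^ 2) : ℝ) := by
  set ρ := Real.sqrt (‖y‖ ^ 2 + x ^ 2) with hρ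
  have hρ0 : 0 < ρ := Real.sqrt_pos.2 (by positivity)
  set κ : ℝ → ℂ := fun ε => ε - Complex.I * k with hκ
  have hκc : Continuous κ := by fun_prop
  have hκ0 : κ 0 = -Complex.I * k := by simp [hκ]
  have hκre : ∀ ε : ℝ, (κ ε).re = ε := fun ε => by simp [hκ]
  -- let `κ = ε - ik` tend to `-ik` on both sides
  have hL : Tendsto (fun ε => ∫ ξ : Hyp d, Real.fourierChar (inner ℝ ξ y) •
      Complex.exp (-(x * complexSymbol (κ ε) ξ))) (𝓝[>] 0)
      (𝓝 (∫ ξ : Hyp d, Real.fourierChar (inner ℝ ξ y) • Complex.exp (-(x * symbol k ξ)))) := by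
    refine tendsto_integral_filter_of_dominated_convergence
      (fun ξ => Real.exp (x * (1 + k)) * Real.exp (-(x * (2 * Real.pi) * ‖ξ‖))) ?_ ?_
      ((integrable_exp_neg_mul_norm (by positivity)).const_mul _) (ae_of_all _ fun ξ => ?_)
    · filter_upwards [self_mem_nhdsWithin] with ε hε
      have := continuous_complexSymbol (d := d) (κ := κ ε) (by rw [hκre]; exact hε)
      refine Continuous.aestronglyMeasurable ?_
      simp only [Circle.smul_def]
      fun_prop
    · filter_upwards [Ioo_mem_nhdsGT (one_pos)] with ε hε
      refine ae_of_all _ fun ξ => norm_exp_complexSymbol_le hx ?_ ξ y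
      refine (norm_sub_le _ _).trans ?_
      rw [Complex.norm_real, norm_mul, Complex.norm_I, Complex.norm_real, one_mul,
        Real.norm_of_nonneg hε.1.le, Real.norm_of_nonneg hk.le]
      linarith [hε.2]
    · have h1 := tendsto_complexSymbol hk ξ
      simp only [Circle.smul_def]
      exact (((h1.const_mul (x : ℂ)).neg).cexp).const_smul _
  have hmem : κ 0 * ρ ∈ Complex.slitPlane := by
    rw [hκ0]
    have := neg_I_mul_mem_slitPlane (mul_pos hk hρ0)
    rwa [Complex.ofReal_mul, ← mul_assoc] at this
  have hR : Tendsto (fun ε => -2 * κ ε ^ d * deriv (profile d) (κ ε * ρ) * (x / ρ : ℝ)) (𝓝[>] 0)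
      (𝓝 (-2 * κ 0 ^ d * deriv (profile d) (κ 0 * ρ) * (x / ρ : ℝ))) := by
    have h1 : ContinuousAt (deriv (profile d)) (κ 0 * ρ) :=
      ((differentiableOn_profile d).deriv Complex.isOpen_slitPlane).continuousOn.continuousAt
        (Complex.isOpen_slitPlane.mem_nhds hmem)
    have h2 : ContinuousAt (fun ε => deriv (profile d) (κ ε * ρ)) 0 :=
      ContinuousAt.comp (f := fun ε => κ ε * ρ) h1 (by fun_prop)
    have h3 : ContinuousAt (fun ε => -2 * κ ε ^ d * deriv (profile d) (κ ε * ρ) * (x / ρ : ℝ)) 0 := by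
      fun_prop
    exact h3.tendsto.mono_left nhdsWithin_le_nhds
  have hne : (𝓝[>] (0 : ℝ)).NeBot := inferInstance
  have h := tendsto_nhds_unique (hL.congr' (by
    filter_upwards [self_mem_nhdsWithin] with ε hε
    exact fourierInv_exp_complexSymbol hd (by rw [hκre]; exact hε) hx y)) hR
  rw [h, hκ0, Complex.ofReal_mul k, ← mul_assoc (-Complex.I)]

/-! ### The symbol -/

theorem continuous_symbol {d : ℕ} (k : ℝ) : Continuous (symbol (d := d) k) := by
  unfold symbol; fun_prop

theorem re_symbol {d : ℕ} (k : ℝ) (ξ : Hyp d) :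
    (symbol k ξ).re = Real.sqrt ((2 * Real.pi * ‖ξ‖) ^ 2 - k ^ 2) := by simp [symbol]

theorem re_symbol_nonneg {d : ℕ} (k : ℝ) (ξ : Hyp d) : 0 ≤ (symbol k ξ).re := by
  rw [re_symbol]; positivity

theorem sq_symbol {d : ℕ} (k : ℝ) (ξ : Hyp d) :
    symbol k ξ ^ 2 = (((2 * Real.pi * ‖ξ‖) ^ 2 - k ^ 2 : ℝ) : ℂ) := by
  rw [symbol]
  set a := (2 * Real.pi * ‖ξ‖) ^ 2 - k ^ 2 with ha
  rw [show k ^ 2 - (2 * Real.pi * ‖ξ‖) ^ 2 = -a by ring]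
  rcases le_total 0 a with h | h
  · rw [Real.sqrt_eq_zero_of_nonpos (by linarith : -a ≤ 0)]
    rw [Complex.ofReal_zero, zero_mul, sub_zero, ← Complex.ofReal_pow, Real.sq_sqrt h]
  · rw [Real.sqrt_eq_zero_of_nonpos h, Complex.ofReal_zero, zero_sub, neg_sq, mul_pow,
      Complex.I_sq, ← Complex.ofReal_pow, Real.sq_sqrt (by linarith)]
    push_cast; ring

theorem le_re_symbol {d : ℕ} {k : ℝ} (hk : 0 < k) (ξ : Hyp d) :
    2 * Real.pi * ‖ξ‖ - k ≤ (symbol k ξ).re := by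
  rw [re_symbol]
  rcases le_total (2 * Real.pi * ‖ξ‖) k with h | h
  · exact (sub_nonpos.2 h).trans (Real.sqrt_nonneg _)
  · refine Real.le_sqrt_of_sq_le ?_
    nlinarith

theorem norm_exp_neg_mul_symbol {d : ℕ} (k t : ℝ) (ξ : Hyp d) :
    ‖Complex.exp (-(t * symbol k ξ))‖ = Real.exp (-(t * (symbol k ξ).re)) := by
  rw [Complex.norm_exp, Complex.neg_re, Complex.re_ofReal_mul]

theorem norm_exp_neg_mul_symbol_le {d : ℕ} {k : ℝ} (hk : 0 < k) {t : ℝ} (ht : 0 ≤ t) (ξ : Hyp d) :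
    ‖Complex.exp (-(t * symbol k ξ))‖ ≤
      Real.exp (t * k) * Real.exp (-(t * (2 * Real.pi) * ‖ξ‖)) := by
  rw [norm_exp_neg_mul_symbol, ← Real.exp_add]
  refine Real.exp_le_exp.2 ?_
  have := le_re_symbol hk ξ
  nlinarith

theorem integrable_exp_neg_mul_symbol {d : ℕ} {k : ℝ} (hk : 0 < k) {t : ℝ} (ht : 0 < t) :
    Integrable fun ξ : Hyp d => Complex.exp (-(t * symbol k ξ)) := by
  have := continuous_symbol (d := d) k
  exact ((integrable_exp_neg_mul_norm (d := d) (c := t * (2 * Real.pi)) (by positivity)).const_mul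
    (Real.exp (t * k))).mono' (Continuous.aestronglyMeasurable (by fun_prop))
    (ae_of_all _ fun ξ => norm_exp_neg_mul_symbol_le hk ht.le ξ)

/-! ### Smoothness and normal derivative of the fundamental solution -/

theorem edist2_pos {d : ℕ} {x y : Amb d} (h : x ≠ y) : 0 < edist2 x y := by
  refine Real.sqrt_pos.2 ?_
  by_contra! h0
  have h1 : ‖x.1 - y.1‖ ^ 2 = 0 := by nlinarith [sq_nonneg (x.2 - y.2), sq_nonneg ‖x.1 - y.1‖]
  have h2 : (x.2 - y.2) ^ 2 = 0 := by nlinarith [sq_nonneg (x.2 - y.2), sq_nonneg ‖x.1 - y.1‖]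
  refine h (Prod.ext ?_ ?_)
  · exact sub_eq_zero.1 (norm_eq_zero.1 (pow_eq_zero_iff two_ne_zero |>.1 h1))
  · exact sub_eq_zero.1 (pow_eq_zero_iff two_ne_zero |>.1 h2)

theorem contDiffAt_fundSol {d : ℕ} (hd : d = 1 ∨ d = 2) {k : ℝ} (hk : 0 < k) {x y : Amb d}
    (h : x ≠ y) : ContDiffAt ℝ ∞ (fundSol k x) y := by
  have hr := edist2_pos h
  have h0 : ‖x.1 - y.1‖ ^ 2 + (x.2 - y.2) ^ 2 ≠ 0 := (Real.sqrt_pos.1 hr).ne'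
  have hc1 : ContDiff ℝ ∞ fun y : Amb d => ‖x.1 - y.1‖ ^ 2 :=
    (contDiff_const.sub contDiff_fst).norm_sq ℝ
  have hc2 : ContDiff ℝ ∞ fun y : Amb d => ‖x.1 - y.1‖ ^ 2 + (x.2 - y.2) ^ 2 :=
    hc1.add ((contDiff_const.sub contDiff_snd).pow 2)
  have hE : ContDiffAt ℝ ∞ (edist2 x) y := ContDiffAt.sqrt hc2.contDiffAt h0
  have hmem : -Complex.I * (k * edist2 x y : ℝ) ∈ Complex.slitPlane :=
    neg_I_mul_mem_slitPlane (mul_pos hk hr)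
  have hp : ContDiffAt ℝ ∞ (profile d) (-Complex.I * (k * edist2 x y : ℝ)) :=
    (((differentiableOn_profile d).analyticAt
      (Complex.isOpen_slitPlane.mem_nhds hmem)).contDiffAt).restrict_scalars ℝ
  have hin : ContDiffAt ℝ ∞ (fun y => -Complex.I * ((k * edist2 x y : ℝ) : ℂ)) y :=
    contDiffAt_const.mul
      (Complex.ofRealCLM.contDiff.contDiffAt.comp y (contDiffAt_const.mul hE))
  have hcomp : ContDiffAt ℝ ∞ (fun y => (-Complex.I * k) ^ (d - 1) *
      profile d (-Complex.I * (k * edist2 x y : ℝ))) y :=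
    contDiffAt_const.mul (ContDiffAt.comp (g := profile d)
      (f := fun y => -Complex.I * ((k * edist2 x y : ℝ) : ℂ)) y hp hin)
  refine hcomp.congr_of_eventuallyEq ?_
  filter_upwards [isOpen_ne.mem_nhds h.symm] with z hz
  exact fundSol_eq_profile hd hk (edist2_pos (Ne.symm hz))

theorem units_int_sq (σ : ℤˣ) : (((σ : ℤ) : ℝ)) * ((σ : ℤ) : ℝ) = 1 := by
  rcases Int.units_eq_one_or σ with rfl | rfl <;> norm_num

/-- The field in the half-space `U^σ` with Fourier density `b`: the superposition of the plane
waves `e^{2πi ξ·x̃ - |x_n| Λ(ξ)}`, which are outgoing for `|2πξ| < k` and evanescent for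
`|2πξ| > k`. -/
def halfField {d : ℕ} (k : ℝ) (σ : ℤˣ) (b : Hyp d → ℂ) (x : Amb d) : ℂ :=
  ∫ ξ : Hyp d, Real.fourierChar (inner ℝ ξ x.1) •
    (Complex.exp (-((((σ : ℤ) : ℝ) * x.2 : ℝ) * symbol k ξ)) * b ξ)

/-- The kernel of the double-layer potential as a superposition of plane waves. -/
theorem deriv_fundSol {d : ℕ} (hd : d = 1 ∨ d = 2) {k : ℝ} (hk : 0 < k) {x : Amb d} (σ : ℤˣ)
    (hx : 0 < ((σ : ℤ) : ℝ) * x.2) (y : Hyp d) :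
    deriv (fun t : ℝ => fundSol k x (y, t)) 0 =
      ((σ : ℤ) : ℂ) / 2 * ∫ ξ : Hyp d, Real.fourierChar (inner ℝ ξ (x.1 - y)) •
        Complex.exp (-((((σ : ℤ) : ℝ) * x.2 : ℝ) * symbol k ξ)) := by
  have hx2 : x.2 ≠ 0 := by rintro h; simp [h] at hx
  have hne : ∀ᶠ t : ℝ in 𝓝 0, x ≠ (y, t) := by
    filter_upwards [isOpen_ne.mem_nhds hx2.symm] with t ht h
    exact ht (by rw [h])
  rw [fourierInv_exp_symbol hd hk hx]
  have hsq : (((σ : ℤ) : ℝ) * x.2) ^ 2 = x.2 ^ 2 := by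
    rw [mul_pow, sq ((σ : ℤ) : ℝ), units_int_sq, one_mul]
  rw [hsq]
  set ρ := Real.sqrt (‖x.1 - y‖ ^ 2 + x.2 ^ 2) with hρ
  have hρ0 : 0 < ρ := Real.sqrt_pos.2 (by positivity)
  have hE : edist2 x (y, 0) = ρ := by simp [edist2, hρ]
  have h1 : HasDerivAt (fun t : ℝ => edist2 x (y, t)) (-(x.2 / ρ)) 0 := by
    have h0 : ‖x.1 - y‖ ^ 2 + (x.2 - 0) ^ 2 ≠ 0 := by rw [sub_zero]; positivity
    have h := ((((hasDerivAt_id (0 : ℝ)).const_sub x.2).pow 2).const_add (‖x.1 - y‖ ^ 2)).sqrt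
      (by simpa using h0)
    refine h.congr_deriv ?_
    simp only [id_eq, sub_zero, Pi.pow_apply]
    rw [← hρ]
    field_simp
    norm_num
  have h2 : HasDerivAt (fun t : ℝ => -Complex.I * ((k * edist2 x (y, t) : ℝ) : ℂ))
      (-Complex.I * ((k * -(x.2 / ρ) : ℝ) : ℂ)) 0 :=
    ((h1.const_mul k).ofReal_comp).const_mul _
  have hmem : -Complex.I * (k * edist2 x (y, 0) : ℝ) ∈ Complex.slitPlane :=
    neg_I_mul_mem_slitPlane (by rw [hE]; positivity)
  have h3 : HasDerivAt (profile d) (deriv (profile d) (-Complex.I * (k * edist2 x (y, 0) : ℝ)))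
      (-Complex.I * (k * edist2 x (y, 0) : ℝ)) :=
    ((differentiableOn_profile d _ hmem).differentiableAt
      (Complex.isOpen_slitPlane.mem_nhds hmem)).hasDerivAt
  have h4 := (HasDerivAt.scomp (0 : ℝ) h3 h2).const_mul ((-Complex.I * (k : ℂ)) ^ (d - 1))
  have h5 : HasDerivAt (fun t : ℝ => fundSol k x (y, t)) _ 0 := h4.congr_of_eventuallyEq (by
    filter_upwards [hne] with t ht
    exact fundSol_eq_profile hd hk (edist2_pos ht))
  rw [h5.deriv, hE]
  have hd' : (-Complex.I * (k : ℂ)) ^ d = (-Complex.I * (k : ℂ)) ^ (d - 1) * (-Complex.I * k) := by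
    rw [← pow_succ]; congr 1; rcases hd with rfl | rfl <;> rfl
  rw [hd', smul_eq_mul]
  have hσ : ((σ : ℤ) : ℂ) * ((σ : ℤ) : ℂ) = 1 := by
    rcases Int.units_eq_one_or σ with rfl | rfl <;> norm_num
  push_cast
  linear_combination (-((-Complex.I * (k : ℂ)) ^ (d - 1)) * (-Complex.I * k) *
    deriv (profile d) (-Complex.I * (k * ρ)) * (-(x.2 : ℂ) / ρ)) * hσ

/-- The double-layer potential with an integrable density, as a superposition of plane waves. -/
theorem integral_mul_deriv_fundSol {d : ℕ} (hd : d = 1 ∨ d = 2) {k : ℝ} (hk : 0 < k) {x : Amb d}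
    (σ : ℤˣ) (hx : 0 < ((σ : ℤ) : ℝ) * x.2) {f : Hyp d → ℂ} (hf : Integrable f) :
    ∫ y, f y * deriv (fun t : ℝ => fundSol k x (y, t)) 0 =
      ((σ : ℤ) : ℂ) / 2 * halfField k σ (𝓕 f) x := by
  set m : Hyp d → ℂ := fun ξ => Complex.exp (-((((σ : ℤ) : ℝ) * x.2 : ℝ) * symbol k ξ)) with hm
  have hmi : Integrable m := integrable_exp_neg_mul_symbol hk hx
  have e1 : ∀ y, f y * deriv (fun t : ℝ => fundSol k x (y, t)) 0 =
      ((σ : ℤ) : ℂ) / 2 * ∫ ξ : Hyp d, Real.fourierChar (inner ℝ ξ (x.1 - y)) • (f y * m ξ) :=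
    fun y => by
      rw [deriv_fundSol hd hk σ hx, mul_left_comm, ← integral_const_mul]
      congr 2
      ext ξ
      rw [mul_smul_comm]
  simp_rw [e1]
  rw [integral_const_mul]
  congr 1
  have hi : Integrable (Function.uncurry fun y ξ : Hyp d =>
      Real.fourierChar (inner ℝ ξ (x.1 - y)) • (f y * m ξ)) (volume.prod volume) := by
    have h := hf.mul_prod hmi
    refine h.mono ?_ (ae_of_all _ fun p => ?_)
    · have h2 : Continuous fun p : Hyp d × Hyp d =>
          ((Real.fourierChar (inner ℝ p.2 (x.1 - p.1)) : Circle) : ℂ) := by fun_prop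
      exact h2.aestronglyMeasurable.mul h.aestronglyMeasurable
    · simp only [Function.uncurry_def, norm_fourierChar_smul, le_refl]
  rw [integral_integral_swap hi, halfField]
  congr 1
  ext ξ
  rw [Real.fourier_eq, ← integral_const_mul, Circle.smul_def, ← integral_smul]
  congr 1
  ext y
  rw [inner_sub_right, sub_eq_add_neg, AddChar.map_add_eq_mul, real_inner_comm ξ y]
  simp only [Circle.smul_def, Circle.coe_mul, smul_eq_mul, hm]
  ring

/-- The kernel `y ↦ ∂_n(ρ Φ(x, ·))(y)` of the double-layer potential as a Schwartz function. -/
theorem exists_schwartz_deriv_mul_fundSol {d : ℕ} (hd : d = 1 ∨ d = 2) {k : ℝ} (hk : 0 < k)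
    {x : Amb d} (η : 𝓓((⊤ : Opens (Amb d)), ℂ)) (hx : x ∉ tsupport η) :
    ∃ θ : 𝓢(Hyp d, ℂ), ∀ y, θ y = deriv (fun t : ℝ => η (y, t) * fundSol k x (y, t)) 0 := by
  set g : Amb d → ℂ := fun z => η z * fundSol k x z with hg
  have hgc : ContDiff ℝ ∞ g := contDiff_iff_contDiffAt.2 fun z => by
    by_cases hz : z ∈ tsupport η
    · exact η.contDiff.contDiffAt.mul (contDiffAt_fundSol hd hk (fun h => hx (h ▸ hz)))
    · have : g =ᶠ[𝓝 z] fun _ => 0 := by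
        filter_upwards [(isClosed_tsupport η).isOpen_compl.mem_nhds hz] with w hw
        simp [hg, image_eq_zero_of_notMem_tsupport hw]
      exact contDiffAt_const.congr_of_eventuallyEq this
  have hgs : HasCompactSupport g := η.hasCompactSupport.mul_right
  have hfd : ContDiff ℝ ∞ fun z => fderiv ℝ g z ((0 : Hyp d), (1 : ℝ)) :=
    (hgc.fderiv_right (m := ∞) (by simp)).clm_apply contDiff_const
  have hfs : HasCompactSupport fun z => fderiv ℝ g z ((0 : Hyp d), (1 : ℝ)) :=
    hgs.fderiv_apply ℝ _
  refine ⟨HasCompactSupport.toSchwartzMap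
    (f := fun y : Hyp d => fderiv ℝ g (y, 0) ((0 : Hyp d), (1 : ℝ)))
    (hfs.comp_isClosedEmbedding (isClosedEmbedding_slice d))
    (hfd.comp (contDiff_id.prodMk contDiff_const)), fun y => ?_⟩
  have h1 : HasDerivAt (fun t : ℝ => ((y, t) : Amb d)) ((0 : Hyp d), (1 : ℝ)) 0 :=
    (hasDerivAt_const (0 : ℝ) y).prodMk (hasDerivAt_id (0 : ℝ))
  have h2 : HasFDerivAt g (fderiv ℝ g (y, 0)) (y, 0) :=
    ((hgc.differentiable (by simp)) _).hasFDerivAt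
  exact (h2.comp_hasDerivAt (0 : ℝ) h1).deriv.symm

/-! ### Sobolev spaces through Fourier densities -/

/-- The symbol `(k² + |2πξ|²)^{s/2}` of the Bessel potential operator of order `s`. -/
def weight {d : ℕ} (k s : ℝ) (ξ : Hyp d) : ℝ := (k ^ 2 + ‖(2 * Real.pi) • ξ‖ ^ 2) ^ (s / 2)

theorem norm_two_pi_smul_sq {d : ℕ} (ξ : Hyp d) :
    ‖(2 * Real.pi) • ξ‖ ^ 2 = (2 * Real.pi * ‖ξ‖) ^ 2 := by
  simp only [norm_smul, mul_pow, Real.norm_eq_abs, sq_abs]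

theorem bessel_eq (d : ℕ) (k s : ℝ) : bessel d k s =
    TemperedDistribution.fourierMultiplierCLM ℂ (fun ξ : Hyp d => ((weight k s ξ : ℝ) : ℂ)) := rfl

theorem weight_pos {d : ℕ} {k : ℝ} (hk : 0 < k) (s : ℝ) (ξ : Hyp d) : 0 < weight k s ξ := by
  unfold weight; positivity

theorem weight_zero {d : ℕ} (k : ℝ) (ξ : Hyp d) : weight k 0 ξ = 1 := by simp [weight]

theorem weight_add {d : ℕ} {k : ℝ} (hk : 0 < k) (s t : ℝ) (ξ : Hyp d) :
    weight k (s + t) ξ = weight k s ξ * weight k t ξ := by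
  unfold weight
  rw [← Real.rpow_add (by positivity), add_div]

theorem weight_neg_mul_weight {d : ℕ} {k : ℝ} (hk : 0 < k) (s : ℝ) (ξ : Hyp d) :
    weight k (-s) ξ * weight k s ξ = 1 := by
  rw [← weight_add hk, neg_add_cancel, weight_zero]

theorem weight_one_sq {d : ℕ} (k : ℝ) (ξ : Hyp d) :
    weight k 1 ξ ^ 2 = k ^ 2 + (2 * Real.pi * ‖ξ‖) ^ 2 := by
  unfold weight
  rw [← Real.sqrt_eq_rpow, Real.sq_sqrt (by positivity), norm_two_pi_smul_sq]

theorem hasTemperateGrowth_weight {d : ℕ} {k : ℝ} (hk : 0 < k) (s : ℝ) :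
    (fun ξ : Hyp d => ((weight k s ξ : ℝ) : ℂ)).HasTemperateGrowth := by
  have hsym : (fun ξ : Hyp d => ((weight k s ξ : ℝ) : ℂ)) = fun ξ : Hyp d =>
      (((k ^ 2) ^ (s / 2) * (1 + ‖(2 * Real.pi / k) • ξ‖ ^ 2) ^ (s / 2) : ℝ) : ℂ) := by
    ext ξ
    rw [weight, ← Real.mul_rpow (by positivity) (by positivity)]
    congr 3
    simp only [norm_smul, mul_pow, Real.norm_eq_abs, sq_abs, div_pow]
    field_simp
  rw [hsym]
  have h1 := (Function.hasTemperateGrowth_one_add_norm_sq_rpow (Hyp d) (s / 2)).comp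
    (((2 * Real.pi / k) • ContinuousLinearMap.id ℝ (Hyp d)).hasTemperateGrowth)
  have h2 : (fun ξ : Hyp d => (1 + ‖(2 * Real.pi / k) • ξ‖ ^ 2) ^ (s / 2)).HasTemperateGrowth := h1
  fun_prop

theorem continuous_weight {d : ℕ} {k : ℝ} (hk : 0 < k) (s : ℝ) :
    Continuous (weight k s : Hyp d → ℝ) := by
  refine Continuous.rpow_const (by fun_prop) fun ξ => Or.inl ?_
  positivity

theorem weight_le_of_nonpos {d : ℕ} {k : ℝ} (hk : 0 < k) {s : ℝ} (hs : s ≤ 0) (ξ : Hyp d) :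
    weight k s ξ ≤ (k ^ 2) ^ (s / 2) :=
  Real.rpow_le_rpow_of_nonpos (by positivity) (le_add_of_nonneg_right (by positivity))
    (by linarith)

/-- `|Λ(ξ)| ≤ (k² + |2πξ|²)^{1/2}`: the two sides have the squares `||2πξ|² - k²|`
and `|2πξ|² + k²`. -/
theorem norm_symbol_le_weight {d : ℕ} {k : ℝ} (hk : 0 < k) (ξ : Hyp d) :
    ‖symbol k ξ‖ ≤ weight k 1 ξ := by
  refine (abs_le_of_sq_le_sq' ?_ (weight_pos hk 1 ξ).le).2
  rw [weight_one_sq, ← norm_pow, sq_symbol, Complex.norm_real, Real.norm_eq_abs, abs_le]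
  constructor <;> nlinarith [sq_nonneg k, sq_nonneg (2 * Real.pi * ‖ξ‖)]

theorem two_pi_norm_le_weight {d : ℕ} {k : ℝ} (hk : 0 < k) (ξ : Hyp d) :
    2 * Real.pi * ‖ξ‖ ≤ weight k 1 ξ := by
  refine (abs_le_of_sq_le_sq' ?_ (weight_pos hk 1 ξ).le).2
  rw [weight_one_sq]
  nlinarith [sq_nonneg k]

/-- `a` is the Fourier transform of `u ∈ H^s(ℝ^{n-1})`, in the variable of Mathlib's Fourier
transform. Being a locally square integrable function, it describes `u` more conveniently than the
distribution `u` does. -/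
structure HasFourierDensity {d : ℕ} (k s : ℝ) (u : 𝓢'(Hyp d, ℂ)) (a : Hyp d → ℂ) : Prop where
  memLp : MemLp (fun ξ => (weight k s ξ : ℂ) * a ξ) 2
  apply_eq : ∀ ψ : 𝓢(Hyp d, ℂ), u ψ = ∫ ξ, a ξ * (𝓕⁻ ψ : 𝓢(Hyp d, ℂ)) ξ

section density

variable {d : ℕ} {k : ℝ}

theorem eq_weight_neg_mul (hk : 0 < k) (s : ℝ) (a : Hyp d → ℂ) (ξ : Hyp d) :
    a ξ = (weight k (-s) ξ : ℂ) * ((weight k s ξ : ℂ) * a ξ) := by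
  rw [← mul_assoc, ← Complex.ofReal_mul, weight_neg_mul_weight hk, Complex.ofReal_one, one_mul]

theorem aestronglyMeasurable_of_memLp_weight (hk : 0 < k) {s : ℝ} {a : Hyp d → ℂ}
    (h : MemLp (fun ξ => (weight k s ξ : ℂ) * a ξ) 2) : AEStronglyMeasurable a := by
  have h1 : a = fun ξ => (weight k (-s) ξ : ℂ) * ((weight k s ξ : ℂ) * a ξ) :=
    funext (eq_weight_neg_mul hk s a)
  rw [h1]
  have := continuous_weight (d := d) hk (-s)
  exact (Complex.continuous_ofReal.comp this).aestronglyMeasurable.mul h.aestronglyMeasurable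

/-- Multiplication by a function of order `t` maps densities of order `s` to order `s - t`. -/
theorem memLp_weight_mul (hk : 0 < k) {s t r : ℝ} (hr : r + t = s) {a m : Hyp d → ℂ} {C : ℝ}
    (hm : AEStronglyMeasurable m) (hmb : ∀ ξ, ‖m ξ‖ ≤ C * weight k t ξ)
    (h : MemLp (fun ξ => (weight k s ξ : ℂ) * a ξ) 2) :
    MemLp (fun ξ => (weight k r ξ : ℂ) * (m ξ * a ξ)) 2 := by
  have ha := aestronglyMeasurable_of_memLp_weight hk h
  refine MemLp.of_le_mul (c := C) h
    ((Complex.continuous_ofReal.comp (continuous_weight hk r)).aestronglyMeasurable.mul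
      (hm.mul ha)) (ae_of_all _ fun ξ => ?_)
  have h1 : weight k s ξ = weight k r ξ * weight k t ξ := by rw [← hr, weight_add hk]
  rw [norm_mul, norm_mul, norm_mul, Complex.norm_real, Complex.norm_real, Real.norm_eq_abs,
    Real.norm_eq_abs, abs_of_pos (weight_pos hk _ _), abs_of_pos (weight_pos hk _ _), h1]
  have := mul_le_mul_of_nonneg_left (hmb ξ)
    (mul_nonneg (weight_pos hk r ξ).le (norm_nonneg (a ξ)))
  nlinarith

/-- The symbol `-Λ/2` has order one. -/
theorem memLp_weight_symbol (hk : 0 < k) {s : ℝ} {a : Hyp d → ℂ}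
    (h : MemLp (fun ξ => (weight k s ξ : ℂ) * a ξ) 2) :
    MemLp (fun ξ => (weight k (s - 1) ξ : ℂ) * (-(symbol k ξ / 2) * a ξ)) 2 := by
  refine memLp_weight_mul hk (t := 1) (C := 1) (by ring) ?_ (fun ξ => ?_) h
  · have := continuous_symbol (d := d) k
    exact Continuous.aestronglyMeasurable (by fun_prop)
  · have := norm_symbol_le_weight hk ξ
    rw [norm_neg, norm_div, Complex.norm_ofNat]
    linarith [weight_pos hk 1 ξ]

theorem memLp_weight_mono (hk : 0 < k) {s r : ℝ} (hr : r ≤ s) {a : Hyp d → ℂ}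
    (h : MemLp (fun ξ => (weight k s ξ : ℂ) * a ξ) 2) :
    MemLp (fun ξ => (weight k r ξ : ℂ) * a ξ) 2 := by
  have h1 := memLp_weight_mul hk (r := r) (t := s - r) (by ring) (m := fun _ => 1)
    (C := (k ^ 2) ^ ((r - s) / 2)) aestronglyMeasurable_const (fun ξ => ?_) h
  · simpa using h1
  · rw [norm_one, ← weight_neg_mul_weight hk (s - r) ξ]
    have := weight_le_of_nonpos (d := d) hk (s := -(s - r)) (by linarith) ξ
    rw [show -(s - r) / 2 = (r - s) / 2 by ring] at this
    exact mul_le_mul_of_nonneg_right this (weight_pos hk _ _).le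

theorem integrable_mul_schwartz (hk : 0 < k) {s : ℝ} {a : Hyp d → ℂ}
    (h : MemLp (fun ξ => (weight k s ξ : ℂ) * a ξ) 2) (ψ : 𝓢(Hyp d, ℂ)) :
    Integrable fun ξ => a ξ * ψ ξ := by
  have h1 := (SchwartzMap.smulLeftCLM ℂ (fun ξ : Hyp d => ((weight k (-s) ξ : ℝ) : ℂ)) ψ).memLp
    (p := 2) (μ := volume)
  refine (h.integrable_mul h1).congr (ae_of_all _ fun ξ => ?_)
  simp only [Pi.mul_apply, SchwartzMap.smulLeftCLM_apply_apply (hasTemperateGrowth_weight hk (-s)),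
    smul_eq_mul]
  conv_rhs => rw [eq_weight_neg_mul hk s a ξ]
  ring

theorem HasFourierDensity.integrable_mul (hk : 0 < k) {s : ℝ} {u : 𝓢'(Hyp d, ℂ)} {a : Hyp d → ℂ}
    (h : HasFourierDensity k s u a) (ψ : 𝓢(Hyp d, ℂ)) : Integrable fun ξ => a ξ * ψ ξ :=
  integrable_mul_schwartz hk h.memLp ψ

theorem HasFourierDensity.add (hk : 0 < k) {s : ℝ} {u v : 𝓢'(Hyp d, ℂ)} {a b : Hyp d → ℂ}
    (h : HasFourierDensity k s u a) (h' : HasFourierDensity k s v b) :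
    HasFourierDensity k s (u + v) (fun ξ => a ξ + b ξ) where
  memLp := by
    refine (h.memLp.add h'.memLp).ae_eq (ae_of_all _ fun ξ => ?_)
    simp only [Pi.add_apply]
    ring
  apply_eq ψ := by
    have : (u + v) ψ = u ψ + v ψ := rfl
    rw [this, h.apply_eq, h'.apply_eq, ← integral_add (h.integrable_mul hk _)
      (h'.integrable_mul hk _)]
    simp only [add_mul]

theorem HasFourierDensity.smul {s : ℝ} {u : 𝓢'(Hyp d, ℂ)} {a : Hyp d → ℂ} (c : ℂ)
    (h : HasFourierDensity k s u a) : HasFourierDensity k s (c • u) (fun ξ => c * a ξ) where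
  memLp := by
    have := h.memLp.const_mul c
    refine this.ae_eq (ae_of_all _ fun ξ => ?_)
    ring
  apply_eq ψ := by
    have : (c • u) ψ = c * u ψ := rfl
    rw [this, h.apply_eq, ← integral_const_mul]
    simp only [mul_assoc]

theorem HasFourierDensity.sub (hk : 0 < k) {s : ℝ} {u v : 𝓢'(Hyp d, ℂ)} {a b : Hyp d → ℂ}
    (h : HasFourierDensity k s u a) (h' : HasFourierDensity k s v b) :
    HasFourierDensity k s (u - v) (fun ξ => a ξ - b ξ) := by
  have h1 := h.add hk (h'.smul (-1))
  have h2 : u + (-1 : ℂ) • v = u - v := by module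
  rw [h2] at h1
  simpa [sub_eq_add_neg] using h1

theorem HasFourierDensity.congr {s : ℝ} {u : 𝓢'(Hyp d, ℂ)} {a b : Hyp d → ℂ}
    (h : HasFourierDensity k s u a) (hab : a =ᵐ[volume] b) : HasFourierDensity k s u b where
  memLp := h.memLp.ae_eq (hab.mono fun ξ hξ => by simp only [hξ])
  apply_eq ψ := (h.apply_eq ψ).trans (integral_congr_ae (hab.mono fun ξ hξ => by simp only [hξ]))

theorem HasFourierDensity.mono (hk : 0 < k) {s r : ℝ} (hr : r ≤ s) {u : 𝓢'(Hyp d, ℂ)}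
    {a : Hyp d → ℂ} (h : HasFourierDensity k s u a) : HasFourierDensity k r u a :=
  ⟨memLp_weight_mono hk hr h.memLp, h.apply_eq⟩

theorem bessel_apply (s : ℝ) (u : 𝓢'(Hyp d, ℂ)) (ψ : 𝓢(Hyp d, ℂ)) :
    bessel d k s u ψ =
      u (𝓕 (SchwartzMap.smulLeftCLM ℂ (fun ξ : Hyp d => ((weight k s ξ : ℝ) : ℂ)) (𝓕⁻ ψ))) := by
  rw [bessel_eq, TemperedDistribution.fourierMultiplierCLM_apply_apply]

/-- The Bessel potentials of orders `s` and `-s` are inverse to each other. -/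
theorem bessel_neg_bessel (hk : 0 < k) (s : ℝ) (u : 𝓢'(Hyp d, ℂ)) :
    bessel d k (-s) (bessel d k s u) = u := by
  rw [bessel_eq, bessel_eq, TemperedDistribution.fourierMultiplierCLM_fourierMultiplierCLM_apply
    (hasTemperateGrowth_weight hk _) (hasTemperateGrowth_weight hk _)]
  have : ((fun ξ : Hyp d => ((weight k (-s) ξ : ℝ) : ℂ)) * fun ξ : Hyp d => ((weight k s ξ : ℝ) : ℂ)) =
      fun _ => 1 := by
    ext ξ
    rw [Pi.mul_apply, ← Complex.ofReal_mul, weight_neg_mul_weight hk, Complex.ofReal_one]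
  rw [mul_comm, this, TemperedDistribution.fourierMultiplierCLM_const]
  simp

theorem hasFourierDensity_of_bessel_eq (hk : 0 < k) {s : ℝ} {u : 𝓢'(Hyp d, ℂ)}
    {f : Lp ℂ 2 (volume : Measure (Hyp d))} (h : bessel d k s u = (f : 𝓢'(Hyp d, ℂ))) :
    HasFourierDensity k s u (fun ξ => (weight k (-s) ξ : ℂ) * (𝓕 f : Lp ℂ 2 volume) ξ) where
  memLp := by
    refine (Lp.memLp (𝓕 f : Lp ℂ 2 volume)).ae_eq (ae_of_all _ fun ξ => ?_)
    have := eq_weight_neg_mul hk (-s) (𝓕 f : Lp ℂ 2 volume) ξ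
    rwa [neg_neg] at this
  apply_eq ψ := by
    rw [← bessel_neg_bessel hk s u, h, bessel_apply,
      ← TemperedDistribution.fourier_apply, Lp.fourier_toTemperedDistribution_eq,
      Lp.toTemperedDistribution_apply]
    congr 1
    ext ξ
    rw [SchwartzMap.smulLeftCLM_apply_apply (hasTemperateGrowth_weight hk (-s)), smul_eq_mul,
      smul_eq_mul]
    ring

theorem HasFourierDensity.bessel_eq (hk : 0 < k) {s : ℝ} {u : 𝓢'(Hyp d, ℂ)} {a : Hyp d → ℂ}
    (h : HasFourierDensity k s u a) :
    bessel d k s u = ((𝓕⁻ (h.memLp.toLp _) : Lp ℂ 2 volume) : 𝓢'(Hyp d, ℂ)) := by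
  ext ψ
  rw [bessel_apply, h.apply_eq, ← Lp.fourierInv_toTemperedDistribution_eq,
    TemperedDistribution.fourierInv_apply, Lp.toTemperedDistribution_apply,
    FourierTransform.fourierInv_fourier_eq]
  refine integral_congr_ae ?_
  filter_upwards [h.memLp.coeFn_toLp] with ξ hξ
  rw [SchwartzMap.smulLeftCLM_apply_apply (hasTemperateGrowth_weight hk s), hξ, smul_eq_mul,
    smul_eq_mul]
  ring

theorem toTemperedDistribution_injective :
    Function.Injective (Lp.toTemperedDistribution : Lp ℂ 2 (volume : Measure (Hyp d)) → _) := by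
  have h := Lp.ker_toTemperedDistributionCLM_eq_bot (F := ℂ) (p := 2)
    (μ := (volume : Measure (Hyp d)))
  exact LinearMap.ker_eq_bot.1 h

theorem HasFourierDensity.sobolevNorm_eq (hk : 0 < k) {s : ℝ} {u : 𝓢'(Hyp d, ℂ)} {a : Hyp d → ℂ}
    (h : HasFourierDensity k s u a) :
    sobolevNorm k s u = eLpNorm (fun ξ => (weight k s ξ : ℂ) * a ξ) 2 := by
  have h1 : ‖(𝓕⁻ (h.memLp.toLp _) : Lp ℂ 2 volume)‖ₑ =
      eLpNorm (fun ξ => (weight k s ξ : ℂ) * a ξ) 2 := by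
    have : ‖(𝓕⁻ (h.memLp.toLp _) : Lp ℂ 2 volume)‖ = ‖h.memLp.toLp _‖ := by
      rw [← Lp.norm_fourier_eq, FourierTransform.fourier_fourierInv_eq]
    rw [← ofReal_norm, this, ofReal_norm, Lp.enorm_toLp]
  rw [← h1, sobolevNorm]
  refine le_antisymm (iInf₂_le (𝓕⁻ (h.memLp.toLp _) : Lp ℂ 2 volume) (h.bessel_eq hk)) (le_iInf₂ fun f hf => ?_)
  rw [toTemperedDistribution_injective (hf.symm.trans (h.bessel_eq hk))]

/-- Densities are unique up to null sets, even across different orders. -/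
theorem HasFourierDensity.ae_eq (hk : 0 < k) {s t : ℝ} {u : 𝓢'(Hyp d, ℂ)} {a b : Hyp d → ℂ}
    (h : HasFourierDensity k s u a) (h' : HasFourierDensity k t u b) : a =ᵐ[volume] b := by
  have h1 := h.mono hk (min_le_left s t)
  have h2 := h'.mono hk (min_le_right s t)
  have h3 := toTemperedDistribution_injective ((h1.bessel_eq hk).symm.trans (h2.bessel_eq hk))
  have h4 := congrArg (fun f : Lp ℂ 2 (volume : Measure (Hyp d)) => (𝓕 f : Lp ℂ 2 volume)) h3
  simp only [FourierTransform.fourier_fourierInv_eq] at h4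
  rw [MemLp.toLp_eq_toLp_iff] at h4
  filter_upwards [h4] with ξ hξ
  rw [eq_weight_neg_mul hk (min s t) a ξ, hξ, ← eq_weight_neg_mul hk (min s t) b ξ]

theorem exists_hasFourierDensity_of_memLp (hk : 0 < k) {s : ℝ} {a : Hyp d → ℂ}
    (h : MemLp (fun ξ => (weight k s ξ : ℂ) * a ξ) 2) :
    ∃ u : 𝓢'(Hyp d, ℂ), HasFourierDensity k s u a := by
  set f : Lp ℂ 2 (volume : Measure (Hyp d)) := 𝓕⁻ (h.toLp _) with hf
  have h1 : bessel d k s (bessel d k (-s) (f : 𝓢'(Hyp d, ℂ))) = f := by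
    have := bessel_neg_bessel hk (-s) (f : 𝓢'(Hyp d, ℂ))
    rwa [neg_neg] at this
  refine ⟨_, (hasFourierDensity_of_bessel_eq hk h1).congr ?_⟩
  rw [hf, FourierTransform.fourier_fourierInv_eq]
  filter_upwards [h.coeFn_toLp] with ξ hξ
  rw [hξ, ← eq_weight_neg_mul hk s a ξ]

theorem exists_hasFourierDensity (hk : 0 < k) {s : ℝ} {u : 𝓢'(Hyp d, ℂ)} (hu : u ∈ sobolev d s) :
    ∃ a, HasFourierDensity k s u a := by
  have h := sobolevNorm_lt_top hk hu
  obtain ⟨f, hf⟩ := iInf_lt_iff.1 h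
  obtain ⟨hf, -⟩ := iInf_lt_iff.1 hf
  exact ⟨_, hasFourierDensity_of_bessel_eq hk hf⟩

theorem exists_one_add_le_weight (hk : 0 < k) (s : ℝ) :
    ∃ C, ∀ ξ : Hyp d, (1 + ‖ξ‖ ^ 2) ^ (s / 2) ≤ C * weight k s ξ := by
  set m := min (k ^ 2) ((2 * Real.pi) ^ 2)
  have hm : 0 < m := lt_min (by positivity) (by positivity)
  set M := max (k ^ 2) ((2 * Real.pi) ^ 2)
  have hM : 0 < M := lt_max_of_lt_left (by positivity)
  have e (ξ : Hyp d) : k ^ 2 + ‖(2 * Real.pi) • ξ‖ ^ 2 = k ^ 2 + (2 * Real.pi) ^ 2 * ‖ξ‖ ^ 2 := by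
    rw [norm_two_pi_smul_sq, mul_pow]
  rcases le_total 0 (s / 2) with hs | hs
  · refine ⟨(m⁻¹) ^ (s / 2), fun ξ => ?_⟩
    rw [weight, ← Real.mul_rpow (by positivity) (by positivity)]
    refine Real.rpow_le_rpow (by positivity) ?_ hs
    rw [inv_mul_eq_div, le_div_iff₀ hm, e]
    nlinarith [min_le_left (k ^ 2) ((2 * Real.pi) ^ 2),
      mul_le_mul_of_nonneg_right (min_le_right (k ^ 2) ((2 * Real.pi) ^ 2)) (sq_nonneg ‖ξ‖)]
  · refine ⟨(M⁻¹) ^ (s / 2), fun ξ => ?_⟩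
    rw [weight, ← Real.mul_rpow (by positivity) (by positivity)]
    refine Real.rpow_le_rpow_of_nonpos (by positivity) ?_ hs
    rw [inv_mul_eq_div, div_le_iff₀ hM, e]
    nlinarith [le_max_left (k ^ 2) ((2 * Real.pi) ^ 2),
      mul_le_mul_of_nonneg_right (le_max_right (k ^ 2) ((2 * Real.pi) ^ 2)) (sq_nonneg ‖ξ‖)]

/-- The weights `(k² + |2πξ|²)^{s/2}` and `(1 + |ξ|²)^{s/2}` are equivalent, so both describe the
same space. -/
theorem HasFourierDensity.mem_sobolev (hk : 0 < k) {s : ℝ} {u : 𝓢'(Hyp d, ℂ)} {a : Hyp d → ℂ}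
    (h : HasFourierDensity k s u a) : u ∈ sobolev d s := by
  obtain ⟨C, hC⟩ := exists_one_add_le_weight (d := d) hk s
  have hg : (fun ξ : Hyp d => (((1 + ‖ξ‖ ^ 2) ^ (s / 2) : ℝ) : ℂ)).HasTemperateGrowth := by
    fun_prop
  have h1 : MemLp (fun ξ : Hyp d => (((1 + ‖ξ‖ ^ 2) ^ (s / 2) : ℝ) : ℂ) * a ξ) 2 := by
    have := memLp_weight_mul hk (r := 0) (t := s) (zero_add s)
      (m := fun ξ : Hyp d => (((1 + ‖ξ‖ ^ 2) ^ (s / 2) : ℝ) : ℂ)) (C := C)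
      hg.1.continuous.aestronglyMeasurable (fun ξ => ?_) h.memLp
    · simpa [weight_zero] using this
    · rw [Complex.norm_real, Real.norm_of_nonneg (by positivity)]
      exact hC ξ
  refine TemperedDistribution.memSobolev_iff_exists_smulLeftCLM_fourier.2 ⟨h1.toLp _, ?_⟩
  ext ψ
  rw [TemperedDistribution.smulLeftCLM_apply_apply, TemperedDistribution.fourier_apply, h.apply_eq,
    FourierTransform.fourierInv_fourier_eq, Lp.toTemperedDistribution_apply]
  refine integral_congr_ae ?_
  filter_upwards [h1.coeFn_toLp] with ξ hξ
  rw [SchwartzMap.smulLeftCLM_apply_apply hg, hξ, smul_eq_mul, smul_eq_mul]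
  ring

/-- A Schwartz function has its Fourier transform as density, for every order. -/
theorem hasFourierDensity_schwartz (hk : 0 < k) (s : ℝ) (f : 𝓢(Hyp d, ℂ)) :
    HasFourierDensity k s (f : 𝓢'(Hyp d, ℂ)) (𝓕 f : 𝓢(Hyp d, ℂ)) where
  memLp := by
    have h1 := (SchwartzMap.smulLeftCLM ℂ (fun ξ : Hyp d => ((weight k s ξ : ℝ) : ℂ))
      (𝓕 f : 𝓢(Hyp d, ℂ))).memLp (p := 2) (μ := volume)
    refine h1.ae_eq (ae_of_all _ fun ξ => ?_)
    rw [SchwartzMap.smulLeftCLM_apply_apply (hasTemperateGrowth_weight hk s), smul_eq_mul]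
  apply_eq ψ := by
    have h := SchwartzMap.integral_fourier_mul_eq f (𝓕⁻ ψ : 𝓢(Hyp d, ℂ))
    rw [FourierTransform.fourier_fourierInv_eq] at h
    rw [h, SchwartzMap.coe_apply]
    simp only [smul_eq_mul, mul_comm]

end density

/-! ### The Fourier transform in the tangential variables -/

theorem lintegral_enorm_sq {α : Type*} [MeasurableSpace α] (f : α → ℂ) (μ : Measure α) :
    ∫⁻ x, ‖f x‖ₑ ^ 2 ∂μ = eLpNorm f 2 μ ^ 2 := by
  rw [eLpNorm_eq_lintegral_rpow_enorm_toReal (by norm_num) (by norm_num), ← ENNReal.rpow_natCast,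
    ← ENNReal.rpow_mul]
  simp

theorem memLp_two_iff {α : Type*} [MeasurableSpace α] {f : α → ℂ} {μ : Measure α}
    (hf : AEStronglyMeasurable f μ) : MemLp f 2 μ ↔ ∫⁻ x, ‖f x‖ₑ ^ 2 ∂μ < ⊤ := by
  rw [lintegral_enorm_sq, MemLp, and_iff_right hf]
  simp

section

variable {d : ℕ}

theorem continuous_fourierInv_of_integrable {b : Hyp d → ℂ} (hb : Integrable b) :
    Continuous (𝓕⁻ b) := by
  have h : Continuous (𝓕 b) := VectorFourier.fourierIntegral_continuous Real.continuous_fourierChar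
    (L := innerₗ (Hyp d)) continuous_inner hb
  have e : (𝓕⁻ b : Hyp d → ℂ) = fun x => 𝓕 b (-x) := funext fun x => Real.fourierInv_eq_fourier_neg b x
  rw [e]
  exact h.comp continuous_neg

theorem integral_fourierInv_mul {f g : Hyp d → ℂ} (hf : Integrable f) (hg : Integrable g) :
    ∫ x, 𝓕⁻ f x * g x = ∫ ξ, f ξ * 𝓕⁻ g ξ := by
  have h : ∫ x, 𝓕 f x * g (-x) = ∫ ξ, f ξ * 𝓕 (fun x => g (-x)) ξ := by
    simpa using! VectorFourier.integral_fourierIntegral_smul_eq_flip (L := innerₗ (Hyp d))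
      Real.continuous_fourierChar continuous_inner hf hg.comp_neg
  rw [← integral_neg_eq_self] at h
  simp only [neg_neg, ← Real.fourierInv_eq_fourier_comp_neg, ← Real.fourierInv_eq_fourier_neg] at h
  exact h

/-- Plancherel's theorem for functions in `L¹ ∩ L²`, whose Fourier transform is given by an
integral. -/
theorem eLpNorm_fourierInv {b : Hyp d → ℂ} (h1 : Integrable b) (h2 : MemLp b 2) :
    eLpNorm (𝓕⁻ b) 2 = eLpNorm b 2 := by
  set f : Lp ℂ 2 (volume : Measure (Hyp d)) := 𝓕⁻ (h2.toLp b) with hf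
  have e : (f : Hyp d → ℂ) =ᵐ[volume] 𝓕⁻ b := by
    refine ae_eq_of_integral_contDiff_smul_eq ((Lp.memLp f).locallyIntegrable (by norm_num))
      (continuous_fourierInv_of_integrable h1).locallyIntegrable fun g hg hgs => ?_
    have hg1 : HasCompactSupport (fun x => (g x : ℂ)) := hgs.comp_left Complex.ofReal_zero
    have hg2 : ContDiff ℝ ∞ fun x => (g x : ℂ) := Complex.ofRealCLM.contDiff.comp hg
    set ψ : 𝓢(Hyp d, ℂ) := hg1.toSchwartzMap hg2
    have e1 : (f : 𝓢'(Hyp d, ℂ)) ψ = ∫ x, g x • f x := by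
      rw [Lp.toTemperedDistribution_apply]
      rfl
    rw [← e1, hf, ← Lp.fourierInv_toTemperedDistribution_eq, TemperedDistribution.fourierInv_apply,
      Lp.toTemperedDistribution_apply]
    have e2 : ∫ x, 𝓕⁻ b x * ψ x = ∫ ξ, b ξ * 𝓕⁻ (ψ : Hyp d → ℂ) ξ :=
      integral_fourierInv_mul h1 ψ.integrable
    have e3 : ∫ x, g x • 𝓕⁻ b x = ∫ x, 𝓕⁻ b x * ψ x := by
      congr 1; ext x
      rw [mul_comm]
      rfl
    rw [e3, e2]
    refine integral_congr_ae ?_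
    filter_upwards [h2.coeFn_toLp] with ξ hξ
    rw [hξ, smul_eq_mul, mul_comm, SchwartzMap.fourierInv_coe]
  rw [← eLpNorm_congr_ae e, ← Lp.enorm_def, hf]
  have : ‖(𝓕⁻ (h2.toLp b) : Lp ℂ 2 volume)‖ = ‖h2.toLp b‖ := by
    rw [← Lp.norm_fourier_eq, FourierTransform.fourier_fourierInv_eq]
  rw [← ofReal_norm, this, ofReal_norm, Lp.enorm_toLp]

/-- The inverse Fourier transform of `G(·, t)` for each `t`. -/
def sliceFourierInv (G : Hyp d × ℝ → ℂ) (z : Hyp d × ℝ) : ℂ := 𝓕⁻ (fun ξ => G (ξ, z.2)) z.1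

variable {ν : Measure ℝ} [SFinite ν] {G H : Hyp d × ℝ → ℂ}

theorem aestronglyMeasurable_sliceFourierInv
    (hG : AEStronglyMeasurable G ((volume : Measure (Hyp d)).prod ν)) :
    AEStronglyMeasurable (sliceFourierInv G) ((volume : Measure (Hyp d)).prod ν) := by
  have e : sliceFourierInv G =ᵐ[(volume : Measure (Hyp d)).prod ν] sliceFourierInv (hG.mk G) := by
    have h0 := Measure.ae_ae_of_ae_prod (Measure.measurePreserving_swap.quasiMeasurePreserving.ae hG.ae_eq_mk)
    have h1 : ∀ᵐ t ∂ν, ∀ x, sliceFourierInv G (x, t) = sliceFourierInv (hG.mk G) (x, t) := by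
      filter_upwards [h0] with t ht x
      simp only [sliceFourierInv, Real.fourierInv_eq]
      refine integral_congr_ae ?_
      filter_upwards [ht] with ξ hξ
      simp only [Prod.swap] at hξ
      rw [hξ]
    exact (Measure.quasiMeasurePreserving_snd.ae h1).mono fun z hz => hz z.1
  refine AEStronglyMeasurable.congr ?_ e.symm
  have h2 : StronglyMeasurable fun p : (Hyp d × ℝ) × Hyp d =>
      Real.fourierChar (inner ℝ p.2 p.1.1) • hG.mk G (p.2, p.1.2) := by
    have h3 : Continuous fun p : (Hyp d × ℝ) × Hyp d =>
      ((Real.fourierChar (inner ℝ p.2 p.1.1) : Circle) : ℂ) := by fun_prop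
    exact h3.stronglyMeasurable.mul (hG.stronglyMeasurable_mk.comp_measurable (by fun_prop))
  have h4 := h2.integral_prod_right' (ν := (volume : Measure (Hyp d)))
  refine StronglyMeasurable.aestronglyMeasurable ?_
  convert h4 using 1
  ext z
  simp only [sliceFourierInv, Real.fourierInv_eq]

theorem ae_memLp_slice (hG : MemLp G 2 ((volume : Measure (Hyp d)).prod ν)) :
    ∀ᵐ t ∂ν, MemLp (fun ξ => G (ξ, t)) 2 := by
  have h1 := (memLp_two_iff hG.1).1 hG
  have hm : AEMeasurable (fun z => ‖G z‖ₑ ^ 2) ((volume : Measure (Hyp d)).prod ν) :=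
    hG.1.enorm.pow_const 2
  rw [lintegral_prod_symm _ hm] at h1
  filter_upwards [ae_lt_top' hm.lintegral_prod_left' h1.ne, hG.1.prodMk_right] with t ht ht'
  exact (memLp_two_iff ht').2 ht

/-- Plancherel's theorem in the tangential variables. -/
theorem memLp_sliceFourierInv (hG : MemLp G 2 ((volume : Measure (Hyp d)).prod ν))
    (hi : ∀ᵐ t ∂ν, Integrable fun ξ => G (ξ, t)) :
    MemLp (sliceFourierInv G) 2 ((volume : Measure (Hyp d)).prod ν) := by
  have hm := aestronglyMeasurable_sliceFourierInv hG.1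
  rw [memLp_two_iff hm, lintegral_prod_symm _ (hm.enorm.pow_const 2)]
  have h1 := (memLp_two_iff hG.1).1 hG
  rw [lintegral_prod_symm _ (hG.1.enorm.pow_const 2)] at h1
  refine lt_of_eq_of_lt (lintegral_congr_ae ?_) h1
  filter_upwards [ae_memLp_slice hG, hi] with t ht ht'
  rw [lintegral_enorm_sq (fun ξ => G (ξ, t)), ← eLpNorm_fourierInv ht' ht, ← lintegral_enorm_sq]
  rfl

theorem integral_sliceFourierInv_mul (hG : MemLp G 2 ((volume : Measure (Hyp d)).prod ν))
    (hH : MemLp H 2 ((volume : Measure (Hyp d)).prod ν))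
    (hi : ∀ᵐ t ∂ν, Integrable fun ξ => G (ξ, t)) (hi' : ∀ᵐ t ∂ν, Integrable fun ξ => H (ξ, t)) :
    ∫ z, sliceFourierInv G z * H z ∂((volume : Measure (Hyp d)).prod ν) =
      ∫ z, G z * sliceFourierInv H z ∂((volume : Measure (Hyp d)).prod ν) := by
  have i1 := (memLp_sliceFourierInv hG hi).integrable_mul hH
  have i2 := hG.integrable_mul (memLp_sliceFourierInv hH hi')
  refine (integral_prod_symm _ i1).trans (Eq.trans ?_ (integral_prod_symm _ i2).symm)
  refine integral_congr_ae ?_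
  filter_upwards [hi, hi'] with t ht ht'
  exact integral_fourierInv_mul ht ht'

end

/-! ### The field in a half-space -/

section

variable {d : ℕ} {k : ℝ} {σ : ℤˣ}

/-- The half-line `{t : ± t > 0}`. -/
def halfLine (σ : ℤˣ) : Set ℝ := {t | 0 < ((σ : ℤ) : ℝ) * t}

theorem isOpen_halfLine (σ : ℤˣ) : IsOpen (halfLine σ) :=
  isOpen_lt continuous_const (continuous_const.mul continuous_id)

theorem measurableSet_halfLine (σ : ℤˣ) : MeasurableSet (halfLine σ) :=
  (isOpen_halfLine σ).measurableSet

theorem halfLine_one : halfLine 1 = Set.Ioi 0 := by ext t; simp [halfLine]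

theorem halfLine_neg_one : halfLine (-1) = Set.Iio 0 := by ext t; simp [halfLine]

theorem volume_restrict_halfSpace (d : ℕ) (σ : ℤˣ) :
    (volume : Measure (Amb d)).restrict (halfSpace d σ) =
      (volume : Measure (Hyp d)).prod (volume.restrict (halfLine σ)) := by
  have h : (halfSpace d σ : Set (Amb d)) = Set.univ ×ˢ halfLine σ := by
    ext x; simp [halfSpace, halfLine]
  rw [h, Measure.volume_eq_prod, ← Measure.prod_restrict, Measure.restrict_univ]

/-- The layer `{x : 0 < ± x_n < R}`, as a measure in `x_n`. -/
def layer (σ : ℤˣ) (R : ℝ) : Measure ℝ :=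
  volume.restrict (halfLine σ ∩ Set.Ioo (-R) R)

instance (σ : ℤˣ) (R : ℝ) : IsFiniteMeasure (layer σ R) where
  measure_univ_lt_top := by
    rw [layer, Measure.restrict_apply_univ]
    exact (measure_mono Set.inter_subset_right).trans_lt measure_Ioo_lt_top

theorem ae_layer (σ : ℤˣ) (R : ℝ) : ∀ᵐ t ∂(layer σ R), 0 < ((σ : ℤ) : ℝ) * t ∧ |t| < R := by
  filter_upwards [ae_restrict_mem ((measurableSet_halfLine σ).inter measurableSet_Ioo)] with t ht
  exact ⟨ht.1, abs_lt.2 ht.2⟩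

theorem lintegral_layer_exp_le (σ : ℤˣ) {R r : ℝ} (hr : 0 < r) :
    ∫⁻ t, ENNReal.ofReal (Real.exp (-(2 * (((σ : ℤ) : ℝ) * t * r)))) ∂(layer σ R) ≤
      ENNReal.ofReal (1 / (2 * r)) := by
  refine (lintegral_mono' (Measure.restrict_mono Set.inter_subset_left le_rfl) le_rfl).trans ?_
  have h1 : ∫⁻ t in Set.Ioi (0 : ℝ), ENNReal.ofReal (Real.exp (-(2 * (t * r)))) =
      ENNReal.ofReal (1 / (2 * r)) := by
    have hi : IntegrableOn (fun t : ℝ => Real.exp (-(2 * (t * r)))) (Set.Ioi 0) :=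
      (integrableOn_exp_mul_Ioi (a := -(2 * r)) (by linarith) 0).congr_fun
        (fun t _ => congrArg Real.exp (by ring)) measurableSet_Ioi
    rw [← ofReal_integral_eq_lintegral_ofReal hi (ae_of_all _ fun t => (Real.exp_pos _).le)]
    congr 1
    have h := integral_exp_mul_Ioi (a := -(2 * r)) (by linarith) 0
    rw [mul_zero, Real.exp_zero] at h
    rw [← neg_div_neg_eq, ← h]
    refine setIntegral_congr_fun measurableSet_Ioi fun t _ => ?_
    exact congrArg Real.exp (by ring)
  rcases Int.units_eq_one_or σ with rfl | rfl
  · rw [halfLine_one]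
    simpa using h1.le
  · rw [halfLine_neg_one, ← h1]
    have h2 := (Measure.measurePreserving_neg (volume : Measure ℝ)).setLIntegral_comp_preimage_emb
      (MeasurableEquiv.neg ℝ).measurableEmbedding
      (fun t => ENNReal.ofReal (Real.exp (-(2 * (t * r))))) (Set.Ioi 0)
    rw [← h2, Set.neg_preimage]
    simp

theorem layer_univ_le (σ : ℤˣ) (R : ℝ) :
    (layer σ R) Set.univ ≤ ENNReal.ofReal R := by
  rw [layer, Measure.restrict_apply_univ]
  rcases Int.units_eq_one_or σ with rfl | rfl
  · rw [halfLine_one]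
    refine (measure_mono (t := Set.Ioo 0 R) fun t ht => ⟨ht.1, ht.2.2⟩).trans ?_
    rw [Real.volume_Ioo, sub_zero]
  · rw [halfLine_neg_one]
    refine (measure_mono (t := Set.Ioo (-R) 0) fun t ht => ⟨ht.2.1, ht.1⟩).trans ?_
    rw [Real.volume_Ioo]
    simp

/-- A density of order `-1/2` has a square integrable field in each layer along `Γ_∞`: the decay
rate `Re Λ(ξ)` of a plane wave is comparable to `|ξ|`. -/
theorem lintegral_layer_norm_sq_le (hk : 0 < k) (σ : ℤˣ) {R : ℝ} (hR : 0 < R) (ξ : Hyp d) :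
    ∫⁻ t, ‖Complex.exp (-((((σ : ℤ) : ℝ) * t : ℝ) * symbol k ξ))‖ₑ ^ 2 ∂(layer σ R) ≤
      ENNReal.ofReal ((3 * k * R + 2) * weight k (-1) ξ) := by
  have e : ∀ t : ℝ, ‖Complex.exp (-((((σ : ℤ) : ℝ) * t : ℝ) * symbol k ξ))‖ₑ ^ 2 =
      ENNReal.ofReal (Real.exp (-(2 * (((σ : ℤ) : ℝ) * t * (symbol k ξ).re)))) := fun t => by
    rw [← ofReal_norm, norm_exp_neg_mul_symbol, ← ENNReal.ofReal_pow (Real.exp_pos _).le,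
      ← Real.exp_nat_mul]
    congr 2
    push_cast
    ring
  simp_rw [e]
  have hw : 0 < weight k 1 ξ := weight_pos hk 1 ξ
  have hw1 : weight k (-1) ξ = (weight k 1 ξ)⁻¹ :=
    eq_inv_of_mul_eq_one_left (weight_neg_mul_weight hk 1 ξ)
  have hle : weight k 1 ξ ≤ k + 2 * Real.pi * ‖ξ‖ := by
    refine (abs_le_of_sq_le_sq' ?_ (by positivity)).2
    rw [weight_one_sq]
    nlinarith [mul_nonneg hk.le (by positivity : 0 ≤ 2 * Real.pi * ‖ξ‖)]
  rw [hw1, ← div_eq_mul_inv]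
  -- for small `ξ` the layer has finite thickness; for large `ξ` the wave decays at a rate `~ |ξ|`
  rcases le_total (2 * Real.pi * ‖ξ‖) (2 * k) with h | h
  · refine (lintegral_mono_ae (g := fun _ => 1) ?_).trans ?_
    · filter_upwards [ae_layer σ R] with t ht
      refine ENNReal.ofReal_le_one.2 (Real.exp_le_one_iff.2 (neg_nonpos.2 ?_))
      have := re_symbol_nonneg k ξ
      have := ht.1
      positivity
    · rw [lintegral_one]
      refine (layer_univ_le σ R).trans (ENNReal.ofReal_le_ofReal ?_)
      rw [le_div_iff₀ hw]
      nlinarith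
  · have hre := le_re_symbol hk ξ
    have hre0 : 0 < (symbol k ξ).re := by linarith
    refine (lintegral_layer_exp_le σ hre0).trans (ENNReal.ofReal_le_ofReal ?_)
    rw [div_le_div_iff₀ (by positivity) hw]
    nlinarith [mul_pos hk hR]

/-- The integrand of the field is square integrable over a layer: integrating `|e^{-tΛ}|²` in `t`
gains half an order. -/
theorem memLp_exp_mul (hk : 0 < k) (σ : ℤˣ) {R : ℝ} (hR : 0 < R) {b : Hyp d → ℂ}
    (hb : MemLp (fun ξ => (weight k (-(1 / 2)) ξ : ℂ) * b ξ) 2) :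
    MemLp (fun z : Amb d => Complex.exp (-((((σ : ℤ) : ℝ) * z.2 : ℝ) * symbol k z.1)) * b z.1) 2
      ((volume : Measure (Hyp d)).prod (layer σ R)) := by
  have hm : AEStronglyMeasurable b := aestronglyMeasurable_of_memLp_weight hk hb
  have hM : AEStronglyMeasurable (fun z : Amb d =>
      Complex.exp (-((((σ : ℤ) : ℝ) * z.2 : ℝ) * symbol k z.1)) * b z.1)
      ((volume : Measure (Hyp d)).prod (layer σ R)) := by
    have h1 := continuous_symbol (d := d) k
    have h2 : Continuous fun z : Amb d =>
      Complex.exp (-((((σ : ℤ) : ℝ) * z.2 : ℝ) * symbol k z.1)) := by fun_prop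
    exact h2.aestronglyMeasurable.mul hm.comp_fst
  rw [memLp_two_iff hM, lintegral_prod _ (hM.enorm.pow_const 2)]
  have h3 := (memLp_two_iff hb.1).1 hb
  refine lt_of_le_of_lt (lintegral_mono (g := fun ξ => ENNReal.ofReal (3 * k * R + 2) *
    ‖(weight k (-(1 / 2)) ξ : ℂ) * b ξ‖ₑ ^ 2) fun ξ => ?_) ?_
  · simp only [enorm_mul, mul_pow]
    rw [lintegral_mul_const' _ _ (by finiteness), ← mul_assoc]
    gcongr
    refine (lintegral_layer_norm_sq_le hk σ hR ξ).trans (le_of_eq ?_)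
    rw [ENNReal.ofReal_mul (by positivity)]
    congr 1
    rw [show (-1 : ℝ) = -(1 / 2) + -(1 / 2) by ring, weight_add hk,
      ENNReal.ofReal_mul (weight_pos hk _ _).le, ← ofReal_norm, Complex.norm_real,
      Real.norm_of_nonneg (weight_pos hk _ _).le, sq]
  · rw [lintegral_const_mul' _ _ ENNReal.ofReal_ne_top]
    exact ENNReal.mul_lt_top ENNReal.ofReal_lt_top h3

theorem exists_weight_le_exp (hk : 0 < k) (s : ℝ) {c : ℝ} (hc : 0 < c) :
    ∃ C, ∀ ξ : Hyp d, weight k s ξ ≤ C * Real.exp (c * ‖ξ‖) := by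
  obtain ⟨N, C, hC⟩ := (hasTemperateGrowth_weight (d := d) hk s).2 0
  refine ⟨C * (Real.exp c * N.factorial / c ^ N), fun ξ => ?_⟩
  have h := hC ξ
  rw [norm_iteratedFDeriv_zero, Complex.norm_real,
    Real.norm_of_nonneg (weight_pos hk s ξ).le] at h
  have hC0 : 0 ≤ C := by
    have := (weight_pos hk s ξ).le.trans h
    exact nonneg_of_mul_nonneg_left this (by positivity)
  refine h.trans ?_
  rw [mul_assoc]
  gcongr
  have h1 := Real.pow_div_factorial_le_exp (c * (1 + ‖ξ‖)) (by positivity) N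
  rw [mul_pow, div_le_iff₀ (by positivity), mul_add, mul_one, Real.exp_add] at h1
  rw [div_mul_eq_mul_div, le_div_iff₀ (by positivity)]
  linarith

/-- Away from `Γ_∞` the factor `e^{-tΛ}` beats every power of `|ξ|`. -/
theorem memLp_weight_mul_exp (hk : 0 < k) {t : ℝ} (ht : 0 < t) (s : ℝ) :
    MemLp (fun ξ : Hyp d => (weight k s ξ : ℂ) * Complex.exp (-((t : ℂ) * symbol k ξ))) 2 := by
  obtain ⟨C, hC⟩ := exists_weight_le_exp (d := d) hk s (c := t * Real.pi) (by positivity)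
  have h1 := continuous_symbol (d := d) k
  have h2 := continuous_weight (d := d) hk s
  have h3 : MemLp (fun ξ : Hyp d => Complex.exp (-((t * Real.pi * ‖ξ‖ : ℝ) : ℂ))) 2 := by
    rw [memLp_two_iff (Continuous.aestronglyMeasurable (by fun_prop))]
    have h4 := (integrable_exp_neg_mul_norm (d := d) (c := 2 * (t * Real.pi)) (by positivity)).2
    refine lt_of_le_of_lt (lintegral_mono fun ξ => le_of_eq ?_) h4
    rw [← ofReal_norm, ← ofReal_norm, ← ENNReal.ofReal_pow (norm_nonneg _), ← norm_pow,
      ← Complex.exp_nat_mul, Complex.norm_exp, Real.norm_of_nonneg (Real.exp_pos _).le]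
    congr 2
    rw [← Complex.ofReal_neg, ← Complex.ofReal_natCast, ← Complex.ofReal_mul, Complex.ofReal_re]
    push_cast
    ring
  refine MemLp.of_le_mul (c := C * Real.exp (t * k)) h3 (Continuous.aestronglyMeasurable
    (by fun_prop)) (ae_of_all _ fun ξ => ?_)
  rw [norm_mul, Complex.norm_real, Real.norm_of_nonneg (weight_pos hk s ξ).le,
    ← Complex.ofReal_neg, Complex.norm_exp (((-(t * Real.pi * ‖ξ‖) : ℝ)) : ℂ), Complex.ofReal_re]
  refine (mul_le_mul (hC ξ) (norm_exp_neg_mul_symbol_le hk ht.le ξ) (norm_nonneg _)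
    ((weight_pos hk s ξ).le.trans (hC ξ))).trans (le_of_eq ?_)
  rw [show -(t * Real.pi * ‖ξ‖) = t * Real.pi * ‖ξ‖ + -(t * (2 * Real.pi) * ‖ξ‖) by ring,
    Real.exp_add]
  ring

theorem integrable_exp_mul (hk : 0 < k) {t : ℝ} (ht : 0 < t) {s : ℝ} {b : Hyp d → ℂ}
    (hb : MemLp (fun ξ => (weight k s ξ : ℂ) * b ξ) 2) :
    Integrable fun ξ => Complex.exp (-((t : ℂ) * symbol k ξ)) * b ξ := by
  refine (hb.integrable_mul (memLp_weight_mul_exp hk ht (-s))).congr (ae_of_all _ fun ξ => ?_)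
  simp only [Pi.mul_apply]
  conv_rhs => rw [eq_weight_neg_mul hk s b ξ]
  ring

theorem halfField_eq_sliceFourierInv (b : Hyp d → ℂ) : halfField k σ b =
    sliceFourierInv fun z : Amb d =>
      Complex.exp (-((((σ : ℤ) : ℝ) * z.2 : ℝ) * symbol k z.1)) * b z.1 := by
  ext x
  rw [halfField, sliceFourierInv, Real.fourierInv_eq]

theorem memLp_halfField (hk : 0 < k) (σ : ℤˣ) {R : ℝ} (hR : 0 < R) {b : Hyp d → ℂ}
    (hb : MemLp (fun ξ => (weight k (-(1 / 2)) ξ : ℂ) * b ξ) 2) :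
    MemLp (halfField k σ b) 2 ((volume : Measure (Hyp d)).prod (layer σ R)) := by
  rw [halfField_eq_sliceFourierInv]
  refine memLp_sliceFourierInv (memLp_exp_mul hk σ hR hb) ?_
  filter_upwards [ae_layer σ R] with t ht
  exact integrable_exp_mul hk ht.1 hb

/-- The plane wave `e^{2πi ξ·x̃ - |x_n| Λ(ξ)}` in `U^σ`. -/
def planeWave (k : ℝ) (σ : ℤˣ) (ξ : Hyp d) (x : Amb d) : ℂ :=
  Complex.exp ((2 * Real.pi * inner ℝ ξ x.1 : ℝ) * Complex.I -
    ((((σ : ℤ) : ℝ) * x.2 : ℝ) * symbol k ξ))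

/-- The pairing of a plane wave with a function on `U^σ`. -/
def planeIntegral (k : ℝ) (σ : ℤˣ) (g : Amb d → ℂ) (ξ : Hyp d) : ℂ :=
  ∫ x in halfSpace d σ, planeWave k σ ξ x * g x

theorem volume_prod_layer (d : ℕ) (σ : ℤˣ) (R : ℝ) :
    (volume : Measure (Hyp d)).prod (layer σ R) =
      (volume : Measure (Amb d)).restrict (Set.univ ×ˢ (halfLine σ ∩ Set.Ioo (-R) R)) := by
  rw [layer, Measure.volume_eq_prod, ← Measure.prod_restrict, Measure.restrict_univ]

theorem measurableSet_layer (d : ℕ) (σ : ℤˣ) (R : ℝ) :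
    MeasurableSet ((Set.univ : Set (Hyp d)) ×ˢ (halfLine σ ∩ Set.Ioo (-R) R)) :=
  MeasurableSet.univ.prod ((measurableSet_halfLine σ).inter measurableSet_Ioo)

theorem setIntegral_halfSpace_eq_layer {F : Amb d → ℂ} {R : ℝ} (hF : ∀ x, R ≤ |x.2| → F x = 0) :
    ∫ x in halfSpace d σ, F x = ∫ x, F x ∂((volume : Measure (Hyp d)).prod (layer σ R)) := by
  rw [volume_prod_layer]
  refine setIntegral_eq_of_subset_of_forall_sdiff_eq_zero (halfSpace d σ).isOpen.measurableSet
    (fun x hx => hx.2.1) fun x hx => hF x ?_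
  by_contra h
  exact hx.2 ⟨Set.mem_univ _, hx.1, abs_lt.1 (not_le.1 h)⟩

theorem memLp_halfSpace_of_layer {F : Amb d → ℂ} {R : ℝ} (hF : ∀ x, R ≤ |x.2| → F x = 0)
    (h : MemLp F 2 ((volume : Measure (Hyp d)).prod (layer σ R))) :
    MemLp F 2 (volume.restrict (halfSpace d σ)) := by
  rw [volume_prod_layer, ← memLp_indicator_iff_restrict (measurableSet_layer d σ R)] at h
  refine (h.restrict (halfSpace d σ)).ae_eq ?_
  filter_upwards [ae_restrict_mem (halfSpace d σ).isOpen.measurableSet] with x hx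
  by_cases h : R ≤ |x.2|
  · rw [hF x h, Set.indicator_apply_eq_zero]
    exact fun _ => hF x h
  · exact Set.indicator_of_mem (show x ∈ Set.univ ×ˢ (halfLine σ ∩ Set.Ioo (-R) R) from
      ⟨Set.mem_univ _, hx, abs_lt.1 (not_le.1 h)⟩) F

theorem exists_forall_le_abs_eq_zero {g : Amb d → ℂ} (hgs : HasCompactSupport g) :
    ∃ R, 0 < R ∧ ∀ x : Amb d, R ≤ |x.2| → g x = 0 := by
  obtain ⟨R, hR⟩ := hgs.isCompact.isBounded.exists_norm_le
  refine ⟨|R| + 1, by positivity, fun x hx => ?_⟩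
  by_contra h
  have h1 := hR x (subset_tsupport g h)
  have h2 := norm_snd_le x
  rw [Real.norm_eq_abs] at h2
  linarith [le_abs_self R]

theorem integrable_slice {g : Amb d → ℂ} (hg : Continuous g) (hgs : HasCompactSupport g) (t : ℝ) :
    Integrable fun x : Hyp d => g (x, t) := by
  refine (hg.comp (by fun_prop : Continuous fun x : Hyp d => ((x, t) : Amb d)))
    |>.integrable_of_hasCompactSupport ?_
  refine hgs.comp_isClosedEmbedding (Isometry.isClosedEmbedding (Isometry.of_dist_eq fun x y => ?_))
  simp [Prod.dist_eq]

theorem memLp_layer {g : Amb d → ℂ} (hg : Continuous g) (hgs : HasCompactSupport g) (σ : ℤˣ)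
    (R : ℝ) : MemLp g 2 ((volume : Measure (Hyp d)).prod (layer σ R)) := by
  rw [volume_prod_layer]
  exact (hg.memLp_of_hasCompactSupport hgs).restrict _

theorem planeIntegral_eq {g : Amb d → ℂ} (hg : Continuous g) (hgs : HasCompactSupport g) {R : ℝ}
    (hR : ∀ x : Amb d, R ≤ |x.2| → g x = 0) (ξ : Hyp d) :
    planeIntegral k σ g ξ = ∫ t, Complex.exp (-((((σ : ℤ) : ℝ) * t : ℝ) * symbol k ξ)) *
      sliceFourierInv g (ξ, t) ∂(layer σ R) := by
  have h1 : Continuous fun x => planeWave k σ ξ x * g x := by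
    unfold planeWave; fun_prop
  rw [planeIntegral, setIntegral_halfSpace_eq_layer (R := R) fun x hx => by rw [hR x hx, mul_zero],
    integral_prod_symm]
  · congr 1
    ext t
    rw [sliceFourierInv, Real.fourierInv_eq, ← integral_const_mul]
    congr 1
    ext x
    rw [planeWave, Circle.smul_def, Real.fourierChar_apply, smul_eq_mul, ← mul_assoc,
      ← Complex.exp_add, real_inner_comm]
    congr 2
    ring
  · rw [volume_prod_layer]
    exact (h1.integrable_of_hasCompactSupport hgs.mul_left).integrableOn

theorem integrable_halfField_mul (hk : 0 < k) (σ : ℤˣ) {b : Hyp d → ℂ}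
    (hb : MemLp (fun ξ => (weight k (-(1 / 2)) ξ : ℂ) * b ξ) 2) {g : Amb d → ℂ} (hg : Continuous g)
    (hgs : HasCompactSupport g) :
    IntegrableOn (fun x => halfField k σ b x * g x) (halfSpace d σ) := by
  obtain ⟨R, hR0, hR⟩ := exists_forall_le_abs_eq_zero hgs
  have h := (memLp_halfField hk σ hR0 hb).integrable_mul (memLp_layer hg hgs σ R)
  rw [volume_prod_layer, ← IntegrableOn, ← integrable_indicator_iff (measurableSet_layer d σ R)] at h
  refine (h.integrableOn (s := halfSpace d σ)).congr ?_
  filter_upwards [ae_restrict_mem (halfSpace d σ).isOpen.measurableSet] with x hx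
  by_cases h : R ≤ |x.2|
  · rw [hR x h, mul_zero, Set.indicator_apply_eq_zero]
    exact fun _ => by rw [Pi.mul_apply, hR x h, mul_zero]
  · exact Set.indicator_of_mem (show x ∈ Set.univ ×ˢ (halfLine σ ∩ Set.Ioo (-R) R) from
      ⟨Set.mem_univ _, hx, abs_lt.1 (not_le.1 h)⟩) _

/-- Parseval's identity for the field. -/
theorem setIntegral_halfField_mul (hk : 0 < k) (σ : ℤˣ) {b : Hyp d → ℂ}
    (hb : MemLp (fun ξ => (weight k (-(1 / 2)) ξ : ℂ) * b ξ) 2) {g : Amb d → ℂ} (hg : Continuous g)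
    (hgs : HasCompactSupport g) :
    Integrable (fun ξ => b ξ * planeIntegral k σ g ξ) ∧
    ∫ x in halfSpace d σ, halfField k σ b x * g x = ∫ ξ, b ξ * planeIntegral k σ g ξ := by
  obtain ⟨R, hR0, hR⟩ := exists_forall_le_abs_eq_zero hgs
  have h1 := memLp_exp_mul hk σ hR0 hb
  have h2 := memLp_layer hg hgs σ R
  have h3 : ∀ᵐ t ∂(layer σ R), Integrable fun ξ : Hyp d =>
      Complex.exp (-((((σ : ℤ) : ℝ) * t : ℝ) * symbol k ξ)) * b ξ := by
    filter_upwards [ae_layer σ R] with t ht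
    exact integrable_exp_mul hk ht.1 hb
  have h4 : ∀ᵐ t ∂(layer σ R), Integrable fun x : Hyp d => g (x, t) :=
    ae_of_all _ fun t => integrable_slice hg hgs t
  have h5 : ∀ ξ, b ξ * planeIntegral k σ g ξ =
      ∫ t, Complex.exp (-((((σ : ℤ) : ℝ) * t : ℝ) * symbol k ξ)) * b ξ *
        sliceFourierInv g (ξ, t) ∂(layer σ R) := fun ξ => by
    rw [planeIntegral_eq hg hgs hR, ← integral_const_mul]
    congr 1
    ext t
    ring
  have h6 := h1.integrable_mul (memLp_sliceFourierInv h2 h4)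
  simp_rw [h5]
  refine ⟨h6.integral_prod_left, ?_⟩
  rw [setIntegral_halfSpace_eq_layer (R := R) fun x hx => by rw [hR x hx, mul_zero],
    halfField_eq_sliceFourierInv, integral_sliceFourierInv_mul h1 h2 h3 h4]
  exact integral_prod _ h6

theorem hasCompactSupport_slice {F : Amb d → ℂ} (hFs : HasCompactSupport F) (t : ℝ) :
    HasCompactSupport fun x : Hyp d => F (x, t) := by
  refine hFs.comp_isClosedEmbedding (Isometry.isClosedEmbedding (Isometry.of_dist_eq fun x y => ?_))
  simp [Prod.dist_eq]

theorem continuous_fderiv_dir {F : Amb d → ℂ} (hF : ContDiff ℝ 1 F) (j : Option (Fin d)) :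
    Continuous fun x => fderiv ℝ F x (dir j) :=
  (hF.continuous_fderiv one_ne_zero).clm_apply continuous_const

theorem setIntegral_fderiv_tangential {F : Amb d → ℂ} (hF : ContDiff ℝ 1 F)
    (hFs : HasCompactSupport F) (σ : ℤˣ) (j : Fin d) :
    ∫ x in halfSpace d σ, fderiv ℝ F x (dir (some j)) = 0 := by
  have hc := continuous_fderiv_dir hF (some j)
  have hcs : HasCompactSupport fun x => fderiv ℝ F x (dir (some j)) := hFs.fderiv_apply ℝ _
  rw [volume_restrict_halfSpace, integral_prod_symm]
  · refine integral_eq_zero_of_ae (ae_of_all _ fun t => ?_)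
    have hft : ContDiff ℝ 1 fun x : Hyp d => F (x, t) := hF.comp (by fun_prop)
    have hfs := hasCompactSupport_slice hFs t
    have e : ∀ x : Hyp d, fderiv ℝ F (x, t) (dir (some j)) =
        fderiv ℝ (fun x : Hyp d => F (x, t)) x (EuclideanSpace.single j 1) := fun x => by
      have h1 : HasFDerivAt (fun x : Hyp d => ((x, t) : Amb d))
        (ContinuousLinearMap.inl ℝ (Hyp d) ℝ) x := hasFDerivAt_prodMk_left x t
      have h2 := ((hF.differentiable one_ne_zero (x, t)).hasFDerivAt.comp x h1).fderiv
      have h3 : (F ∘ fun x : Hyp d => ((x, t) : Amb d)) = fun x => F (x, t) := rfl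
      rw [h3] at h2
      rw [h2]
      rfl
    simp only [e, Pi.zero_apply]
    have hi := (hft.continuous.integrable_of_hasCompactSupport hfs : Integrable _ volume)
    have hi' : Integrable fun x : Hyp d =>
        fderiv ℝ (fun x : Hyp d => F (x, t)) x (EuclideanSpace.single j 1) :=
      ((hft.continuous_fderiv one_ne_zero).clm_apply continuous_const).integrable_of_hasCompactSupport
        (hfs.fderiv_apply ℝ _)
    have h := integral_mul_fderiv_eq_neg_fderiv_mul_of_integrable (f := fun _ : Hyp d => (1 : ℂ))
      (g := fun x : Hyp d => F (x, t)) (v := EuclideanSpace.single j 1) (μ := volume)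
      (by simp) (by simpa using hi') (by simpa using hi) (by fun_prop)
      (fun x _ => hft.differentiable one_ne_zero x)
    simpa using h
  · rw [← volume_restrict_halfSpace]
    exact (hc.integrable_of_hasCompactSupport hcs).integrableOn

theorem setIntegral_fderiv_normal {F : Amb d → ℂ} (hF : ContDiff ℝ 1 F)
    (hFs : HasCompactSupport F) (σ : ℤˣ) :
    ∫ x in halfSpace d σ, fderiv ℝ F x (dir none) = -((σ : ℤ) : ℂ) * ∫ x : Hyp d, F (x, 0) := by
  have hc := continuous_fderiv_dir hF none
  have hcs : HasCompactSupport fun x => fderiv ℝ F x (dir none) := hFs.fderiv_apply ℝ _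
  rw [volume_restrict_halfSpace, integral_prod, ← integral_const_mul]
  · congr 1
    ext x
    have hft : ContDiff ℝ 1 fun t : ℝ => F (x, t) := hF.comp (by fun_prop)
    have hfs : HasCompactSupport fun t : ℝ => F (x, t) := by
      refine hFs.comp_isClosedEmbedding
        (Isometry.isClosedEmbedding (Isometry.of_dist_eq fun x y => ?_))
      simp [Prod.dist_eq]
    have e : ∀ t : ℝ, fderiv ℝ F (x, t) (dir none) = deriv (fun t : ℝ => F (x, t)) t := fun t => by
      have h1 : HasDerivAt (fun t : ℝ => ((x, t) : Amb d)) ((0 : Hyp d), (1 : ℝ)) t :=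
        (hasDerivAt_const t x).prodMk (hasDerivAt_id t)
      exact ((hF.differentiable one_ne_zero (x, t)).hasFDerivAt.comp_hasDerivAt t h1).deriv.symm
    simp only [e]
    rcases Int.units_eq_one_or σ with rfl | rfl
    · rw [halfLine_one, HasCompactSupport.integral_Ioi_deriv_eq hft hfs]
      simp
    · rw [halfLine_neg_one, ← integral_Iic_eq_integral_Iio,
        HasCompactSupport.integral_Iic_deriv_eq hft hfs]
      simp
  · rw [← volume_restrict_halfSpace]
    exact (hc.integrable_of_hasCompactSupport hcs).integrableOn

/-- The exponent of a plane wave as a linear form. -/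
def planeExponent (k : ℝ) (σ : ℤˣ) (ξ : Hyp d) : Amb d →L[ℝ] ℂ :=
  ((2 * Real.pi) • (innerSL ℝ ξ).comp (ContinuousLinearMap.fst ℝ (Hyp d) ℝ)).smulRight Complex.I -
    (((σ : ℤ) : ℝ) • ContinuousLinearMap.snd ℝ (Hyp d) ℝ).smulRight (symbol k ξ)

theorem planeWave_eq (k : ℝ) (σ : ℤˣ) (ξ : Hyp d) :
    planeWave k σ ξ = fun x => Complex.exp (planeExponent k σ ξ x) := by
  ext x
  simp [planeWave, planeExponent]

theorem contDiff_planeWave (k : ℝ) (σ : ℤˣ) (ξ : Hyp d) {n : ℕ∞ω} :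
    ContDiff ℝ n (planeWave k σ ξ) := by
  rw [planeWave_eq]
  exact (planeExponent k σ ξ).contDiff.cexp

theorem fderiv_planeWave_mul {g : Amb d → ℂ} (hg : ContDiff ℝ 1 g) (ξ : Hyp d) (x v : Amb d) :
    fderiv ℝ (fun x => planeWave k σ ξ x * g x) x v =
      planeExponent k σ ξ v * (planeWave k σ ξ x * g x) +
        planeWave k σ ξ x * fderiv ℝ g x v := by
  have h1 : HasFDerivAt (planeWave k σ ξ)
      (Complex.exp (planeExponent k σ ξ x) • planeExponent k σ ξ) x := by
    rw [planeWave_eq]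
    exact (planeExponent k σ ξ).hasFDerivAt.cexp
  have h2 := h1.mul (hg.differentiable one_ne_zero x).hasFDerivAt
  rw [show (fun x => planeWave k σ ξ x * g x) = planeWave k σ ξ * g from rfl, h2.fderiv]
  simp [planeWave_eq]
  ring

theorem setIntegral_fderiv_planeWave_mul {g : Amb d → ℂ} (hg : ContDiff ℝ 1 g)
    (hgs : HasCompactSupport g) (ξ : Hyp d) (j : Option (Fin d)) :
    ∫ x in halfSpace d σ, fderiv ℝ (fun x => planeWave k σ ξ x * g x) x (dir j) =
      planeExponent k σ ξ (dir j) * planeIntegral k σ g ξ +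
        planeIntegral k σ (fun x => fderiv ℝ g x (dir j)) ξ := by
  have hp := (contDiff_planeWave k σ ξ (n := 0)).continuous
  simp_rw [fderiv_planeWave_mul hg]
  rw [integral_add, integral_const_mul]
  · rfl
  · exact (((hp.mul hg.continuous).integrable_of_hasCompactSupport hgs.mul_left).const_mul
      _).integrableOn
  · exact ((hp.mul (continuous_fderiv_dir hg j)).integrable_of_hasCompactSupport
      (HasCompactSupport.mul_left (hgs.fderiv_apply ℝ _))).integrableOn

theorem planeIntegral_fderiv_tangential {g : Amb d → ℂ} (hg : ContDiff ℝ 1 g)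
    (hgs : HasCompactSupport g) (j : Fin d) (ξ : Hyp d) :
    planeIntegral k σ (fun x => fderiv ℝ g x (dir (some j))) ξ =
      -((2 * Real.pi * ξ j : ℝ) * Complex.I) * planeIntegral k σ g ξ := by
  have h := setIntegral_fderiv_planeWave_mul (k := k) (σ := σ) hg hgs ξ (some j)
  rw [setIntegral_fderiv_tangential ((contDiff_planeWave k σ ξ).mul hg) hgs.mul_left] at h
  have e : planeExponent k σ ξ (dir (some j)) = (2 * Real.pi * ξ j : ℝ) * Complex.I := by
    simp [planeExponent, dir, EuclideanSpace.inner_single_right]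
  rw [e] at h
  linear_combination -h

/-- Integration by parts against a plane wave in the normal direction; the boundary term is the
Fourier transform of the trace. -/
theorem planeIntegral_fderiv_normal {g : Amb d → ℂ} (hg : ContDiff ℝ 1 g)
    (hgs : HasCompactSupport g) (ξ : Hyp d) :
    planeIntegral k σ (fun x => fderiv ℝ g x (dir none)) ξ =
      ((σ : ℤ) : ℂ) * symbol k ξ * planeIntegral k σ g ξ -
        ((σ : ℤ) : ℂ) * 𝓕⁻ (fun x : Hyp d => g (x, 0)) ξ := by
  have h := setIntegral_fderiv_planeWave_mul (k := k) (σ := σ) hg hgs ξ none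
  rw [setIntegral_fderiv_normal ((contDiff_planeWave k σ ξ).mul hg) hgs.mul_left] at h
  have e : planeExponent k σ ξ (dir none) = -(((σ : ℤ) : ℂ) * symbol k ξ) := by
    simp [planeExponent, dir]
  have e' : ∫ x : Hyp d, planeWave k σ ξ (x, 0) * g (x, 0) = 𝓕⁻ (fun x : Hyp d => g (x, 0)) ξ := by
    rw [Real.fourierInv_eq]
    congr 1
    ext x
    rw [planeWave, Circle.smul_def, Real.fourierChar_apply, smul_eq_mul, real_inner_comm]
    simp
  rw [e, e'] at h
  linear_combination -h

end

/-! ### Green's identities for the field -/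

section

variable {d : ℕ} {k : ℝ} {σ : ℤˣ}

/-- The symbol of `∂_j` on plane waves in `U^σ`: `2πi ξ_j` in the tangential directions and
`-σ Λ(ξ)` in the normal direction. -/
def dirSymbol (k : ℝ) (σ : ℤˣ) (j : Option (Fin d)) (ξ : Hyp d) : ℂ := planeExponent k σ ξ (dir j)

/-- The component of the inner normal of `U^σ` in the direction `j`. -/
def innerNormal {d : ℕ} (σ : ℤˣ) (j : Option (Fin d)) : ℂ := if j = none then ((σ : ℤ) : ℂ) else 0

theorem dirSymbol_some (j : Fin d) (ξ : Hyp d) :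
    dirSymbol k σ (some j) ξ = (2 * Real.pi * ξ j : ℝ) * Complex.I := by
  simp [dirSymbol, planeExponent, dir, EuclideanSpace.inner_single_right]

theorem dirSymbol_none (ξ : Hyp d) :
    dirSymbol k σ none ξ = -(((σ : ℤ) : ℂ) * symbol k ξ) := by
  simp [dirSymbol, planeExponent, dir]

theorem units_int_complex_mul_self (σ : ℤˣ) : ((σ : ℤ) : ℂ) * ((σ : ℤ) : ℂ) = 1 := by
  rcases Int.units_eq_one_or σ with rfl | rfl <;> norm_num

/-- Plane waves solve the Helmholtz equation. -/
theorem sum_dirSymbol_sq (ξ : Hyp d) : ∑ j, dirSymbol k σ j ξ ^ 2 = -(k : ℂ) ^ 2 := by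
  rw [Fintype.sum_option]
  simp only [dirSymbol_some, dirSymbol_none, neg_sq, mul_pow, Complex.I_sq]
  have h1 : ((σ : ℤ) : ℂ) ^ 2 = 1 := by rw [sq, units_int_complex_mul_self]
  rw [h1, sq_symbol, ← Finset.sum_mul]
  have h2 : ∑ i : Fin d, ((2 * Real.pi * ξ i : ℝ) : ℂ) ^ 2 = ((2 * Real.pi * ‖ξ‖ : ℝ) : ℂ) ^ 2 := by
    rw [← Complex.ofReal_pow, mul_pow, EuclideanSpace.norm_sq_eq, Finset.mul_sum]
    push_cast
    refine Finset.sum_congr rfl fun i _ => ?_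
    rw [← Complex.ofReal_pow ‖ξ.ofLp i‖, Real.norm_eq_abs, sq_abs]
    push_cast
    ring
  rw [h2]
  push_cast
  ring

theorem continuous_dirSymbol (k : ℝ) (σ : ℤˣ) (j : Option (Fin d)) :
    Continuous (dirSymbol k σ j) := by
  have := continuous_symbol (d := d) k
  cases j with
  | none => rw [show dirSymbol k σ none = _ from funext dirSymbol_none]; fun_prop
  | some j => rw [show dirSymbol k σ (some j) = _ from funext (dirSymbol_some j)]; fun_prop

theorem norm_dirSymbol_le (hk : 0 < k) (σ : ℤˣ) (j : Option (Fin d)) (ξ : Hyp d) :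
    ‖dirSymbol k σ j ξ‖ ≤ weight k 1 ξ := by
  cases j with
  | none =>
    have : ‖((σ : ℤ) : ℂ)‖ = 1 := by rcases Int.units_eq_one_or σ with rfl | rfl <;> simp
    rw [dirSymbol_none, norm_neg, norm_mul, this, one_mul]
    exact norm_symbol_le_weight hk ξ
  | some j =>
    rw [dirSymbol_some, norm_mul, Complex.norm_I, mul_one, Complex.norm_real, norm_mul,
      Real.norm_of_nonneg (by positivity : (0 : ℝ) ≤ 2 * Real.pi)]
    refine le_trans ?_ (two_pi_norm_le_weight hk ξ)
    gcongr
    exact PiLp.norm_apply_le ξ j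

theorem planeIntegral_fderiv {g : Amb d → ℂ} (hg : ContDiff ℝ 1 g) (hgs : HasCompactSupport g)
    (j : Option (Fin d)) (ξ : Hyp d) :
    planeIntegral k σ (fun x => fderiv ℝ g x (dir j)) ξ =
      -(dirSymbol k σ j ξ * planeIntegral k σ g ξ) -
        innerNormal σ j * 𝓕⁻ (fun x : Hyp d => g (x, 0)) ξ := by
  cases j with
  | none =>
    rw [planeIntegral_fderiv_normal hg hgs, dirSymbol_none, innerNormal, if_pos rfl]
    ring
  | some j =>
    rw [planeIntegral_fderiv_tangential hg hgs, dirSymbol_some, innerNormal, if_neg (by simp)]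
    ring

theorem memLp_dirSymbol_mul (hk : 0 < k) (σ : ℤˣ) (j : Option (Fin d)) {a : Hyp d → ℂ}
    (ha : MemLp (fun ξ => (weight k (1 / 2) ξ : ℂ) * a ξ) 2) :
    MemLp (fun ξ => (weight k (-(1 / 2)) ξ : ℂ) * (dirSymbol k σ j ξ * a ξ)) 2 :=
  memLp_weight_mul hk (t := 1) (C := 1) (by norm_num)
    (continuous_dirSymbol k σ j).aestronglyMeasurable
    (fun ξ => by rw [one_mul]; exact norm_dirSymbol_le hk σ j ξ) ha

theorem integrable_mul_fourierInv_slice (hk : 0 < k) {s : ℝ} {a : Hyp d → ℂ}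
    (ha : MemLp (fun ξ => (weight k s ξ : ℂ) * a ξ) 2) {g : Amb d → ℂ} (hg : ContDiff ℝ ∞ g)
    (hgs : HasCompactSupport g) :
    Integrable fun ξ => a ξ * 𝓕⁻ (fun x : Hyp d => g (x, 0)) ξ := by
  set ψ : 𝓢(Hyp d, ℂ) := (hasCompactSupport_slice hgs 0).toSchwartzMap
    (hg.comp (contDiff_id.prodMk contDiff_const))
  have e : 𝓕⁻ (fun x : Hyp d => g (x, 0)) = ⇑(𝓕⁻ ψ : 𝓢(Hyp d, ℂ)) :=
    (SchwartzMap.fourierInv_coe ψ).symm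
  rw [e]
  exact integrable_mul_schwartz hk ha (𝓕⁻ ψ)

/-- The derivative of the field with density `a` in the direction `j` is the field with density
`dirSymbol j * a`, with the boundary values `a` of the field. -/
theorem setIntegral_halfField_mul_fderiv (hk : 0 < k) (σ : ℤˣ) {a : Hyp d → ℂ}
    (ha : MemLp (fun ξ => (weight k (1 / 2) ξ : ℂ) * a ξ) 2) {g : Amb d → ℂ} (hg : ContDiff ℝ ∞ g)
    (hgs : HasCompactSupport g) (j : Option (Fin d)) :
    ∫ x in halfSpace d σ, halfField k σ a x * fderiv ℝ g x (dir j) =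
      -(∫ x in halfSpace d σ, halfField k σ (fun ξ => dirSymbol k σ j ξ * a ξ) x * g x) -
        innerNormal σ j * ∫ ξ, a ξ * 𝓕⁻ (fun x : Hyp d => g (x, 0)) ξ := by
  have hg1 : ContDiff ℝ 1 g := hg.of_le (by simp)
  have ha' : MemLp (fun ξ => (weight k (-(1 / 2)) ξ : ℂ) * a ξ) 2 :=
    memLp_weight_mono hk (by norm_num) ha
  obtain ⟨i1, e1⟩ := setIntegral_halfField_mul hk σ ha' (continuous_fderiv_dir hg1 j)
    (hgs.fderiv_apply ℝ _)
  obtain ⟨i2, e2⟩ := setIntegral_halfField_mul hk σ (memLp_dirSymbol_mul hk σ j ha) hg.continuous hgs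
  rw [e1, e2, ← integral_const_mul, ← integral_neg, ← integral_sub (f := fun ξ => -(dirSymbol k σ j ξ * a ξ * planeIntegral k σ g ξ))
      i2.neg ((integrable_mul_fourierInv_slice hk ha hg hgs).const_mul _)]
  congr 1
  ext ξ
  rw [planeIntegral_fderiv hg1 hgs]
  ring

/-- Green's first identity for the field: since it solves the Helmholtz equation, its conormal
derivative has the Fourier density `Λ a`. -/
theorem sum_setIntegral_halfField_mul_fderiv (hk : 0 < k) (σ : ℤˣ) {a : Hyp d → ℂ}
    (ha : MemLp (fun ξ => (weight k (1 / 2) ξ : ℂ) * a ξ) 2) {g : Amb d → ℂ} (hg : ContDiff ℝ ∞ g)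
    (hgs : HasCompactSupport g) :
    ∑ j, ∫ x in halfSpace d σ,
        halfField k σ (fun ξ => dirSymbol k σ j ξ * a ξ) x * fderiv ℝ g x (dir j) =
      (k : ℂ) ^ 2 * (∫ x in halfSpace d σ, halfField k σ a x * g x) +
        ∫ ξ, symbol k ξ * a ξ * 𝓕⁻ (fun x : Hyp d => g (x, 0)) ξ := by
  have hg1 : ContDiff ℝ 1 g := hg.of_le (by simp)
  have ha' : MemLp (fun ξ => (weight k (-(1 / 2)) ξ : ℂ) * a ξ) 2 :=
    memLp_weight_mono hk (by norm_num) ha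
  have h1 := fun j => setIntegral_halfField_mul hk σ (memLp_dirSymbol_mul hk σ j ha)
    (continuous_fderiv_dir hg1 j) (hgs.fderiv_apply ℝ _)
  obtain ⟨i2, e2⟩ := setIntegral_halfField_mul hk σ ha' hg.continuous hgs
  have h3 : MemLp (fun ξ => (weight k (-(1 / 2)) ξ : ℂ) * (symbol k ξ * a ξ)) 2 :=
    memLp_weight_mul hk (t := 1) (C := 1) (by norm_num)
      (continuous_symbol k).aestronglyMeasurable
      (fun ξ => by rw [one_mul]; exact norm_symbol_le_weight hk ξ) ha
  rw [Finset.sum_congr rfl fun j _ => (h1 j).2, ← integral_finsetSum _ fun j _ => (h1 j).1, e2,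
    ← integral_const_mul, ← integral_add (i2.const_mul _)
      (integrable_mul_fourierInv_slice hk h3 hg hgs)]
  congr 1
  ext ξ
  have e : ∀ j, dirSymbol k σ j ξ * a ξ * planeIntegral k σ (fun x => fderiv ℝ g x (dir j)) ξ =
      dirSymbol k σ j ξ ^ 2 * -(a ξ * planeIntegral k σ g ξ) -
        innerNormal σ j * (dirSymbol k σ j ξ * a ξ * 𝓕⁻ (fun x : Hyp d => g (x, 0)) ξ) := fun j => by
    rw [planeIntegral_fderiv hg1 hgs]
    ring
  simp only [e]
  rw [Finset.sum_sub_distrib, ← Finset.sum_mul, sum_dirSymbol_sq, Fintype.sum_option]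
  simp only [innerNormal, if_true, reduceCtorEq, if_false, zero_mul, Finset.sum_const_zero,
    dirSymbol_none]
  linear_combination (symbol k ξ * a ξ * 𝓕⁻ (fun x : Hyp d => g (x, 0)) ξ) *
    units_int_complex_mul_self σ

theorem memLp_mul_halfField (hk : 0 < k) (σ : ℤˣ) {b : Hyp d → ℂ}
    (hb : MemLp (fun ξ => (weight k (-(1 / 2)) ξ : ℂ) * b ξ) 2) {g : Amb d → ℂ} (hg : Continuous g)
    (hgs : HasCompactSupport g) :
    MemLp (fun x => g x * halfField k σ b x) 2 (volume.restrict (halfSpace d σ)) := by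
  obtain ⟨R, hR0, hR⟩ := exists_forall_le_abs_eq_zero hgs
  refine memLp_halfSpace_of_layer (R := R) (fun x hx => by rw [hR x hx, zero_mul]) ?_
  obtain ⟨C, hC⟩ := hgs.exists_bound_of_continuous hg
  have h := memLp_halfField hk σ hR0 hb
  refine MemLp.of_le_mul (c := C) h (hg.aestronglyMeasurable.mul h.1) (ae_of_all _ fun x => ?_)
  rw [norm_mul]
  gcongr
  exact hC x

/-- The weak gradient of `χ V`, where `V` is the field with density `a`. -/
def cutoffGrad (k : ℝ) (σ : ℤˣ) (a : Hyp d → ℂ) (χ : Amb d → ℂ) (j : Option (Fin d))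
    (x : Amb d) : ℂ :=
  χ x * halfField k σ (fun ξ => dirSymbol k σ j ξ * a ξ) x +
    fderiv ℝ χ x (dir j) * halfField k σ a x

/-- The weak Laplacian of `χ V`, where `V` is the field with density `a`. -/
def cutoffLaplacian (k : ℝ) (σ : ℤˣ) (a : Hyp d → ℂ) (χ : Amb d → ℂ) (x : Amb d) : ℂ :=
  -(k : ℂ) ^ 2 * (χ x * halfField k σ a x) +
    ∑ j, (2 * (fderiv ℝ χ x (dir j) * halfField k σ (fun ξ => dirSymbol k σ j ξ * a ξ) x) +
      fderiv ℝ (fun y => fderiv ℝ χ y (dir j)) x (dir j) * halfField k σ a x)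

theorem contDiff_fderiv_dir {χ : Amb d → ℂ} (hχ : ContDiff ℝ ∞ χ) (j : Option (Fin d)) :
    ContDiff ℝ ∞ fun x => fderiv ℝ χ x (dir j) :=
  (hχ.fderiv_right (m := ∞) (by simp)).clm_apply contDiff_const

theorem fderiv_mul_dir {f g : Amb d → ℂ} (hf : ContDiff ℝ ∞ f) (hg : ContDiff ℝ ∞ g)
    (x v : Amb d) : fderiv ℝ (fun y => f y * g y) x v =
      f x * fderiv ℝ g x v + g x * fderiv ℝ f x v := by
  rw [fderiv_fun_mul (hf.differentiable (by simp) x) (hg.differentiable (by simp) x)]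
  simp

/-- `χ V` has the gradient given by the product rule. -/
theorem setIntegral_cutoffGrad (hk : 0 < k) (σ : ℤˣ) {a : Hyp d → ℂ}
    (ha : MemLp (fun ξ => (weight k (1 / 2) ξ : ℂ) * a ξ) 2) {χ v : Amb d → ℂ}
    (hχ : ContDiff ℝ ∞ χ) (hχs : HasCompactSupport χ) (hv : ContDiff ℝ ∞ v)
    (h0 : ∀ x : Hyp d, v (x, 0) = 0) (j : Option (Fin d)) :
    ∫ x in halfSpace d σ, χ x * halfField k σ a x * fderiv ℝ v x (dir j) =
      -∫ x in halfSpace d σ, cutoffGrad k σ a χ j x * v x := by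
  have ha' : MemLp (fun ξ => (weight k (-(1 / 2)) ξ : ℂ) * a ξ) 2 :=
    memLp_weight_mono hk (by norm_num) ha
  have hg : ContDiff ℝ ∞ fun x => χ x * v x := hχ.mul hv
  have hgs : HasCompactSupport fun x => χ x * v x := hχs.mul_right
  have h1 := setIntegral_halfField_mul_fderiv hk σ ha hg hgs j
  have i1 := integrable_halfField_mul hk σ ha' ((contDiff_fderiv_dir hg j).continuous)
    (hgs.fderiv_apply ℝ _)
  have i2 := integrable_halfField_mul hk σ (memLp_dirSymbol_mul hk σ j ha) hg.continuous hgs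
  have i3 : IntegrableOn (fun x => halfField k σ a x * (fderiv ℝ χ x (dir j) * v x))
      (halfSpace d σ) := integrable_halfField_mul hk σ ha'
    ((contDiff_fderiv_dir hχ j).continuous.mul hv.continuous)
    (HasCompactSupport.mul_right (hχs.fderiv_apply ℝ _))
  have hz : (fun x : Hyp d => χ (x, 0) * v (x, 0)) = fun _ => 0 := by ext x; rw [h0, mul_zero]
  have hz' : ∀ ξ, 𝓕⁻ (fun _ : Hyp d => (0 : ℂ)) ξ = 0 := fun ξ => by simp [Real.fourierInv_eq]
  simp only [hz, hz', mul_zero, integral_zero, sub_zero] at h1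
  have e1 : ∀ x, χ x * halfField k σ a x * fderiv ℝ v x (dir j) =
      halfField k σ a x * fderiv ℝ (fun x => χ x * v x) x (dir j) -
        halfField k σ a x * (fderiv ℝ χ x (dir j) * v x) := fun x => by
    rw [fderiv_mul_dir hχ hv]
    ring
  have e2 : ∀ x, cutoffGrad k σ a χ j x * v x =
      halfField k σ (fun ξ => dirSymbol k σ j ξ * a ξ) x * (χ x * v x) +
        halfField k σ a x * (fderiv ℝ χ x (dir j) * v x) := fun x => by
    rw [cutoffGrad]
    ring
  simp_rw [e1, e2]
  rw [integral_sub i1 i3, integral_add i2 i3, h1]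
  ring

/-- Green's first identity for `χ V`: the conormal derivative of `χ V` is the normal derivative
`-σ Λ a` of the field times the trace of `χ`, plus the trace `a` of the field times the normal
derivative of `χ`. -/
theorem setIntegral_cutoff_green (hk : 0 < k) (σ : ℤˣ) {a : Hyp d → ℂ}
    (ha : MemLp (fun ξ => (weight k (1 / 2) ξ : ℂ) * a ξ) 2) {χ v : Amb d → ℂ}
    (hχ : ContDiff ℝ ∞ χ) (hχs : HasCompactSupport χ) (hv : ContDiff ℝ ∞ v) :
    ∫ x in halfSpace d σ, ((∑ j, cutoffGrad k σ a χ j x * fderiv ℝ v x (dir j)) +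
        v x * cutoffLaplacian k σ a χ x) =
      (∫ ξ, symbol k ξ * a ξ * 𝓕⁻ (fun x : Hyp d => χ (x, 0) * v (x, 0)) ξ) -
        ((σ : ℤ) : ℂ) * ∫ ξ, a ξ *
          𝓕⁻ (fun x : Hyp d => fderiv ℝ χ (x, 0) (dir none) * v (x, 0)) ξ := by
  have ha' : MemLp (fun ξ => (weight k (-(1 / 2)) ξ : ℂ) * a ξ) 2 :=
    memLp_weight_mono hk (by norm_num) ha
  have hg : ContDiff ℝ ∞ fun x => χ x * v x := hχ.mul hv
  have hgs : HasCompactSupport fun x => χ x * v x := hχs.mul_right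
  have hm : ∀ j : Option (Fin d), ContDiff ℝ ∞ fun x => fderiv ℝ χ x (dir j) * v x :=
    fun j => (contDiff_fderiv_dir hχ j).mul hv
  have hms : ∀ j : Option (Fin d), HasCompactSupport fun x => fderiv ℝ χ x (dir j) * v x :=
    fun j => HasCompactSupport.mul_right (hχs.fderiv_apply ℝ _)
  have i1 := fun j => integrable_halfField_mul hk σ (memLp_dirSymbol_mul hk σ j ha)
    ((contDiff_fderiv_dir hg j).continuous) (hgs.fderiv_apply ℝ _)
  have i2 := fun j => integrable_halfField_mul hk σ (memLp_dirSymbol_mul hk σ j ha)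
    (hm j).continuous (hms j)
  have i3 := fun j => integrable_halfField_mul hk σ ha' ((contDiff_fderiv_dir (hm j) j).continuous)
    ((hms j).fderiv_apply ℝ _)
  have i4 := integrable_halfField_mul hk σ ha' hg.continuous hgs
  have e : ∀ x, (∑ j, cutoffGrad k σ a χ j x * fderiv ℝ v x (dir j)) +
      v x * cutoffLaplacian k σ a χ x =
      (∑ j, halfField k σ (fun ξ => dirSymbol k σ j ξ * a ξ) x *
          fderiv ℝ (fun x => χ x * v x) x (dir j)) - (k : ℂ) ^ 2 * (halfField k σ a x * (χ x * v x)) +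
        ∑ j, (halfField k σ (fun ξ => dirSymbol k σ j ξ * a ξ) x * (fderiv ℝ χ x (dir j) * v x) +
          halfField k σ a x *
            fderiv ℝ (fun x => fderiv ℝ χ x (dir j) * v x) x (dir j)) := fun x => by
    simp only [cutoffGrad, cutoffLaplacian, fderiv_mul_dir hχ hv,
      fun j => fderiv_mul_dir (contDiff_fderiv_dir hχ j) hv]
    rw [mul_add, Finset.mul_sum, add_left_comm, ← Finset.sum_add_distrib, sub_add_eq_add_sub,
      ← Finset.sum_add_distrib, add_comm, sub_eq_add_neg]
    congr 1
    · refine Finset.sum_congr rfl fun j _ => ?_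
      ring
    · ring
  simp_rw [e]
  rw [integral_add, integral_sub, integral_finsetSum, integral_const_mul, integral_finsetSum,
    sum_setIntegral_halfField_mul_fderiv hk σ ha hg hgs]
  · have e2 : ∀ j, ∫ x in halfSpace d σ,
        (halfField k σ (fun ξ => dirSymbol k σ j ξ * a ξ) x * (fderiv ℝ χ x (dir j) * v x) +
          halfField k σ a x * fderiv ℝ (fun x => fderiv ℝ χ x (dir j) * v x) x (dir j)) =
        -(innerNormal σ j * ∫ ξ, a ξ *
          𝓕⁻ (fun x : Hyp d => fderiv ℝ χ (x, 0) (dir j) * v (x, 0)) ξ) := fun j => by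
      rw [integral_add (i2 j) (i3 j), setIntegral_halfField_mul_fderiv hk σ ha (hm j) (hms j) j]
      ring
    simp only [e2]
    rw [Fintype.sum_option]
    simp only [innerNormal, if_true, reduceCtorEq, if_false, zero_mul, neg_zero,
      Finset.sum_const_zero]
    ring
  · exact fun j _ => (i2 j).add (i3 j)
  · exact fun j _ => i1 j
  · exact integrable_finsetSum _ fun j _ => i1 j
  · exact i4.const_mul _
  · exact (integrable_finsetSum _ fun j _ => i1 j).sub (i4.const_mul _)
  · exact integrable_finsetSum _ fun j _ => (i2 j).add (i3 j)

theorem memLp_cutoffGrad (hk : 0 < k) (σ : ℤˣ) {a : Hyp d → ℂ}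
    (ha : MemLp (fun ξ => (weight k (1 / 2) ξ : ℂ) * a ξ) 2) {χ : Amb d → ℂ}
    (hχ : ContDiff ℝ ∞ χ) (hχs : HasCompactSupport χ) (j : Option (Fin d)) :
    MemLp (cutoffGrad k σ a χ j) 2 (volume.restrict (halfSpace d σ)) :=
  (memLp_mul_halfField hk σ (memLp_dirSymbol_mul hk σ j ha) hχ.continuous hχs).add
    (memLp_mul_halfField hk σ (memLp_weight_mono hk (by norm_num) ha)
      (contDiff_fderiv_dir hχ j).continuous (hχs.fderiv_apply ℝ _))

theorem memLp_cutoffLaplacian (hk : 0 < k) (σ : ℤˣ) {a : Hyp d → ℂ}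
    (ha : MemLp (fun ξ => (weight k (1 / 2) ξ : ℂ) * a ξ) 2) {χ : Amb d → ℂ}
    (hχ : ContDiff ℝ ∞ χ) (hχs : HasCompactSupport χ) :
    MemLp (cutoffLaplacian k σ a χ) 2 (volume.restrict (halfSpace d σ)) := by
  have ha' : MemLp (fun ξ => (weight k (-(1 / 2)) ξ : ℂ) * a ξ) 2 :=
    memLp_weight_mono hk (by norm_num) ha
  refine ((memLp_mul_halfField hk σ ha' hχ.continuous hχs).const_mul _).add
    (memLp_finsetSum _ fun j _ => MemLp.add ?_ ?_)
  · exact (memLp_mul_halfField hk σ (memLp_dirSymbol_mul hk σ j ha)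
      (contDiff_fderiv_dir hχ j).continuous (hχs.fderiv_apply ℝ _)).const_mul 2
  · exact memLp_mul_halfField hk σ ha'
      (contDiff_fderiv_dir (contDiff_fderiv_dir hχ j) j).continuous
      ((hχs.fderiv_apply ℝ _).fderiv_apply ℝ _)

end

/-! ### Multiplication by Schwartz functions in Sobolev spaces -/

theorem sq_lintegral_mul_le {α : Type*} [MeasurableSpace α] (μ : Measure α) {f g : α → ℝ≥0∞}
    (hf : AEMeasurable f μ) (hg : AEMeasurable g μ) :
    (∫⁻ x, f x * g x ∂μ) ^ 2 ≤ (∫⁻ x, f x ^ 2 ∂μ) * ∫⁻ x, g x ^ 2 ∂μ := by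
  have h := ENNReal.lintegral_mul_le_Lp_mul_Lq μ Real.HolderConjugate.two_two hf hg
  simp only [ENNReal.rpow_two, Pi.mul_apply] at h
  calc _ ≤ ((∫⁻ x, f x ^ 2 ∂μ) ^ (1 / (2 : ℝ)) * (∫⁻ x, g x ^ 2 ∂μ) ^ (1 / (2 : ℝ))) ^ 2 := by
        gcongr
    _ = _ := by
        rw [mul_pow, ← ENNReal.rpow_natCast, ← ENNReal.rpow_natCast, ← ENNReal.rpow_mul,
          ← ENNReal.rpow_mul]
        norm_num

section

variable {d : ℕ} {k : ℝ}

/-- Young's inequality for the convolution of `L¹` with `L²`. -/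
theorem lintegral_sq_lintegral_sub_mul_le {m A : Hyp d → ℝ≥0∞} (hm : Measurable m)
    (hA : AEMeasurable A) :
    ∫⁻ η, (∫⁻ ζ, m (ζ - η) * A ζ) ^ 2 ≤ (∫⁻ ζ, m ζ) ^ 2 * ∫⁻ ζ, A ζ ^ 2 := by
  have h1 : ∀ η, (∫⁻ ζ, m (ζ - η) * A ζ) ^ 2 ≤ (∫⁻ ζ, m ζ) * ∫⁻ ζ, m (ζ - η) * A ζ ^ 2 := fun η => by
    have hmη : Measurable fun ζ => m (ζ - η) := hm.comp (measurable_id.sub_const η)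
    have e : ∀ x : ℝ≥0∞, x ^ (1 / 2 : ℝ) * x ^ (1 / 2 : ℝ) = x := fun x => by
      rw [← ENNReal.rpow_add_of_nonneg _ _ (by norm_num) (by norm_num)]
      norm_num
    have h := sq_lintegral_mul_le volume (f := fun ζ => m (ζ - η) ^ (1 / 2 : ℝ))
      (g := fun ζ => m (ζ - η) ^ (1 / 2 : ℝ) * A ζ) (hmη.pow_const _).aemeasurable
      ((hmη.pow_const _).aemeasurable.mul hA)
    simp only [← mul_assoc, e, sq (_ * A _), mul_mul_mul_comm _ (A _)] at h
    simp only [sq (_ ^ (1 / 2 : ℝ)), e] at h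
    rw [lintegral_sub_right_eq_self (fun ζ => m ζ) η] at h
    simpa only [sq (A _), mul_assoc] using h
  refine (lintegral_mono h1).trans ?_
  have hm2 : AEMeasurable (fun p : Hyp d × Hyp d => m (p.2 - p.1) * A p.2 ^ 2)
      (volume.prod volume) :=
    (hm.comp (measurable_snd.sub measurable_fst)).aemeasurable.mul (hA.comp_snd.pow_const 2)
  rw [lintegral_const_mul'' _ hm2.lintegral_prod_right', lintegral_lintegral_swap hm2, sq, mul_assoc]
  gcongr
  rw [← lintegral_const_mul'' _ (hA.pow_const 2)]
  refine lintegral_mono fun ζ => ?_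
  have hmζ : Measurable fun x => m (ζ - x) := hm.comp (measurable_const.sub measurable_id)
  simp only
  rw [lintegral_mul_const _ hmζ, lintegral_sub_left_eq_self (fun ζ => m ζ) ζ]

/-- Peetre's inequality. -/
theorem weight_le_mul_weight (hk : 0 < k) (s : ℝ) (η ζ : Hyp d) :
    weight k s η ≤ (2 / k ^ 2) ^ (|s| / 2) * (weight k s ζ * weight k |s| (ζ - η)) := by
  have key : ∀ (s : ℝ), 0 ≤ s → ∀ η ζ : Hyp d,
      weight k s η ≤ (2 / k ^ 2) ^ (s / 2) * (weight k s ζ * weight k s (ζ - η)) := by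
    intro s hs η ζ
    unfold weight
    rw [← Real.mul_rpow (by positivity) (by positivity), ← Real.mul_rpow (by positivity)
      (by positivity)]
    refine Real.rpow_le_rpow (by positivity) ?_ (by positivity)
    have h1 : ‖(2 * Real.pi) • η‖ ≤ ‖(2 * Real.pi) • ζ‖ + ‖(2 * Real.pi) • (ζ - η)‖ := by
      have : (2 * Real.pi) • η = (2 * Real.pi) • ζ - (2 * Real.pi) • (ζ - η) := by
        rw [← smul_sub, sub_sub_cancel]
      rw [this]
      exact norm_sub_le _ _
    set p := ‖(2 * Real.pi) • ζ‖
    set q := ‖(2 * Real.pi) • (ζ - η)‖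
    rw [div_mul_eq_mul_div, le_div_iff₀ (by positivity)]
    have h2 : ‖(2 * Real.pi) • η‖ ^ 2 ≤ (p + q) ^ 2 := by gcongr
    have h3 : (p + q) ^ 2 ≤ 2 * p ^ 2 + 2 * q ^ 2 := by nlinarith [sq_nonneg (p - q)]
    have h4 : (k ^ 2 + ‖(2 * Real.pi) • η‖ ^ 2) * k ^ 2 ≤ (k ^ 2 + (2 * p ^ 2 + 2 * q ^ 2)) * k ^ 2 := by
      gcongr
      exact h2.trans h3
    nlinarith [sq_nonneg (p * q), sq_nonneg (k ^ 2)]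
  rcases le_total 0 s with hs | hs
  · rw [abs_of_nonneg hs]
    exact key s hs η ζ
  · rw [abs_of_nonpos hs]
    -- exchange the roles of `η` and `ζ` and divide
    have h := key (-s) (by linarith) ζ η
    have h1 := weight_neg_mul_weight hk s η
    have h2 := weight_neg_mul_weight hk s ζ
    have p1 := weight_pos hk s η
    have p2 := weight_pos hk s ζ
    have e : weight k (-s) (η - ζ) = weight k (-s) (ζ - η) := by
      unfold weight
      rw [← neg_sub ζ η, smul_neg, norm_neg]
    rw [e] at h
    have h3 := mul_le_mul_of_nonneg_left h (mul_pos p1 p2).le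
    calc weight k s η = weight k s η * weight k s ζ * weight k (-s) ζ := by
          rw [mul_assoc, mul_comm (weight k s ζ), h2, mul_one]
      _ ≤ _ := h3
      _ = (2 / k ^ 2) ^ (-s / 2) * (weight k s ζ * weight k (-s) (ζ - η)) *
          (weight k (-s) η * weight k s η) := by ring
      _ = _ := by rw [h1, mul_one]

theorem fourierInv_schwartz_mul (χ ψ : 𝓢(Hyp d, ℂ)) (ξ : Hyp d) :
    𝓕⁻ (fun x => χ x * ψ x) ξ =
      ∫ η, (𝓕⁻ χ : 𝓢(Hyp d, ℂ)) (ξ - η) * (𝓕⁻ ψ : 𝓢(Hyp d, ℂ)) η := by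
  set f : Hyp d → ℂ := fun x => (Real.fourierChar (inner ℝ x ξ) : ℂ) * χ x with hf
  have hfi : Integrable f := by
    refine χ.integrable.mono ?_ (ae_of_all _ fun x => ?_)
    · have : Continuous fun x : Hyp d => (Real.fourierChar (inner ℝ x ξ) : ℂ) := by fun_prop
      exact (this.mul χ.continuous).aestronglyMeasurable
    · rw [hf, norm_mul, Circle.norm_coe, one_mul]
  have h : ∫ x, 𝓕 f x * (𝓕⁻ ψ : 𝓢(Hyp d, ℂ)) x = ∫ x, f x * 𝓕 (⇑(𝓕⁻ ψ : 𝓢(Hyp d, ℂ))) x := by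
    simpa using! VectorFourier.integral_fourierIntegral_smul_eq_flip (L := innerₗ (Hyp d))
      Real.continuous_fourierChar continuous_inner hfi (𝓕⁻ ψ : 𝓢(Hyp d, ℂ)).integrable
  have e1 : 𝓕 (⇑(𝓕⁻ ψ : 𝓢(Hyp d, ℂ))) = ψ := by
    rw [← SchwartzMap.fourier_coe, FourierTransform.fourier_fourierInv_eq]
  have e2 : ∀ η, 𝓕 f η = (𝓕⁻ χ : 𝓢(Hyp d, ℂ)) (ξ - η) := fun η => by
    rw [SchwartzMap.fourierInv_coe, Real.fourier_eq, Real.fourierInv_eq]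
    congr 1
    ext x
    rw [hf, inner_sub_right, sub_eq_add_neg, AddChar.map_add_eq_mul, Circle.smul_def,
      Circle.smul_def, Circle.coe_mul, smul_eq_mul, smul_eq_mul]
    ring
  simp only [e1, e2] at h
  rw [h, Real.fourierInv_eq]
  congr 1
  ext x
  rw [hf, Circle.smul_def, smul_eq_mul]
  ring

/-- The density of `χ u`, where `u` has the density `a` and `χ` the inverse Fourier transform `c`. -/
def mulDensity (c a : Hyp d → ℂ) (η : Hyp d) : ℂ := ∫ ζ, c (ζ - η) * a ζ

/-- Multiplication by a Schwartz function is bounded on all Sobolev spaces. -/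
theorem exists_hasFourierDensity_smulLeftCLM (hk : 0 < k) (s : ℝ) (χ : 𝓢(Hyp d, ℂ)) :
    ∃ C : ℝ≥0∞, C ≠ ⊤ ∧ ∀ u a, HasFourierDensity k s u a → ∃ b,
      HasFourierDensity k s (TemperedDistribution.smulLeftCLM ℂ χ u) b ∧
      eLpNorm (fun ξ => (weight k s ξ : ℂ) * b ξ) 2 ≤
        C * eLpNorm (fun ξ => (weight k s ξ : ℂ) * a ξ) 2 := by
  set c : 𝓢(Hyp d, ℂ) := 𝓕⁻ χ with hc
  set P : ℝ := (2 / k ^ 2) ^ (|s| / 2) with hP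
  set m : Hyp d → ℝ≥0∞ := fun ζ => ‖(weight k |s| ζ : ℂ) * c ζ‖ₑ with hm
  have hwc : ∀ t, Continuous fun ζ : Hyp d => (weight k t ζ : ℂ) := fun t =>
    Complex.continuous_ofReal.comp (continuous_weight hk t)
  have hmm : Measurable m := ((hwc |s|).mul c.continuous).measurable.enorm
  have hmfin : ∫⁻ ζ, m ζ ≠ ⊤ := by
    have h := (SchwartzMap.smulLeftCLM ℂ (fun ξ : Hyp d => ((weight k |s| ξ : ℝ) : ℂ))
      c).integrable (μ := volume)
    have h2 : Integrable fun ζ => (weight k |s| ζ : ℂ) * c ζ := h.congr (ae_of_all _ fun ζ => by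
      rw [SchwartzMap.smulLeftCLM_apply_apply (hasTemperateGrowth_weight hk |s|), smul_eq_mul])
    exact h2.2.ne
  have hP0 : 0 < P := by positivity
  refine ⟨ENNReal.ofReal P * ∫⁻ ζ, m ζ, ENNReal.mul_ne_top ENNReal.ofReal_ne_top hmfin,
    fun u a h => ?_⟩
  set A : Hyp d → ℝ≥0∞ := fun ζ => ‖(weight k s ζ : ℂ) * a ζ‖ₑ with hA
  have ham : AEStronglyMeasurable a := aestronglyMeasurable_of_memLp_weight hk h.memLp
  have hAm : AEMeasurable A := h.memLp.1.enorm
  have hwn : ∀ t (ζ : Hyp d), ‖(weight k t ζ : ℂ)‖ₑ = ENNReal.ofReal (weight k t ζ) := fun t ζ => by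
    rw [← ofReal_norm, Complex.norm_real, Real.norm_of_nonneg (weight_pos hk t ζ).le]
  have hpt : ∀ η ζ, ‖(weight k s η : ℂ)‖ₑ * ‖c (ζ - η) * a ζ‖ₑ ≤
      ENNReal.ofReal P * (m (ζ - η) * A ζ) := fun η ζ => by
    have := ENNReal.ofReal_le_ofReal (weight_le_mul_weight hk s η ζ)
    rw [ENNReal.ofReal_mul (by positivity), ENNReal.ofReal_mul (weight_pos hk _ _).le] at this
    simp only [hm, hA, enorm_mul, hwn]
    calc _ ≤ ENNReal.ofReal ((2 / k ^ 2) ^ (|s| / 2)) * (ENNReal.ofReal (weight k s ζ) *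
          ENNReal.ofReal (weight k |s| (ζ - η))) * (‖c (ζ - η)‖ₑ * ‖a ζ‖ₑ) := by gcongr
      _ = _ := by ring
  set M : Hyp d → ℝ≥0∞ := fun η => ∫⁻ ζ, m (ζ - η) * A ζ with hM
  have hYoung : ∫⁻ η, M η ^ 2 ≤ (∫⁻ ζ, m ζ) ^ 2 * ∫⁻ ζ, A ζ ^ 2 :=
    lintegral_sq_lintegral_sub_mul_le hmm hAm
  have hmAm : AEMeasurable (fun p : Hyp d × Hyp d => m (p.2 - p.1) * A p.2)
      (volume.prod volume) :=
    (hmm.comp (measurable_snd.sub measurable_fst)).aemeasurable.mul hAm.comp_snd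
  have hMm : AEMeasurable M := hmAm.lintegral_prod_right'
  set b := mulDensity c a with hb
  have hjoint : AEStronglyMeasurable (fun p : Hyp d × Hyp d => c (p.2 - p.1) * a p.2)
      (volume.prod volume) :=
    (c.continuous.comp (continuous_snd.sub continuous_fst)).aestronglyMeasurable.mul ham.comp_snd
  have hbm : AEStronglyMeasurable b := hjoint.integral_prod_right'
  -- by Peetre's inequality the weighted density is dominated by a convolution of `L¹` with `L²`
  have hbM : ∀ η, ‖(weight k s η : ℂ) * b η‖ₑ ≤ ENNReal.ofReal P * M η := fun η => by
    rw [enorm_mul]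
    calc _ ≤ ‖(weight k s η : ℂ)‖ₑ * ∫⁻ ζ, ‖c (ζ - η) * a ζ‖ₑ := by
          gcongr; exact enorm_integral_le_lintegral_enorm _
      _ = ∫⁻ ζ, ‖(weight k s η : ℂ)‖ₑ * ‖c (ζ - η) * a ζ‖ₑ :=
          (lintegral_const_mul' _ _ enorm_ne_top).symm
      _ ≤ ∫⁻ ζ, ENNReal.ofReal P * (m (ζ - η) * A ζ) := lintegral_mono (hpt η)
      _ = _ := lintegral_const_mul' _ _ ENNReal.ofReal_ne_top
  have hfin : ∫⁻ ζ, A ζ ^ 2 < ⊤ := (memLp_two_iff h.memLp.1).1 h.memLp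
  have hbsq : ∫⁻ η, ‖(weight k s η : ℂ) * b η‖ₑ ^ 2 ≤
      (ENNReal.ofReal P * ∫⁻ ζ, m ζ) ^ 2 * ∫⁻ ζ, A ζ ^ 2 := by
    calc _ ≤ ∫⁻ η, ENNReal.ofReal P ^ 2 * M η ^ 2 := lintegral_mono fun η => by
          rw [← mul_pow]; gcongr; exact hbM η
      _ = ENNReal.ofReal P ^ 2 * ∫⁻ η, M η ^ 2 := lintegral_const_mul' _ _ (by finiteness)
      _ ≤ ENNReal.ofReal P ^ 2 * ((∫⁻ ζ, m ζ) ^ 2 * ∫⁻ ζ, A ζ ^ 2) := by gcongr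
      _ = _ := by ring
  refine ⟨b, ⟨?_, fun ψ => ?_⟩, ?_⟩
  · refine (memLp_two_iff ((hwc s).aestronglyMeasurable.mul hbm)).2 ?_
    exact hbsq.trans_lt (ENNReal.mul_lt_top (by finiteness) hfin)
  · rw [TemperedDistribution.smulLeftCLM_apply_apply, h.apply_eq]
    set ψ' : 𝓢(Hyp d, ℂ) := 𝓕⁻ ψ
    have e1 : ∀ ξ, (𝓕⁻ (SchwartzMap.smulLeftCLM ℂ χ ψ) : 𝓢(Hyp d, ℂ)) ξ =
        ∫ η, c (ξ - η) * ψ' η := fun ξ => by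
      rw [SchwartzMap.fourierInv_coe, ← fourierInv_schwartz_mul]
      refine congrArg (fun f : Hyp d → ℂ => 𝓕⁻ f ξ) (funext fun x => ?_)
      rw [SchwartzMap.smulLeftCLM_apply_apply χ.hasTemperateGrowth, smul_eq_mul]
    simp_rw [e1, hb, mulDensity, ← integral_const_mul, ← integral_mul_const]
    have hint : Integrable (Function.uncurry fun η ξ : Hyp d => c (ξ - η) * a ξ * ψ' η)
        (volume.prod volume) := by
      refine ⟨hjoint.mul ψ'.continuous.aestronglyMeasurable.comp_fst, ?_⟩
      set B : Hyp d → ℝ≥0∞ := fun η => ‖(weight k (-s) η : ℂ) * ψ' η‖ₑ with hB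
      have hBm : AEMeasurable B :=
        ((hwc (-s)).mul ψ'.continuous).measurable.enorm.aemeasurable
      have hBfin : ∫⁻ η, B η ^ 2 < ⊤ := by
        have h1 := (SchwartzMap.smulLeftCLM ℂ (fun ξ : Hyp d => ((weight k (-s) ξ : ℝ) : ℂ))
          ψ').memLp (p := 2) (μ := volume)
        refine lt_of_eq_of_lt (lintegral_congr fun η => ?_) ((memLp_two_iff h1.1).1 h1)
        rw [SchwartzMap.smulLeftCLM_apply_apply (hasTemperateGrowth_weight hk (-s)), smul_eq_mul]
      have hBψ : ∀ η, ‖ψ' η‖ₑ = ‖(weight k s η : ℂ)‖ₑ * B η := fun η => by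
        rw [hB, ← enorm_mul, ← mul_assoc, ← Complex.ofReal_mul, mul_comm (weight k s η),
          weight_neg_mul_weight hk, Complex.ofReal_one, one_mul]
      have hmeas : AEMeasurable (fun p : Hyp d × Hyp d => ‖c (p.2 - p.1) * a p.2 * ψ' p.1‖ₑ)
          (volume.prod volume) :=
        (hjoint.mul ψ'.continuous.aestronglyMeasurable.comp_fst).enorm
      calc ∫⁻ p : Hyp d × Hyp d, ‖c (p.2 - p.1) * a p.2 * ψ' p.1‖ₑ ∂(volume.prod volume)
          = ∫⁻ η, ∫⁻ ζ, ‖c (ζ - η) * a ζ * ψ' η‖ₑ := lintegral_prod _ hmeas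
        _ ≤ ∫⁻ η, (ENNReal.ofReal P * M η) * B η := lintegral_mono fun η => by
            calc ∫⁻ ζ, ‖c (ζ - η) * a ζ * ψ' η‖ₑ
                = ∫⁻ ζ, B η * (‖(weight k s η : ℂ)‖ₑ * ‖c (ζ - η) * a ζ‖ₑ) :=
                  lintegral_congr fun ζ => by rw [enorm_mul, hBψ]; ring
              _ = B η * ∫⁻ ζ, ‖(weight k s η : ℂ)‖ₑ * ‖c (ζ - η) * a ζ‖ₑ :=
                  lintegral_const_mul' _ _ enorm_ne_top
              _ ≤ B η * ∫⁻ ζ, ENNReal.ofReal P * (m (ζ - η) * A ζ) :=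
                  mul_le_mul' le_rfl (lintegral_mono (hpt η))
              _ = _ := by rw [lintegral_const_mul' _ _ ENNReal.ofReal_ne_top, mul_comm]
        _ < ⊤ := by
            have h2 := sq_lintegral_mul_le volume (hMm.const_mul (ENNReal.ofReal P)) hBm
            have h3 : ∫⁻ η, (ENNReal.ofReal P * M η) ^ 2 < ⊤ := by
              simp only [mul_pow]
              rw [lintegral_const_mul' _ _ (by finiteness)]
              exact ENNReal.mul_lt_top (by finiteness)
                (hYoung.trans_lt (ENNReal.mul_lt_top (by finiteness) hfin))
            have h4 := h2.trans_lt (ENNReal.mul_lt_top h3 hBfin)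
            exact lt_top_iff_ne_top.2 fun h5 => by simp [h5] at h4
    rw [integral_integral_swap (f := fun η ξ => c (ξ - η) * a ξ * ψ' η) hint]
    congr 1
    ext ξ
    congr 1
    ext η
    ring
  · have h1 : eLpNorm (fun ξ => (weight k s ξ : ℂ) * b ξ) 2 ^ 2 ≤
        ((ENNReal.ofReal P * ∫⁻ ζ, m ζ) * eLpNorm (fun ξ => (weight k s ξ : ℂ) * a ξ) 2) ^ 2 := by
      rw [mul_pow, ← lintegral_enorm_sq, ← lintegral_enorm_sq]
      exact hbsq
    exact (ENNReal.pow_le_pow_left_iff two_ne_zero).1 h1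

end

/-! ### Supports of tempered distributions and approximation by test functions -/

section

variable {d : ℕ} {k : ℝ}

theorem exists_cutoff {E : Type*} [NormedAddCommGroup E] [NormedSpace ℝ E]
    [FiniteDimensional ℝ E] {K U : Set E} (hK : IsCompact K) (hU : IsOpen U) (hKU : K ⊆ U) :
    ∃ χ : E → ℂ, ContDiff ℝ ∞ χ ∧ HasCompactSupport χ ∧ tsupport χ ⊆ U ∧
      ∀ᶠ x in 𝓝ˢ K, χ x = 1 := by
  obtain ⟨L, hL, hKL, hLU⟩ := exists_compact_between hK hU hKU
  obtain ⟨f, h1, h0, -⟩ := exists_contMDiffMap_one_nhds_of_subset_interior (n := (⊤ : ℕ∞))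
    (modelWithCornersSelf ℝ E) hK.isClosed hKL
  have hts : tsupport (fun x => ((f x : ℝ) : ℂ)) ⊆ L := by
    refine closure_minimal (fun x hx => ?_) hL.isClosed
    by_contra hxL
    exact hx (by simp [h0 x hxL])
  refine ⟨fun x => ((f x : ℝ) : ℂ), Complex.ofRealCLM.contDiff.comp f.contMDiff.contDiff,
    hL.of_isClosed_subset (isClosed_tsupport _) hts, hts.trans hLU, ?_⟩
  filter_upwards [h1] with x hx
  simp [hx]

/-- Truncation by dilated cut-off functions converges in the Schwartz space. -/
theorem tendsto_truncation {χ : Hyp d → ℂ} (hχ : ContDiff ℝ ∞ χ) (hχs : HasCompactSupport χ)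
    (h1 : χ 0 = 1) (ψ : 𝓢(Hyp d, ℂ)) :
    ∃ g : ℕ → 𝓢(Hyp d, ℂ), (∀ n x, g n x = χ (((n : ℝ) + 1)⁻¹ • x) * ψ x) ∧
      Tendsto g atTop (𝓝 ψ) := by
  have hdil : ∀ ε : ℝ, ε ≠ 0 → (fun x : Hyp d => χ (ε • x)).HasTemperateGrowth := fun ε hε => by
    refine HasCompactSupport.hasTemperateGrowth ?_ ?_
    · exact hχs.comp_homeomorph (Homeomorph.smulOfNeZero ε hε)
    · exact hχ.comp (contDiff_const_smul ε)
  have hε : ∀ n : ℕ, ((n : ℝ) + 1)⁻¹ ≠ 0 := fun n => by positivity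
  refine ⟨fun n => SchwartzMap.smulLeftCLM ℂ (fun x => χ (((n : ℝ) + 1)⁻¹ • x)) ψ, fun n x => by
    rw [SchwartzMap.smulLeftCLM_apply_apply (hdil _ (hε n)), smul_eq_mul], ?_⟩
  rw [(schwartz_withSeminorms ℝ (Hyp d) ℂ).tendsto_nhds]
  rintro ⟨p, q⟩
  -- the derivatives of `χ(ε x) - 1` are bounded by `ε C (1 + |x|)`
  have hbound : ∃ C, 0 ≤ C ∧ ∀ i ≤ q, ∀ ε : ℝ, 0 < ε → ε ≤ 1 → ∀ x : Hyp d,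
      ‖iteratedFDeriv ℝ i (fun x => χ (ε • x) - 1) x‖ ≤ ε * (C * (1 + ‖x‖)) := by
    have hB : ∀ i : ℕ, ∃ B, ∀ y, ‖iteratedFDeriv ℝ i χ y‖ ≤ B := fun i =>
      (hχs.iteratedFDeriv i).exists_bound_of_continuous
        (hχ.continuous_iteratedFDeriv (by exact_mod_cast le_top))
    choose B hB using hB
    have hB0 : ∀ i, 0 ≤ B i := fun i => (norm_nonneg _).trans (hB i 0)
    set C := ∑ i ∈ Finset.range (q + 2), B i with hC
    have hBC : ∀ i ≤ q + 1, B i ≤ C := fun i hi =>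
      Finset.single_le_sum (fun i _ => hB0 i) (Finset.mem_range.2 (by omega))
    have hC0 : 0 ≤ C := (hB0 0).trans (hBC 0 (by omega))
    refine ⟨C, hC0, fun i hi ε hε0 hε1 x => ?_⟩
    rcases Nat.eq_zero_or_pos i with rfl | hi0
    · rw [norm_iteratedFDeriv_zero]
      have h2 := Convex.norm_image_sub_le_of_norm_fderiv_le (𝕜 := ℝ) (f := χ) (C := C)
        (s := Set.univ) (x := 0) (y := ε • x) (fun y _ => hχ.differentiable (by simp) y)
        (fun y _ => by
          rw [← norm_iteratedFDeriv_one]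
          exact (hB 1 y).trans (hBC 1 (by omega))) convex_univ trivial trivial
      rw [h1, sub_zero, norm_smul, Real.norm_of_nonneg hε0.le] at h2
      refine h2.trans ?_
      nlinarith [mul_nonneg hε0.le hC0]
    · set L : Hyp d →L[ℝ] Hyp d := ε • ContinuousLinearMap.id ℝ (Hyp d) with hL
      have e1 : (fun x : Hyp d => χ (ε • x)) = χ ∘ L := by ext x; simp [hL]
      have hcd : ContDiff ℝ ∞ (χ ∘ L) := hχ.comp L.contDiff
      have e2 : iteratedFDeriv ℝ i (fun x => χ (ε • x) - 1) x = iteratedFDeriv ℝ i (χ ∘ L) x := by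
        have h3 := iteratedFDeriv_sub_apply (𝕜 := ℝ) (i := i) (x := x) (f := χ ∘ L)
          (g := fun _ : Hyp d => (1 : ℂ))
          ((hcd.of_le (by exact_mod_cast le_top)).contDiffAt) contDiff_const.contDiffAt
        rw [iteratedFDeriv_const_of_ne hi0.ne', Pi.zero_apply, sub_zero, ← e1] at h3
        rw [← e1]
        exact h3
      have hLn : ‖L‖ ≤ ε := by
        refine L.opNorm_le_bound hε0.le fun y => ?_
        simp [hL, norm_smul, abs_of_pos hε0]
      rw [e2, L.iteratedFDeriv_comp_right hχ x (by exact_mod_cast le_top)]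
      refine (ContinuousMultilinearMap.norm_compContinuousLinearMap_le _ _).trans ?_
      rw [Finset.prod_const, Finset.card_univ, Fintype.card_fin]
      calc _ ≤ C * ε := by
            refine mul_le_mul ((hB i _).trans (hBC i (by omega))) ?_ (by positivity) hC0
            calc ‖L‖ ^ i ≤ ε ^ i := by gcongr
              _ ≤ ε ^ 1 := pow_le_pow_of_le_one hε0.le hε1 hi0
              _ = ε := pow_one ε
        _ ≤ _ := by nlinarith [mul_nonneg (mul_nonneg hε0.le hC0) (norm_nonneg x)]
  obtain ⟨C, hC0, hC⟩ := hbound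
  set S : ℝ := ∑ i ∈ Finset.range (q + 1), (q.choose i : ℝ) *
    (C * (SchwartzMap.seminorm ℝ p (q - i) ψ + SchwartzMap.seminorm ℝ (p + 1) (q - i) ψ)) with hS
  have key : ∀ n : ℕ, SchwartzMap.seminorm ℝ p q
      (SchwartzMap.smulLeftCLM ℂ (fun x => χ (((n : ℝ) + 1)⁻¹ • x)) ψ - ψ) ≤
        ((n : ℝ) + 1)⁻¹ * S := fun n => by
    have hS0 : 0 ≤ S := Finset.sum_nonneg fun i _ => by positivity
    refine SchwartzMap.seminorm_le_bound ℝ p q _ (by positivity) fun x => ?_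
    have e : (⇑(SchwartzMap.smulLeftCLM ℂ (fun x => χ (((n : ℝ) + 1)⁻¹ • x)) ψ - ψ)) =
        fun x => (χ (((n : ℝ) + 1)⁻¹ • x) - 1) * ψ x := by
      ext x
      rw [sub_apply, SchwartzMap.smulLeftCLM_apply_apply (hdil _ (hε n)), smul_eq_mul]
      ring
    rw [e]
    have hd1 : ContDiff ℝ ∞ fun x : Hyp d => χ (((n : ℝ) + 1)⁻¹ • x) - 1 :=
      (hχ.comp (contDiff_const_smul _)).sub contDiff_const
    have hl := norm_iteratedFDeriv_mul_le hd1 (ψ.smooth ⊤) x (n := q) (by exact_mod_cast le_top)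
    refine (mul_le_mul_of_nonneg_left hl (by positivity)).trans ?_
    rw [hS, Finset.mul_sum, Finset.mul_sum]
    refine Finset.sum_le_sum fun i hi => ?_
    have h2 := hC i (by simpa [Nat.lt_succ_iff] using hi) ((n : ℝ) + 1)⁻¹ (by positivity)
      (inv_le_one_of_one_le₀ (by linarith [(Nat.cast_nonneg n : (0 : ℝ) ≤ n)])) x
    have h3 := SchwartzMap.le_seminorm ℝ p (q - i) ψ x
    have h4 := SchwartzMap.le_seminorm ℝ (p + 1) (q - i) ψ x
    calc _ ≤ ‖x‖ ^ p * (q.choose i * (((n : ℝ) + 1)⁻¹ * (C * (1 + ‖x‖))) *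
          ‖iteratedFDeriv ℝ (q - i) ψ x‖) := by gcongr
      _ = ((n : ℝ) + 1)⁻¹ * (q.choose i * (C * (‖x‖ ^ p * ‖iteratedFDeriv ℝ (q - i) ψ x‖ +
          ‖x‖ ^ (p + 1) * ‖iteratedFDeriv ℝ (q - i) ψ x‖))) := by ring
      _ ≤ _ := by gcongr
  intro ε hε'
  have hlim : Tendsto (fun n : ℕ => ((n : ℝ) + 1)⁻¹ * S) atTop (𝓝 0) := by
    have := (tendsto_one_div_add_atTop_nhds_zero_nat (𝕜 := ℝ)).mul_const S
    simpa using this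
  filter_upwards [hlim.eventually (gt_mem_nhds hε')] with n hn
  exact (key n).trans_lt hn

/-- A tempered distribution vanishes on test functions supported off its support. -/
theorem apply_eq_zero_of_hasCompactSupport (u : 𝓢'(Hyp d, ℂ)) {ψ : 𝓢(Hyp d, ℂ)}
    (hs : HasCompactSupport ψ) (h : Disjoint (tsupport ψ) (Distribution.dsupport u)) :
    u ψ = 0 := by
  have h1 : ∀ x ∈ tsupport ψ, ∃ s, Distribution.IsVanishingOn u s ∧ IsOpen s ∧ x ∈ s := fun x hx =>
    (Distribution.notMem_dsupport_iff x).1 (Set.disjoint_left.1 h hx)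
  choose! U hU hUo hxU using h1
  obtain ⟨t, ht, htc⟩ := hs.isCompact.elim_nhds_subcover U fun x hx => (hUo x hx).mem_nhds (hxU x hx)
  obtain ⟨f, hf⟩ := SmoothPartitionOfUnity.exists_isSubordinate
    (modelWithCornersSelf ℝ (Hyp d)) (isClosed_tsupport ψ) (fun i : t => U i)
    (fun i => hUo i (ht i i.2)) (fun x hx => by
      obtain ⟨i, hi, hxi⟩ := Set.mem_iUnion₂.1 (htc hx)
      exact Set.mem_iUnion.2 ⟨⟨i, hi⟩, hxi⟩)
  have hfc : ∀ i, ContDiff ℝ ∞ fun x => ((f i x : ℝ) : ℂ) * ψ x := fun i =>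
    (Complex.ofRealCLM.contDiff.comp (f i).contMDiff.contDiff).mul ψ.smooth'
  set g : t → 𝓢(Hyp d, ℂ) := fun i => HasCompactSupport.toSchwartzMap
    (f := fun x => ((f i x : ℝ) : ℂ) * ψ x) hs.mul_left (hfc i)
  have e : ψ = ∑ i, g i := by
    ext x
    have e1 : (∑ i, g i) x = ∑ i, ((f i x : ℝ) : ℂ) * ψ x := by
      rw [sum_apply]
      rfl
    rw [e1, ← Finset.sum_mul, ← Complex.ofReal_sum]
    by_cases hx : x ∈ tsupport ψ
    · have := f.sum_eq_one hx
      rw [finsum_eq_sum_of_fintype] at this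
      rw [this, Complex.ofReal_one, one_mul]
    · rw [image_eq_zero_of_notMem_tsupport hx, mul_zero]
  rw [e, map_sum]
  refine Finset.sum_eq_zero fun i _ => hU i (ht i i.2) (g i) (Set.Subset.trans ?_ (hf i))
  refine closure_mono fun x hx => ?_
  intro h0
  exact hx (by change ((f i x : ℝ) : ℂ) * ψ x = 0; rw [h0]; simp)

/-- A tempered distribution vanishes on Schwartz functions supported off its support. -/
theorem apply_eq_zero_of_disjoint_dsupport (u : 𝓢'(Hyp d, ℂ)) {ψ : 𝓢(Hyp d, ℂ)}
    (h : Disjoint (tsupport ψ) (Distribution.dsupport u)) : u ψ = 0 := by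
  obtain ⟨χ, hχ, hχs, -, h1⟩ := exists_cutoff (isCompact_singleton (x := (0 : Hyp d))) isOpen_univ
    (Set.subset_univ _)
  obtain ⟨g, hg, hlim⟩ := tendsto_truncation hχ hχs (h1.self_of_nhdsSet 0 rfl) ψ
  have h2 : ∀ n, u (g n) = 0 := fun n => by
    have e : (g n : Hyp d → ℂ) = fun x => χ (((n : ℝ) + 1)⁻¹ • x) * ψ x := funext (hg n)
    refine apply_eq_zero_of_hasCompactSupport u ?_ (h.mono_left ?_)
    · rw [e]
      exact (hχs.comp_homeomorph (Homeomorph.smulOfNeZero _ (by positivity :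
        ((n : ℝ) + 1)⁻¹ ≠ 0))).mul_right
    · rw [e]
      exact closure_mono (Function.support_mul_subset_right _ _)
  have h3 := (u.continuous.tendsto ψ).comp hlim
  refine tendsto_nhds_unique h3 ?_
  exact tendsto_const_nhds.congr fun n => (h2 n).symm

/-- Cut-off functions equal to `1` near the support do not change a distribution. -/
theorem smulLeftCLM_eq_self {u : 𝓢'(Hyp d, ℂ)} {χ : Hyp d → ℂ} (hχ : χ.HasTemperateGrowth)
    {K : Set (Hyp d)} (hu : Distribution.dsupport u ⊆ K) (h1 : ∀ᶠ x in 𝓝ˢ K, χ x = 1) :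
    TemperedDistribution.smulLeftCLM ℂ χ u = u := by
  ext ψ
  rw [TemperedDistribution.smulLeftCLM_apply_apply, ← sub_eq_zero, ← map_sub]
  refine apply_eq_zero_of_disjoint_dsupport u (Set.disjoint_left.2 fun x hx hxu => ?_)
  obtain ⟨V, hV, hKV, hV1⟩ := eventually_nhdsSet_iff_exists.1 h1
  have h2 : tsupport ⇑(SchwartzMap.smulLeftCLM ℂ χ ψ - ψ) ⊆ Vᶜ := by
    refine closure_minimal (fun y hy hyV => hy ?_) hV.isClosed_compl
    rw [sub_apply, SchwartzMap.smulLeftCLM_apply_apply hχ, hV1 y hyV, one_smul, sub_self]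
  exact h2 hx (hKV (hu hxu))

/-- Test functions on a neighbourhood of the compact set `K` approximate the elements of
`H^s_K`. -/
theorem exists_tendsto_testTempered (hk : 0 < k) {s : ℝ} {u : 𝓢'(Hyp d, ℂ)} (hu : u ∈ sobolev d s)
    {K : Set (Hyp d)} (hK : IsCompact K) (huK : Distribution.dsupport u ⊆ K) {Ω : Opens (Hyp d)}
    (hΩ : K ⊆ Ω) :
    ∃ ψ : ℕ → 𝓓(Ω, ℂ),
      Tendsto (fun j => sobolevNorm k s (testTempered Ω (ψ j) - u)) atTop (𝓝 0) := by
  obtain ⟨χ, hχ, hχs, hχΩ, h1⟩ := exists_cutoff hK Ω.isOpen hΩ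
  set X : 𝓢(Hyp d, ℂ) := hχs.toSchwartzMap hχ with hX
  have hXχ : (X : Hyp d → ℂ) = χ := rfl
  obtain ⟨C, hC, hbd⟩ := exists_hasFourierDensity_smulLeftCLM hk s X
  obtain ⟨a, ha⟩ := exists_hasFourierDensity hk hu
  -- approximate the weighted density by Schwartz functions, transform back and cut off
  have hd : ∀ ε : ℝ, 0 < ε → ∃ f : 𝓢(Hyp d, ℂ),
      eLpNorm (fun ξ => f ξ - (weight k s ξ : ℂ) * a ξ) 2 < ENNReal.ofReal ε := fun ε hε => by
    obtain ⟨f, hf⟩ := (SchwartzMap.denseRange_toLpCLM (F := ℂ) (p := 2)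
      (μ := (volume : Measure (Hyp d))) (by norm_num)).exists_dist_lt (ha.memLp.toLp _) hε
    refine ⟨f, ?_⟩
    have h2 : edist (ha.memLp.toLp _) (f.toLp 2) < ENNReal.ofReal ε := by
      rw [edist_dist]
      exact (ENNReal.ofReal_lt_ofReal_iff hε).2 hf
    rw [edist_comm, Lp.edist_def] at h2
    refine lt_of_eq_of_lt (eLpNorm_congr_ae ?_) h2
    filter_upwards [f.coeFn_toLp 2 volume, ha.memLp.coeFn_toLp] with ξ e1 e2
    rw [Pi.sub_apply, e1, e2]
  have hstep : ∀ ε : ℝ, 0 < ε → ∃ ψ : 𝓓(Ω, ℂ),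
      sobolevNorm k s (testTempered Ω ψ - u) ≤ C * ENNReal.ofReal ε := fun ε hε => by
    obtain ⟨f, hf⟩ := hd ε hε
    set φ : 𝓢(Hyp d, ℂ) :=
      𝓕⁻ (SchwartzMap.smulLeftCLM ℂ (fun ξ : Hyp d => ((weight k (-s) ξ : ℝ) : ℂ)) f) with hφ
    have h2 : ∀ ξ, (𝓕 φ : 𝓢(Hyp d, ℂ)) ξ = (weight k (-s) ξ : ℂ) * f ξ := fun ξ => by
      rw [hφ, FourierTransform.fourier_fourierInv_eq,
        SchwartzMap.smulLeftCLM_apply_apply (hasTemperateGrowth_weight hk (-s)), smul_eq_mul]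
    have h3 := (hasFourierDensity_schwartz hk s φ).sub hk ha
    obtain ⟨b, hb, hbn⟩ := hbd _ _ h3
    set ψ : 𝓓(Ω, ℂ) := ⟨fun x => χ x * φ x, hχ.mul φ.smooth', hχs.mul_right,
      (closure_mono (Function.support_mul_subset_left _ _)).trans hχΩ⟩ with hψ
    refine ⟨ψ, ?_⟩
    have e : testTempered Ω ψ - u =
        TemperedDistribution.smulLeftCLM ℂ X ((φ : 𝓢'(Hyp d, ℂ)) - u) := by
      rw [map_sub, smulLeftCLM_eq_self X.hasTemperateGrowth huK h1]
      congr 1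
      ext g
      rw [TemperedDistribution.smulLeftCLM_apply_apply, testTempered, SchwartzMap.coe_apply,
        SchwartzMap.coe_apply]
      congr 1
      ext x
      rw [SchwartzMap.smulLeftCLM_apply_apply X.hasTemperateGrowth]
      change g x • (χ x * φ x) = (χ x • g x) • φ x
      simp only [smul_eq_mul]
      ring
    rw [e, hb.sobolevNorm_eq hk]
    refine hbn.trans ?_
    gcongr
    refine le_of_eq_of_le (eLpNorm_congr_ae (ae_of_all _ fun ξ => ?_)) hf.le
    simp only [h2]
    rw [mul_sub, ← mul_assoc, ← Complex.ofReal_mul, mul_comm (weight k s ξ),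
      weight_neg_mul_weight hk, Complex.ofReal_one, one_mul]
  choose ψ hψ using fun n : ℕ => hstep (1 / ((n : ℝ) + 1)) (by positivity)
  refine ⟨ψ, ?_⟩
  have h4 : Tendsto (fun n : ℕ => C * ENNReal.ofReal (1 / ((n : ℝ) + 1))) atTop (𝓝 0) := by
    have h5 := ENNReal.tendsto_ofReal (tendsto_one_div_add_atTop_nhds_zero_nat (𝕜 := ℝ))
    rw [ENNReal.ofReal_zero] at h5
    have h6 := ENNReal.Tendsto.const_mul h5 (Or.inr hC)
    rwa [mul_zero] at h6
  exact tendsto_of_tendsto_of_tendsto_of_le_of_le tendsto_const_nhds h4 (fun _ => zero_le) hψ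

end

/-! ### The double-layer potential and its normal derivative -/

section

variable {d : ℕ} {k : ℝ}

/-- Distributions with a square integrable Fourier density are functions. -/
theorem HasFourierDensity.exists_eq_toLp (hk : 0 < k) {u : 𝓢'(Hyp d, ℂ)} {a : Hyp d → ℂ}
    (h : HasFourierDensity k 0 u a) :
    ∃ f : Lp ℂ 2 (volume : Measure (Hyp d)), ∀ ψ : 𝓢(Hyp d, ℂ), u ψ = ∫ x, f x * ψ x := by
  refine ⟨𝓕⁻ (h.memLp.toLp _), fun ψ => ?_⟩
  have h1 := congrArg (fun v : 𝓢'(Hyp d, ℂ) => v ψ) (h.bessel_eq hk)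
  simp only [bessel_apply, Lp.toTemperedDistribution_apply] at h1
  have e : (fun ξ : Hyp d => ((weight k 0 ξ : ℝ) : ℂ)) = fun _ => 1 := by
    ext ξ; rw [weight_zero, Complex.ofReal_one]
  rw [e, SchwartzMap.smulLeftCLM_const, one_smul, ContinuousLinearMap.id_apply,
    FourierTransform.fourier_fourierInv_eq] at h1
  rw [h1]
  congr 1
  ext x
  rw [smul_eq_mul, mul_comm]

/-- A function vanishes almost everywhere off the support of its distribution. -/
theorem ae_eq_zero_off_dsupport {u : 𝓢'(Hyp d, ℂ)} {f : Hyp d → ℂ} (hf : LocallyIntegrable f)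
    (hu : ∀ ψ : 𝓢(Hyp d, ℂ), u ψ = ∫ x, f x * ψ x) :
    ∀ᵐ x, x ∉ Distribution.dsupport u → f x = 0 := by
  have h0 : volume {x | ¬(x ∉ Distribution.dsupport u → f x = 0)} = 0 := by
    refine measure_null_of_locally_null _ fun x hx => ?_
    have hx' : x ∉ Distribution.dsupport u := by
      intro h
      exact hx fun h' => absurd h h'
    obtain ⟨s, hs, hso, hxs⟩ := (Distribution.notMem_dsupport_iff x).1 hx'
    refine ⟨_, inter_mem self_mem_nhdsWithin (mem_nhdsWithin_of_mem_nhds (hso.mem_nhds hxs)), ?_⟩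
    have h1 := hso.ae_eq_zero_of_integral_contDiff_smul_eq_zero (μ := volume) (f := f)
      (hf.locallyIntegrableOn s) fun g hg hgs hgt => by
        have hg1 : HasCompactSupport (fun x => (g x : ℂ)) := hgs.comp_left Complex.ofReal_zero
        have hg2 : ContDiff ℝ ∞ fun x => (g x : ℂ) := Complex.ofRealCLM.contDiff.comp hg
        have h2 := hs (hg1.toSchwartzMap hg2) (Set.Subset.trans (closure_mono fun y hy => by
          intro h0
          exact hy (by change (g y : ℂ) = 0; rw [h0, Complex.ofReal_zero])) hgt)
        rw [hu] at h2
        refine Eq.trans ?_ h2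
        congr 1
        ext y
        rw [Complex.real_smul, mul_comm]
        rfl
    rw [← nonpos_iff_eq_zero]
    refine (measure_mono fun y hy => ?_).trans (ae_iff.1 h1).le
    intro h3
    exact hy.1 fun _ => h3 hy.2
  exact h0

theorem memLp_fourier {f : Hyp d → ℂ} (h1 : Integrable f) (h2 : MemLp f 2) : MemLp (𝓕 f) 2 := by
  have h3 : Integrable fun x => f (-x) := h1.comp_neg
  have h4 : MemLp (fun x => f (-x)) 2 :=
    h2.comp_measurePreserving (Measure.measurePreserving_neg volume)
  have e : 𝓕⁻ (fun x => f (-x)) = 𝓕 f := by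
    rw [Real.fourierInv_eq_fourier_comp_neg]
    simp only [neg_neg]
  rw [← e]
  exact ⟨(continuous_fourierInv_of_integrable h3).aestronglyMeasurable,
    (eLpNorm_fourierInv h3 h4).trans_lt h4.2⟩

/-- An element of `L²` with bounded support is an integrable function. -/
theorem HasFourierDensity.exists_integrable (hk : 0 < k) {u : 𝓢'(Hyp d, ℂ)} {a : Hyp d → ℂ}
    (h : HasFourierDensity k 0 u a) {K : Set (Hyp d)} (hK : IsCompact K)
    (hu : Distribution.dsupport u ⊆ K) :
    ∃ f : Hyp d → ℂ, Integrable f ∧ (∀ᵐ x, x ∉ K → f x = 0) ∧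
      (∀ ψ : 𝓢(Hyp d, ℂ), u ψ = ∫ x, f x * ψ x) ∧ a =ᵐ[volume] 𝓕 f := by
  obtain ⟨f, hf⟩ := h.exists_eq_toLp hk
  have hf2 := Lp.memLp f
  have h0 : ∀ᵐ x, x ∉ K → f x = 0 := by
    filter_upwards [ae_eq_zero_off_dsupport (hf2.locallyIntegrable (by norm_num)) hf] with x hx hxK
    exact hx fun h' => hxK (hu h')
  have hfi : Integrable f := by
    refine IntegrableOn.integrable_of_ae_notMem_eq_zero (s := K) ?_ h0
    have : IsFiniteMeasure ((volume : Measure (Hyp d)).restrict K) :=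
      ⟨by rw [Measure.restrict_apply_univ]; exact hK.measure_lt_top⟩
    exact (hf2.restrict K).integrable (by norm_num)
  refine ⟨f, hfi, h0, hf, h.ae_eq hk (t := 0) ⟨?_, fun ψ => ?_⟩⟩
  · simpa [weight_zero] using memLp_fourier hfi hf2
  · have h1 : ∫ x, 𝓕 (f : Hyp d → ℂ) x * (𝓕⁻ ψ : 𝓢(Hyp d, ℂ)) x =
        ∫ x, f x * 𝓕 (⇑(𝓕⁻ ψ : 𝓢(Hyp d, ℂ))) x := by
      simpa using! VectorFourier.integral_fourierIntegral_smul_eq_flip (L := innerₗ (Hyp d))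
        Real.continuous_fourierChar continuous_inner hfi (𝓕⁻ ψ : 𝓢(Hyp d, ℂ)).integrable
    rw [h1, ← SchwartzMap.fourier_coe, FourierTransform.fourier_fourierInv_eq, hf]

/-- The double-layer potential with an integrable density. -/
def doubleLayer (k : ℝ) (f : Hyp d → ℂ) (x : Amb d) : ℂ :=
  ∫ y, f y * deriv (fun t : ℝ => fundSol k x (y, t)) 0

theorem hasDerivAt_slice {g : Amb d → ℂ} (hg : ContDiff ℝ ∞ g) (y : Hyp d) :
    HasDerivAt (fun t : ℝ => g (y, t)) (fderiv ℝ g (y, 0) (dir none)) 0 := by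
  have h1 : HasDerivAt (fun t : ℝ => ((y, t) : Amb d)) ((0 : Hyp d), (1 : ℝ)) 0 :=
    (hasDerivAt_const (0 : ℝ) y).prodMk (hasDerivAt_id (0 : ℝ))
  exact ((hg.differentiable (by simp)) (y, 0)).hasFDerivAt.comp_hasDerivAt (0 : ℝ) h1

/-- The cut-offs are `1` on an open set that need not contain `closure Γ`, but by continuity they
agree with `1` to first order there. -/
theorem cutoff_eq_one {Γ : Opens (Hyp d)} {χ : 𝓓((⊤ : Opens (Amb d)), ℂ)} (hχ : χ ∈ cutoffs Γ)
    {y : Hyp d} (hy : y ∈ closure (Γ : Set (Hyp d))) :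
    χ (y, 0) = 1 ∧ fderiv ℝ χ (y, 0) (dir none) = 0 := by
  have hsl : Continuous fun y : Hyp d => ((y, 0) : Amb d) := by fun_prop
  have hnh : ∀ y ∈ Γ, (χ : Amb d → ℂ) =ᶠ[𝓝 (y, 0)] fun _ => 1 := fun y hy =>
    (eventually_nhdsSet_iff_forall.1 hχ) (y, 0) ⟨hy, rfl⟩
  constructor
  · have hc : IsClosed {y : Hyp d | χ (y, 0) = 1} :=
      isClosed_eq (χ.contDiff.continuous.comp hsl) continuous_const
    exact closure_minimal (fun z hz => (hnh z hz).self_of_nhds) hc hy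
  · have hc : IsClosed {y : Hyp d | fderiv ℝ χ (y, 0) (dir none) = 0} :=
      isClosed_eq ((contDiff_fderiv_dir χ.contDiff none).continuous.comp hsl) continuous_const
    refine closure_minimal (fun z hz => ?_) hc hy
    change fderiv ℝ χ (z, 0) (dir none) = 0
    rw [(hnh z hz).fderiv_eq]
    simp

/-- The cut-off `ρ` in the definition of `𝒟_k` is immaterial: on `closure Γ`, where `f` lives, it is
`1` with vanishing normal derivative. -/
theorem isDoubleLayer_doubleLayer (hd : d = 1 ∨ d = 2) (hk : 0 < k) {Γ : Opens (Hyp d)}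
    {φ : 𝓢'(Hyp d, ℂ)} {f : Hyp d → ℂ}
    (hf0 : ∀ᵐ y, y ∉ closure (Γ : Set (Hyp d)) → f y = 0)
    (hf : ∀ ψ : 𝓢(Hyp d, ℂ), φ ψ = ∫ x, f x * ψ x) : IsDoubleLayer k Γ φ (doubleLayer k f) := by
  intro x hx ρ hρ hxρ
  obtain ⟨θ, hθ⟩ := exists_schwartz_deriv_mul_fundSol hd hk ρ hxρ
  refine ⟨θ, hθ, ?_⟩
  rw [hf, doubleLayer]
  refine integral_congr_ae ?_
  filter_upwards [hf0] with y hy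
  by_cases hyΓ : y ∈ closure (Γ : Set (Hyp d))
  · have hne : x ≠ (y, 0) := by
      rintro rfl
      exact hx ⟨hyΓ, rfl⟩
    obtain ⟨e1, e2⟩ := cutoff_eq_one hρ hyΓ
    have h1 := hasDerivAt_slice ρ.contDiff y
    have h2 : DifferentiableAt ℝ (fun t : ℝ => fundSol k x (y, t)) 0 := by
      have h3 : DifferentiableAt ℝ (fundSol k x) ((fun t : ℝ => ((y, t) : Amb d)) 0) :=
        (contDiffAt_fundSol hd hk hne).differentiableAt (by simp)
      exact h3.comp (0 : ℝ) ((differentiableAt_const y).prodMk differentiableAt_id)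
    have h4 : HasDerivAt (fun t : ℝ => ρ (y, t) * fundSol k x (y, t)) _ 0 := h1.mul h2.hasDerivAt
    rw [hθ, h4.deriv, e2, e1]
    ring
  · rw [hy hyΓ, zero_mul, zero_mul]

theorem doubleLayer_eq_halfField (hd : d = 1 ∨ d = 2) (hk : 0 < k) (σ : ℤˣ) {f : Hyp d → ℂ}
    (hf : Integrable f) {x : Amb d} (hx : x ∈ halfSpace d σ) :
    doubleLayer k f x = ((σ : ℤ) : ℂ) / 2 * halfField k σ (𝓕 f) x :=
  integral_mul_deriv_fundSol hd hk σ hx hf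

theorem testFunction_slice_eq_zero (σ : ℤˣ) (v : 𝓓(halfSpace d σ, ℂ)) (x : Hyp d) :
    v (x, 0) = 0 := by
  refine image_eq_zero_of_notMem_tsupport fun h => ?_
  have := v.tsupport_subset h
  simp [halfSpace] at this

/-- `χ 𝒟_k φ` belongs to `W^1(U^±; Δ)`. -/
theorem hasWeakGradLaplacian_cutoff (hd : d = 1 ∨ d = 2) (hk : 0 < k) (σ : ℤˣ) {f : Hyp d → ℂ}
    (hf : Integrable f) (ha : MemLp (fun ξ => (weight k (1 / 2) ξ : ℂ) * 𝓕 f ξ) 2)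
    (χ : 𝓓((⊤ : Opens (Amb d)), ℂ)) :
    HasWeakGradLaplacian σ (fun y => χ y * doubleLayer k f y)
      (fun j x => ((σ : ℤ) : ℂ) / 2 * cutoffGrad k σ (𝓕 f) χ j x)
      (fun x => ((σ : ℤ) : ℂ) / 2 * cutoffLaplacian k σ (𝓕 f) χ x) := by
  have hχ := χ.contDiff
  have hχs := χ.hasCompactSupport
  have hw : ∀ x ∈ (halfSpace d σ : Set (Amb d)), χ x * doubleLayer k f x =
      ((σ : ℤ) : ℂ) / 2 * (χ x * halfField k σ (𝓕 f) x) := fun x hx => by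
    rw [doubleLayer_eq_halfField hd hk σ hf hx]
    ring
  have hms := (halfSpace d σ).isOpen.measurableSet
  have hG := memLp_cutoffGrad hk σ ha hχ hχs
  have hL := memLp_cutoffLaplacian hk σ ha hχ hχs
  refine ⟨?_, fun j => (hG j).const_mul _, hL.const_mul _, fun j v => ?_, fun v => ?_⟩
  · refine ((memLp_mul_halfField hk σ (memLp_weight_mono hk (by norm_num) ha) hχ.continuous
      hχs).const_mul (((σ : ℤ) : ℂ) / 2)).ae_eq ?_
    filter_upwards [ae_restrict_mem hms] with x hx
    exact (hw x hx).symm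
  · have h := setIntegral_cutoffGrad hk σ ha hχ hχs v.contDiff (testFunction_slice_eq_zero σ v) j
    simp only [mul_assoc] at h ⊢
    rw [integral_const_mul, neg_mul_eq_mul_neg, ← h, ← integral_const_mul]
    refine setIntegral_congr_fun hms fun x hx => ?_
    change χ x * (doubleLayer k f x * fderiv ℝ v x (dir j)) = _
    rw [← mul_assoc, hw x hx]
    ring
  · have h := setIntegral_cutoff_green hk σ ha hχ hχs v.contDiff
    have hz' : ∀ ξ, 𝓕⁻ (fun _ : Hyp d => (0 : ℂ)) ξ = 0 := fun ξ => by simp [Real.fourierInv_eq]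
    simp only [testFunction_slice_eq_zero σ v, mul_zero, hz', integral_zero, sub_zero] at h
    have hvL : ∀ j, MemLp (fun x => fderiv ℝ v x (dir j)) 2 (volume.restrict (halfSpace d σ)) :=
      fun j => ((contDiff_fderiv_dir v.contDiff j).continuous.memLp_of_hasCompactSupport
        (v.hasCompactSupport.fderiv_apply ℝ _)).restrict _
    have hv : MemLp v 2 (volume.restrict (halfSpace d σ)) :=
      (v.contDiff.continuous.memLp_of_hasCompactSupport v.hasCompactSupport).restrict _
    have i1 : Integrable (fun x => ∑ j, cutoffGrad k σ (𝓕 f) χ j x * fderiv ℝ v x (dir j))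
        (volume.restrict (halfSpace d σ)) :=
      integrable_finsetSum _ fun j _ => (hG j).integrable_mul (hvL j)
    have i2 : Integrable (fun x => v x * cutoffLaplacian k σ (𝓕 f) χ x)
        (volume.restrict (halfSpace d σ)) := hv.integrable_mul hL
    rw [integral_add i1 i2] at h
    simp only [mul_assoc, ← Finset.mul_sum]
    rw [integral_const_mul, integral_const_mul, eq_neg_of_add_eq_zero_left h]
    simp only [mul_comm (v _)]
    ring

/-- The Schwartz function `x̃ ↦ ∂_n χ(x̃, 0)`. -/
def normalTrace (χ : 𝓓((⊤ : Opens (Amb d)), ℂ)) : 𝓢(Hyp d, ℂ) :=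
  HasCompactSupport.toSchwartzMap (f := fun x : Hyp d => fderiv ℝ χ (x, 0) (dir none))
    (hasCompactSupport_slice (χ.hasCompactSupport.fderiv_apply ℝ (dir none)) 0)
    ((contDiff_fderiv_dir χ.contDiff none).comp (contDiff_id.prodMk contDiff_const))

/-- The normal derivative of `χ 𝒟_k φ`. Here `τ` is `T_k φ` extended to `Γ_∞`. -/
theorem isNormalDeriv_cutoff (hd : d = 1 ∨ d = 2) (hk : 0 < k) (σ : ℤˣ) {f : Hyp d → ℂ}
    (hf : Integrable f) {φ τ : 𝓢'(Hyp d, ℂ)} (hφ : HasFourierDensity k (1 / 2) φ (𝓕 f))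
    (hτ : HasFourierDensity k (-(1 / 2)) τ (fun ξ => -(symbol k ξ / 2) * 𝓕 f ξ))
    (χ : 𝓓((⊤ : Opens (Amb d)), ℂ)) :
    IsNormalDeriv σ (fun y => χ y * doubleLayer k f y)
      (TemperedDistribution.smulLeftCLM ℂ (traceTest χ) τ +
        (((σ : ℤ) : ℂ) / 2) • TemperedDistribution.smulLeftCLM ℂ (normalTrace χ) φ) := by
  constructor
  · obtain ⟨_, _, h1⟩ := exists_hasFourierDensity_smulLeftCLM hk (-(1 / 2)) (traceTest χ)
    obtain ⟨_, _, h2⟩ := exists_hasFourierDensity_smulLeftCLM hk (-(1 / 2)) (normalTrace χ)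
    obtain ⟨b, hb, -⟩ := h1 _ _ hτ
    obtain ⟨c, hc, -⟩ := h2 _ _ (hφ.mono hk (by norm_num))
    exact add_mem (hb.mem_sobolev hk) (Submodule.smul_mem _ _ (hc.mem_sobolev hk))
  · refine ⟨_, _, hasWeakGradLaplacian_cutoff hd hk σ hf hφ.memLp χ, fun v => ?_⟩
    have h := setIntegral_cutoff_green hk σ hφ.memLp χ.contDiff χ.hasCompactSupport v.contDiff
    have e1 : (TemperedDistribution.smulLeftCLM ℂ (traceTest χ) τ +
        (((σ : ℤ) : ℂ) / 2) • TemperedDistribution.smulLeftCLM ℂ (normalTrace χ) φ) (traceTest v) =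
        τ (SchwartzMap.smulLeftCLM ℂ (traceTest χ) (traceTest v)) + ((σ : ℤ) : ℂ) / 2 *
          φ (SchwartzMap.smulLeftCLM ℂ (normalTrace χ) (traceTest v)) := rfl
    have e2 : (SchwartzMap.smulLeftCLM ℂ (traceTest χ) (traceTest v) : Hyp d → ℂ) =
        fun x => χ (x, 0) * v (x, 0) := by
      ext x
      rw [SchwartzMap.smulLeftCLM_apply_apply (traceTest χ).hasTemperateGrowth]
      rfl
    have e3 : (SchwartzMap.smulLeftCLM ℂ (normalTrace χ) (traceTest v) : Hyp d → ℂ) =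
        fun x => fderiv ℝ χ (x, 0) (dir none) * v (x, 0) := by
      ext x
      rw [SchwartzMap.smulLeftCLM_apply_apply (normalTrace χ).hasTemperateGrowth]
      rfl
    have e4 : ∀ x, (∑ j, ((σ : ℤ) : ℂ) / 2 * cutoffGrad k σ (𝓕 f) χ j x * fderiv ℝ v x (dir j)) +
        v x * (((σ : ℤ) : ℂ) / 2 * cutoffLaplacian k σ (𝓕 f) χ x) =
        ((σ : ℤ) : ℂ) / 2 * ((∑ j, cutoffGrad k σ (𝓕 f) χ j x * fderiv ℝ v x (dir j)) +
          v x * cutoffLaplacian k σ (𝓕 f) χ x) := fun x => by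
      rw [mul_add, Finset.mul_sum]
      congr 1
      · exact Finset.sum_congr rfl fun j _ => by ring
      · ring
    rw [e1, hτ.apply_eq, hφ.apply_eq, SchwartzMap.fourierInv_coe, SchwartzMap.fourierInv_coe, e2, e3]
    simp_rw [e4]
    rw [integral_const_mul, h]
    have e5 : ∀ ξ, -(symbol k ξ / 2) * 𝓕 f ξ * 𝓕⁻ (fun x : Hyp d => χ (x, 0) * v (x, 0)) ξ =
        -(1 / 2) * (symbol k ξ * 𝓕 f ξ * 𝓕⁻ (fun x : Hyp d => χ (x, 0) * v (x, 0)) ξ) := fun ξ => by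
      ring
    simp_rw [e5]
    rw [integral_const_mul]
    linear_combination (((σ : ℤ) : ℂ) / 2 * (∫ ξ, 𝓕 f ξ *
      𝓕⁻ (fun x : Hyp d => fderiv ℝ χ (x, 0) (dir none) * v (x, 0)) ξ) -
      1 / 2 * ∫ ξ, symbol k ξ * 𝓕 f ξ * 𝓕⁻ (fun x : Hyp d => χ (x, 0) * v (x, 0)) ξ) *
      -units_int_complex_mul_self σ

/-- On `H^{1/2}_{closure Γ}` the hypersingular operator is the Fourier multiplier `-Λ/2`, followed
by the restriction to `Γ`. -/
theorem isHypersingular_restrict (hd : d = 1 ∨ d = 2) (hk : 0 < k) {Γ : Opens (Hyp d)}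
    (hΓ : Bornology.IsBounded (Γ : Set (Hyp d))) {φ τ : 𝓢'(Hyp d, ℂ)} {a : Hyp d → ℂ}
    (hφ : HasFourierDensity k (1 / 2) φ a) (hs : Distribution.dsupport φ ⊆ closure (Γ : Set (Hyp d)))
    {s : ℝ} (hτ : HasFourierDensity k s τ (fun ξ => -(symbol k ξ / 2) * a ξ)) :
    IsHypersingular k Γ φ (restrict Γ τ) := by
  obtain ⟨f, hfi, hf0, hf, hfa⟩ := (hφ.mono hk (by norm_num : (0 : ℝ) ≤ 1 / 2)).exists_integrable hk
    (Metric.isCompact_of_isClosed_isBounded isClosed_closure hΓ.closure) hs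
  have hφ' := hφ.congr hfa
  have hm : MemLp (fun ξ => (weight k (-(1 / 2)) ξ : ℂ) * (-(symbol k ξ / 2) * 𝓕 f ξ)) 2 := by
    have := memLp_weight_symbol hk hφ'.memLp
    rwa [show (1 / 2 : ℝ) - 1 = -(1 / 2) by norm_num] at this
  have hτ' : HasFourierDensity k (-(1 / 2)) τ (fun ξ => -(symbol k ξ / 2) * 𝓕 f ξ) := by
    refine ⟨hm, fun ψ => ?_⟩
    rw [hτ.apply_eq]
    refine integral_congr_ae ?_
    filter_upwards [hfa] with ξ hξ
    rw [hξ]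
  refine ⟨doubleLayer k f, isDoubleLayer_doubleLayer hd hk hf0 hf, fun χ hχ σ =>
    ⟨_, isNormalDeriv_cutoff hd hk σ hfi hφ' hτ' χ, ?_⟩⟩
  ext v
  have e1 : restrict Γ (TemperedDistribution.smulLeftCLM ℂ (traceTest χ) τ +
      (((σ : ℤ) : ℂ) / 2) • TemperedDistribution.smulLeftCLM ℂ (normalTrace χ) φ) v =
      τ (SchwartzMap.smulLeftCLM ℂ (traceTest χ) (testSchwartz Γ v)) + ((σ : ℤ) : ℂ) / 2 *
        φ (SchwartzMap.smulLeftCLM ℂ (normalTrace χ) (testSchwartz Γ v)) := rfl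
  have hv : ∀ x : Hyp d, x ∉ Γ → v x = 0 := fun x hx =>
    image_eq_zero_of_notMem_tsupport fun h => hx (v.tsupport_subset h)
  have e2 : SchwartzMap.smulLeftCLM ℂ (traceTest χ) (testSchwartz Γ v) = testSchwartz Γ v := by
    ext x
    rw [SchwartzMap.smulLeftCLM_apply_apply (traceTest χ).hasTemperateGrowth]
    change χ (x, 0) * v x = v x
    by_cases hx : x ∈ Γ
    · rw [(cutoff_eq_one hχ (subset_closure hx)).1, one_mul]
    · rw [hv x hx, mul_zero]
  have e3 : SchwartzMap.smulLeftCLM ℂ (normalTrace χ) (testSchwartz Γ v) = 0 := by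
    ext x
    rw [SchwartzMap.smulLeftCLM_apply_apply (normalTrace χ).hasTemperateGrowth]
    change fderiv ℝ χ (x, 0) (dir none) * v x = 0
    by_cases hx : x ∈ Γ
    · rw [(cutoff_eq_one hχ (subset_closure hx)).2, zero_mul]
    · rw [hv x hx, mul_zero]
  rw [e1, e2, e3, map_zero, mul_zero, add_zero]
  rfl

end

/-! ### Uniqueness of the hypersingular trace -/

section

variable {d : ℕ} {k : ℝ}

theorem exists_mem_cutoffs {Γ : Opens (Hyp d)} (hΓ : Bornology.IsBounded (Γ : Set (Hyp d)))
    {F : Set (Amb d)} (hF : IsClosed F)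
    (h : Disjoint (closure (Γ : Set (Hyp d)) ×ˢ ({0} : Set ℝ)) F) :
    ∃ ρ ∈ cutoffs Γ, Disjoint (tsupport ρ) F := by
  have hK : IsCompact (closure (Γ : Set (Hyp d)) ×ˢ ({0} : Set ℝ)) :=
    (Metric.isCompact_of_isClosed_isBounded isClosed_closure hΓ.closure).prod isCompact_singleton
  obtain ⟨χ, hχ, hχs, hχF, h1⟩ := exists_cutoff hK hF.isOpen_compl
    (Set.disjoint_left.1 h : _ ⊆ Fᶜ)
  refine ⟨⟨χ, hχ, hχs, Set.subset_univ _⟩, ?_, Set.disjoint_left.2 hχF⟩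
  exact h1.filter_mono (nhdsSet_mono (Set.prod_mono subset_closure subset_rfl))

/-- The defining property determines the double-layer potential off the screen. -/
theorem IsDoubleLayer.eq {Γ : Opens (Hyp d)} (hΓ : Bornology.IsBounded (Γ : Set (Hyp d)))
    {φ : 𝓢'(Hyp d, ℂ)} {u u' : Amb d → ℂ} (hu : IsDoubleLayer k Γ φ u)
    (hu' : IsDoubleLayer k Γ φ u') {x : Amb d}
    (hx : x ∉ closure (Γ : Set (Hyp d)) ×ˢ ({0} : Set ℝ)) : u x = u' x := by
  obtain ⟨ρ, hρ, hd⟩ := exists_mem_cutoffs hΓ (isClosed_singleton (x := x))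
    (Set.disjoint_singleton_right.2 hx)
  have hxρ := Set.disjoint_singleton_right.1 hd
  obtain ⟨θ, hθ, e⟩ := hu x hx ρ hρ hxρ
  obtain ⟨θ', hθ', e'⟩ := hu' x hx ρ hρ hxρ
  have : θ = θ' := by
    ext y
    rw [hθ, hθ']
  rw [e, e', this]

/-- The fundamental lemma of the calculus of variations for square integrable functions. -/
theorem ae_eq_of_forall_setIntegral_testFunction {U : Opens (Amb d)} {f g : Amb d → ℂ}
    (hf : MemLp f 2 (volume.restrict U)) (hg : MemLp g 2 (volume.restrict U))
    (h : ∀ v : 𝓓(U, ℂ), ∫ y in U, f y * v y = ∫ y in U, g y * v y) :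
    f =ᵐ[volume.restrict U] g := by
  have hl : LocallyIntegrableOn (fun y => f y - g y) U volume := fun x hx => by
    obtain ⟨K, hK, hxK, hKU⟩ := exists_compact_subset U.isOpen hx
    refine ⟨K, mem_nhdsWithin_of_mem_nhds (mem_interior_iff_mem_nhds.1 hxK), ?_⟩
    have : IsFiniteMeasure ((volume : Measure (Amb d)).restrict K) :=
      ⟨by rw [Measure.restrict_apply_univ]; exact hK.measure_lt_top⟩
    exact ((hf.sub hg).mono_measure (Measure.restrict_mono hKU le_rfl)).integrable (by norm_num)
  have h0 := U.isOpen.ae_eq_zero_of_integral_contDiff_smul_eq_zero hl fun w hw hws hwU => by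
    set v : 𝓓(U, ℂ) := ⟨fun x => (w x : ℂ), Complex.ofRealCLM.contDiff.comp hw,
      hws.comp_left Complex.ofReal_zero, (closure_mono (Function.support_comp_subset
        (g := fun r : ℝ => (r : ℂ)) Complex.ofReal_zero w)).trans hwU⟩ with hv
    have hvL : MemLp v 2 (volume.restrict (U : Set (Amb d))) :=
      (v.contDiff.continuous.memLp_of_hasCompactSupport v.hasCompactSupport).restrict _
    have e : ∫ y, w y • (f y - g y) = ∫ y in U, (f y * v y - g y * v y) := by
      rw [← setIntegral_eq_integral_of_forall_compl_eq_zero (s := (U : Set (Amb d)))]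
      · congr 1
        ext y
        change w y • (f y - g y) = f y * (w y : ℂ) - g y * (w y : ℂ)
        rw [Complex.real_smul]
        ring
      · intro y hy
        rw [image_eq_zero_of_notMem_tsupport fun h => hy (hwU h), zero_smul]
    have e2 := integral_sub (hf.integrable_mul hvL) (hg.integrable_mul hvL)
    simp only [Pi.mul_apply] at e2
    rw [e, e2, h v, sub_self]
  rw [Filter.EventuallyEq, ae_restrict_iff' U.isOpen.measurableSet]
  filter_upwards [h0] with y hy hyU
  exact sub_eq_zero.1 (hy hyU)

/-- The weak gradient, the weak Laplacian and hence the normal derivative are determined by the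
values in the half-space. -/
theorem IsNormalDeriv.apply_eq {σ : ℤˣ} {w w' : Amb d → ℂ} {h h' : 𝓢'(Hyp d, ℂ)}
    (H : IsNormalDeriv σ w h) (H' : IsNormalDeriv σ w' h')
    (hw : ∀ y ∈ halfSpace d σ, w y = w' y) (v : 𝓓((⊤ : Opens (Amb d)), ℂ)) :
    h (traceTest v) = h' (traceTest v) := by
  obtain ⟨-, G, f, hG, e⟩ := H
  obtain ⟨-, G', f', hG', e'⟩ := H'
  have hms := (halfSpace d σ).isOpen.measurableSet
  have h1 : ∀ j, G j =ᵐ[volume.restrict (halfSpace d σ)] G' j := fun j => by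
    refine ae_eq_of_forall_setIntegral_testFunction (hG.memLp_grad j) (hG'.memLp_grad j)
      fun v => neg_injective ?_
    rw [← hG.grad, ← hG'.grad]
    exact setIntegral_congr_fun hms fun y hy => by simp only [hw y hy]
  have h1' := eventually_all.2 h1
  have h2 : f =ᵐ[volume.restrict (halfSpace d σ)] f' := by
    refine ae_eq_of_forall_setIntegral_testFunction hG.memLp_laplacian hG'.memLp_laplacian
      fun v => neg_injective ?_
    rw [← hG.laplacian, ← hG'.laplacian]
    refine integral_congr_ae ?_
    filter_upwards [h1'] with y hy
    simp only [hy]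
  rw [e, e']
  congr 1
  refine integral_congr_ae ?_
  filter_upwards [h1', h2] with y hy hy2
  simp only [hy, hy2]

/-- Every test function on `Γ` is the trace of a test function on `ℝⁿ`. -/
theorem exists_traceTest_eq {Γ : Opens (Hyp d)} (v : 𝓓(Γ, ℂ)) :
    ∃ V : 𝓓((⊤ : Opens (Amb d)), ℂ), traceTest V = testSchwartz Γ v := by
  obtain ⟨χ, hχ, hχs, -, h1⟩ := exists_cutoff (isCompact_singleton (x := (0 : ℝ))) isOpen_univ
    (Set.subset_univ _)
  have hc : HasCompactSupport fun x : Amb d => v x.1 * χ x.2 := by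
    refine HasCompactSupport.of_support_subset_isCompact
      (v.hasCompactSupport.isCompact.prod hχs.isCompact) fun x hx => ?_
    have hx' : v x.1 * χ x.2 ≠ 0 := hx
    exact ⟨subset_tsupport _ (left_ne_zero_of_mul hx'), subset_tsupport _ (right_ne_zero_of_mul hx')⟩
  refine ⟨⟨fun x => v x.1 * χ x.2, (v.contDiff.comp contDiff_fst).mul (hχ.comp contDiff_snd), hc,
    Set.subset_univ _⟩, ?_⟩
  ext x
  change v x * χ 0 = v x
  rw [h1.self_of_nhdsSet 0 rfl, mul_one]

/-- On a bounded screen the hypersingular operator is single-valued. -/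
theorem IsHypersingular.unique {Γ : Opens (Hyp d)} (hΓ : Bornology.IsBounded (Γ : Set (Hyp d)))
    {φ : 𝓢'(Hyp d, ℂ)} {g g' : Dist Γ} (hg : IsHypersingular k Γ φ g)
    (hg' : IsHypersingular k Γ φ g') : g = g' := by
  obtain ⟨u, hu, H⟩ := hg
  obtain ⟨u', hu', H'⟩ := hg'
  obtain ⟨χ, hχ, -⟩ := exists_mem_cutoffs hΓ isClosed_empty (Set.disjoint_empty _)
  obtain ⟨h, hn, rfl⟩ := H χ hχ 1
  obtain ⟨h', hn', rfl⟩ := H' χ hχ 1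
  ext v
  obtain ⟨V, hV⟩ := exists_traceTest_eq v
  have := hn.apply_eq hn' (fun y hy => ?_) V
  · rw [hV] at this
    exact this
  · rw [hu.eq hΓ hu' fun hy' => ?_]
    have h0 : y.2 = 0 := hy'.2
    simp [halfSpace, h0] at hy

end

/-! ### The hypersingular operator on Sobolev spaces of every order -/

section

variable {d : ℕ} {k : ℝ}

/-- The Fourier multiplier `-Λ/2` maps `H^s` to `H^{s-1}`. -/
theorem exists_symbolMultiplier (hk : 0 < k) (s : ℝ) :
    ∃ L : sobolev d s →ₗ[ℂ] sobolev d (s - 1), ∀ (u : sobolev d s) (t : ℝ) (a : Hyp d → ℂ),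
      HasFourierDensity k t (u : 𝓢'(Hyp d, ℂ)) a →
      HasFourierDensity k (s - 1) (L u : 𝓢'(Hyp d, ℂ)) (fun ξ => -(symbol k ξ / 2) * a ξ) := by
  choose a ha using fun u : sobolev d s => exists_hasFourierDensity hk u.2
  choose τ hτ using fun u : sobolev d s =>
    exists_hasFourierDensity_of_memLp hk (memLp_weight_symbol hk (ha u).memLp)
  have key : ∀ (u : sobolev d s) (t : ℝ) (b : Hyp d → ℂ), HasFourierDensity k t (u : 𝓢'(Hyp d, ℂ)) b →
      HasFourierDensity k (s - 1) (τ u) (fun ξ => -(symbol k ξ / 2) * b ξ) := fun u t b hb => by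
    refine (hτ u).congr ?_
    filter_upwards [(ha u).ae_eq hk hb] with ξ hξ
    rw [hξ]
  have huniq : ∀ {u v : 𝓢'(Hyp d, ℂ)} {b : Hyp d → ℂ}, HasFourierDensity k (s - 1) u b →
      HasFourierDensity k (s - 1) v b → u = v := fun h h' => by
    ext ψ
    rw [h.apply_eq, h'.apply_eq]
  refine ⟨{ toFun := fun u => ⟨τ u, (hτ u).mem_sobolev hk⟩
            map_add' := fun u v => Subtype.ext ?_
            map_smul' := fun c u => Subtype.ext ?_ }, key⟩
  · refine huniq (key (u + v) s _ ((ha u).add hk (ha v))) ((hτ u).add hk (hτ v) |>.congr ?_)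
    exact ae_of_all _ fun ξ => by simp only [mul_add]
  · refine huniq (key (c • u) s _ ((ha u).smul c)) (((hτ u).smul c).congr ?_)
    exact ae_of_all _ fun ξ => by simp only [mul_left_comm]

/-- The factor `1/2` in the bound, from `|Λ(ξ)| ≤ (k² + |ξ|²)^{1/2}`. -/
theorem sobolevNorm_symbol_le (hk : 0 < k) {s : ℝ} {u τ : 𝓢'(Hyp d, ℂ)} {a : Hyp d → ℂ}
    (hu : HasFourierDensity k s u a)
    (hτ : HasFourierDensity k (s - 1) τ (fun ξ => -(symbol k ξ / 2) * a ξ)) :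
    sobolevNorm k (s - 1) τ ≤ 2⁻¹ * sobolevNorm k s u := by
  rw [hu.sobolevNorm_eq hk, hτ.sobolevNorm_eq hk]
  have h : ∀ ξ, ‖(weight k (s - 1) ξ : ℂ) * (-(symbol k ξ / 2) * a ξ)‖ ≤
      2⁻¹ * ‖(weight k s ξ : ℂ) * a ξ‖ := fun ξ => by
    have h1 := norm_symbol_le_weight hk ξ
    have h2 := weight_add hk (s - 1) 1 ξ
    rw [sub_add_cancel] at h2
    have h3 := weight_pos hk (s - 1) ξ
    rw [norm_mul, norm_mul, norm_mul, norm_neg, norm_div, Complex.norm_ofNat, Complex.norm_real,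
      Complex.norm_real, Real.norm_of_nonneg h3.le, Real.norm_of_nonneg (weight_pos hk s ξ).le, h2]
    have h4 := mul_le_mul_of_nonneg_left h1 (mul_nonneg h3.le (norm_nonneg (a ξ)))
    linarith
  refine (eLpNorm_le_mul_eLpNorm_of_ae_le_mul (ae_of_all _ h) 2).trans (le_of_eq ?_)
  rw [ENNReal.ofReal_inv_of_pos two_pos, ENNReal.ofReal_ofNat]

theorem sobolevOnNorm_restrict_le (Γ : Opens (Hyp d)) {s : ℝ} {U : 𝓢'(Hyp d, ℂ)}
    (hU : U ∈ sobolev d s) : sobolevOnNorm k s Γ (restrict Γ U) ≤ sobolevNorm k s U :=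
  iInf₂_le U ⟨hU, rfl⟩

theorem exists_schwartz_eq_mul_weight (hk : 0 < k) (s : ℝ) (θ : 𝓢(Hyp d, ℂ)) :
    ∃ η : 𝓢(Hyp d, ℂ), ∀ ξ, θ ξ = η ξ * (weight k s ξ : ℂ) := by
  refine ⟨SchwartzMap.smulLeftCLM ℂ (fun ξ : Hyp d => ((weight k (-s) ξ : ℝ) : ℂ)) θ, fun ξ => ?_⟩
  rw [SchwartzMap.smulLeftCLM_apply_apply (hasTemperateGrowth_weight hk (-s)), smul_eq_mul]
  have h2 : (weight k (-s) ξ : ℂ) * (weight k s ξ : ℂ) = 1 := by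
    rw [← Complex.ofReal_mul, weight_neg_mul_weight hk s ξ, Complex.ofReal_one]
  linear_combination -(θ ξ) * h2

theorem enorm_integral_mul_le {s : ℝ} {a : Hyp d → ℂ}
    (h : MemLp (fun ξ => (weight k s ξ : ℂ) * a ξ) 2) {η θ : 𝓢(Hyp d, ℂ)}
    (hη : ∀ ξ, θ ξ = η ξ * (weight k s ξ : ℂ)) :
    ‖∫ ξ, a ξ * θ ξ‖ₑ ≤ eLpNorm η 2 * eLpNorm (fun ξ => (weight k s ξ : ℂ) * a ξ) 2 := by
  have e : ∀ ξ, a ξ * θ ξ = η ξ • ((weight k s ξ : ℂ) * a ξ) := fun ξ => by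
    rw [hη, smul_eq_mul]
    ring
  simp_rw [e]
  refine (enorm_integral_le_lintegral_enorm _).trans ?_
  have h1 := eLpNorm_smul_le_mul_eLpNorm (p := 2) (q := 2) (r := 1) h.1 (η.memLp 2).1
  rw [eLpNorm_one_eq_lintegral_enorm] at h1
  exact h1

theorem eLpNorm_schwartz_ne_top (η : 𝓢(Hyp d, ℂ)) : eLpNorm η 2 ≠ ⊤ := by
  have h : MemLp η 2 := η.memLp 2
  exact h.eLpNorm_ne_top

theorem enorm_apply_le (hk : 0 < k) {s : ℝ} {ψ η : 𝓢(Hyp d, ℂ)}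
    (hη : ∀ ξ, (𝓕⁻ ψ : 𝓢(Hyp d, ℂ)) ξ = η ξ * (weight k s ξ : ℂ)) {U : 𝓢'(Hyp d, ℂ)}
    (hU : U ∈ sobolev d s) : ‖U ψ‖ₑ ≤ eLpNorm η 2 * sobolevNorm k s U := by
  obtain ⟨a, ha⟩ := exists_hasFourierDensity hk hU
  have h1 := enorm_integral_mul_le ha.memLp hη
  rwa [← ha.apply_eq, ← ha.sobolevNorm_eq hk] at h1

/-- The norm of `H^s(Γ)` controls the pairing with each test function. -/
theorem exists_enorm_apply_le (hk : 0 < k) (s : ℝ) {Γ : Opens (Hyp d)} (v : 𝓓(Γ, ℂ)) :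
    ∃ C : ℝ≥0∞, C ≠ ⊤ ∧ ∀ g : Dist Γ, ‖g v‖ₑ ≤ C * sobolevOnNorm k s Γ g := by
  obtain ⟨η, hη⟩ := exists_schwartz_eq_mul_weight hk s (𝓕⁻ (testSchwartz Γ v) : 𝓢(Hyp d, ℂ))
  obtain ⟨N, hN, hb⟩ : ∃ N : ℝ≥0∞, N ≠ ⊤ ∧
      ∀ U ∈ sobolev d s, ‖U (testSchwartz Γ v)‖ₑ ≤ N * sobolevNorm k s U :=
    ⟨eLpNorm (η : Hyp d → ℂ) 2 volume, eLpNorm_schwartz_ne_top η, fun U hU => enorm_apply_le hk hη hU⟩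
  have h0 : N + 1 ≠ 0 := by simp
  have ht : N + 1 ≠ ⊤ := by simp [hN]
  refine ⟨N + 1, ht, fun g => ?_⟩
  rw [mul_comm, ← ENNReal.div_le_iff h0 ht, sobolevOnNorm]
  refine le_iInf₂ fun U hU => ?_
  rw [ENNReal.div_le_iff h0 ht, mul_comm, ← hU.2]
  refine (hb U hU.1).trans ?_
  gcongr
  exact le_self_add

/-- Limits in `H^s(Γ)` are limits of distributions. -/
theorem tendsto_apply_of_tendsto_sobolevOnNorm (hk : 0 < k) {s : ℝ} {Γ : Opens (Hyp d)}
    {g : ℕ → Dist Γ} {l : Dist Γ}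
    (h : Tendsto (fun j => sobolevOnNorm k s Γ (g j - l)) atTop (𝓝 0)) (v : 𝓓(Γ, ℂ)) :
    Tendsto (fun j => g j v) atTop (𝓝 (l v)) := by
  obtain ⟨C, hC, hb⟩ := exists_enorm_apply_le hk s v
  rw [tendsto_iff_edist_tendsto_0]
  have h1 := ENNReal.Tendsto.const_mul h (Or.inr hC)
  rw [mul_zero] at h1
  refine tendsto_of_tendsto_of_tendsto_of_le_of_le tendsto_const_nhds h1 (fun _ => zero_le)
    fun j => ?_
  rw [edist_eq_enorm_sub]
  exact hb (g j - l)

theorem dsupport_testTempered_subset (Ω : Opens (Hyp d)) (v : 𝓓(Ω, ℂ)) :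
    Distribution.dsupport (testTempered Ω v) ⊆ closure (Ω : Set (Hyp d)) := by
  intro x hx
  by_contra hxΩ
  refine (Distribution.notMem_dsupport_iff x).2
    ⟨(closure (Ω : Set (Hyp d)))ᶜ, fun ψ hψ => ?_, isClosed_closure.isOpen_compl, hxΩ⟩ hx
  rw [testTempered, SchwartzMap.coe_apply]
  refine integral_eq_zero_of_ae (ae_of_all _ fun y => ?_)
  by_cases hy : y ∈ Ω
  · have h0 : ψ y = 0 := image_eq_zero_of_notMem_tsupport fun h => hψ h (subset_closure hy)
    simp [h0]
  · have h0 : testSchwartz Ω v y = 0 :=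
      image_eq_zero_of_notMem_tsupport (f := v) fun h => hy (v.tsupport_subset h)
    simp [h0]

theorem restrictTo_restrict {Ω Γ : Opens (Hyp d)} (h : Γ ≤ Ω) (U : 𝓢'(Hyp d, ℂ)) :
    restrictTo Γ (restrict Ω U) = restrict Γ U := by
  ext v
  change U (testSchwartz Ω (TestFunction.monoCLM ℂ v)) = U (testSchwartz Γ v)
  congr 1
  ext x
  change (TestFunction.monoCLM ℂ v : 𝓓(Ω, ℂ)) x = v x
  simp [TestFunction.monoCLM_apply, h]

/-- The operator on `H^s_{closure Γ}` given by a Fourier multiplier that acts as `-Λ/2`. -/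
theorem isHypersingularOperator_of_multiplier (hd : d = 1 ∨ d = 2) (hk : 0 < k) {s : ℝ}
    {Γ : Opens (Hyp d)} (hΓ : Bornology.IsBounded (Γ : Set (Hyp d)))
    {L : sobolev d s →ₗ[ℂ] sobolev d (s - 1)}
    (hL : ∀ (u : sobolev d s) (t : ℝ) (a : Hyp d → ℂ),
      HasFourierDensity k t (u : 𝓢'(Hyp d, ℂ)) a →
      HasFourierDensity k (s - 1) (L u : 𝓢'(Hyp d, ℂ)) (fun ξ => -(symbol k ξ / 2) * a ξ))
    {T : sobolevSupp s (closure (Γ : Set (Hyp d))) →ₗ[ℂ] sobolevOn (s - 1) Γ}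
    (hT : ∀ φ, (T φ : Dist Γ) = restrict Γ (L ⟨φ, φ.2.1⟩ : 𝓢'(Hyp d, ℂ))) :
    IsHypersingularOperator k s Γ T where
  eq_trace φ hφ := by
    obtain ⟨a, ha⟩ := exists_hasFourierDensity hk hφ
    rw [hT]
    exact isHypersingular_restrict hd hk hΓ ha φ.2.2 (hL ⟨φ, φ.2.1⟩ _ a ha)
  extension φ Ω hΩ hΓΩ ψ hψ := by
    have hS : ∀ j r, HasFourierDensity k r (testTempered Ω (ψ j)) 
        ⇑(𝓕 (testSchwartz Ω (ψ j)) : 𝓢(Hyp d, ℂ)) :=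
      fun j r => hasFourierDensity_schwartz hk r _
    set U : ℕ → sobolev d s := fun j => ⟨testTempered Ω (ψ j), (hS j s).mem_sobolev hk⟩ with hU
    refine ⟨fun j => restrict Ω (L (U j) : 𝓢'(Hyp d, ℂ)), fun j =>
      isHypersingular_restrict hd hk hΩ (hS j _) (dsupport_testTempered_subset Ω _)
        (hL (U j) s _ (hS j s)), ?_⟩
    have hlim : Tendsto (fun j => 2⁻¹ * sobolevNorm k s (testTempered Ω (ψ j) -
        (φ : 𝓢'(Hyp d, ℂ)))) atTop (𝓝 0) := by
      have := ENNReal.Tendsto.const_mul hψ (a := 2⁻¹) (Or.inr (by simp))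
      rwa [mul_zero] at this
    refine tendsto_of_tendsto_of_tendsto_of_le_of_le tendsto_const_nhds hlim (fun _ => zero_le)
      fun j => ?_
    change sobolevOnNorm k (s - 1) Γ (restrictTo Γ (restrict Ω (L (U j) : 𝓢'(Hyp d, ℂ))) -
      (T φ : Dist Γ)) ≤ _
    have e : restrictTo Γ (restrict Ω (L (U j) : 𝓢'(Hyp d, ℂ))) - (T φ : Dist Γ) =
        restrict Γ (L (U j - ⟨φ, φ.2.1⟩) : 𝓢'(Hyp d, ℂ)) := by
      rw [restrictTo_restrict (fun x hx => hΓΩ (subset_closure hx)), hT, map_sub,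
        Submodule.coe_sub, map_sub]
    obtain ⟨a, ha⟩ := exists_hasFourierDensity hk (U j - ⟨φ, φ.2.1⟩).2
    rw [e]
    exact (sobolevOnNorm_restrict_le Γ (L _).2).trans (sobolevNorm_symbol_le hk ha (hL _ s a ha))

/-- Since test functions are dense, the extension by continuity is unique. -/
theorem IsHypersingularOperator.unique (hk : 0 < k) {s : ℝ} {Γ : Opens (Hyp d)}
    (hΓ : Bornology.IsBounded (Γ : Set (Hyp d)))
    {T T' : sobolevSupp s (closure (Γ : Set (Hyp d))) →ₗ[ℂ] sobolevOn (s - 1) Γ}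
    (hT : IsHypersingularOperator k s Γ T) (hT' : IsHypersingularOperator k s Γ T') : T = T' := by
  ext φ v
  set Ω : Opens (Hyp d) := ⟨Metric.thickening 1 (closure (Γ : Set (Hyp d))),
    Metric.isOpen_thickening⟩ with hΩ
  have hb : Bornology.IsBounded (Ω : Set (Hyp d)) := hΓ.closure.thickening
  have hs : closure (Γ : Set (Hyp d)) ⊆ Ω := Metric.self_subset_thickening one_pos _
  obtain ⟨ψ, hψ⟩ := exists_tendsto_testTempered hk φ.2.1
    (Metric.isCompact_of_isClosed_isBounded isClosed_closure hΓ.closure) φ.2.2 hs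
  obtain ⟨g, hg, hlim⟩ := hT.extension φ Ω hb hs ψ hψ
  obtain ⟨g', hg', hlim'⟩ := hT'.extension φ Ω hb hs ψ hψ
  obtain rfl : g = g' := funext fun j => (hg j).unique hb (hg' j)
  exact tendsto_nhds_unique (tendsto_apply_of_tendsto_sobolevOnNorm hk hlim v)
    (tendsto_apply_of_tendsto_sobolevOnNorm hk hlim' v)

end

end

end Screen

theorem theorem6p1 (d : ℕ) (hd : d = 1 ∨ d = 2)
    (Γ : TopologicalSpace.Opens (Screen.Hyp d)) (hΓ : (Γ : Set (Screen.Hyp d)).Nonempty)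
    (hΓb : Bornology.IsBounded (Γ : Set (Screen.Hyp d))) (s k : ℝ) (hk : 0 < k) :
    ∃ T : Screen.sobolevSupp s (closure (Γ : Set (Screen.Hyp d))) →ₗ[ℂ] Screen.sobolevOn (s - 1) Γ,
      Screen.IsHypersingularOperator k s Γ T ∧
      (∀ T', Screen.IsHypersingularOperator k s Γ T' → T' = T) ∧
      ∀ φ, Screen.sobolevOnNorm k (s - 1) Γ (T φ : Screen.Dist Γ) ≤
        2⁻¹ * Screen.sobolevNorm k s (φ : TemperedDistribution (Screen.Hyp d) ℂ) := by
  obtain ⟨L, hL⟩ := Screen.exists_symbolMultiplier (d := d) hk s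
  have hle : Screen.sobolevSupp s (closure (Γ : Set (Screen.Hyp d))) ≤ Screen.sobolev d s :=
    fun _ h => h.1
  obtain ⟨T, hT⟩ : ∃ T : Screen.sobolevSupp s (closure (Γ : Set (Screen.Hyp d))) →ₗ[ℂ]
      Screen.sobolevOn (s - 1) Γ,
      ∀ φ, (T φ : Screen.Dist Γ) = Screen.restrict Γ (L ⟨φ, φ.2.1⟩ : TemperedDistribution _ ℂ) :=
    ⟨LinearMap.codRestrict (Screen.sobolevOn (s - 1) Γ) (Screen.restrict Γ ∘ₗ
      (Screen.sobolev d (s - 1)).subtype ∘ₗ L ∘ₗ Submodule.inclusion hle)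
      fun φ => ⟨_, (L (Submodule.inclusion hle φ)).2, rfl⟩, fun _ => rfl⟩
  have hT' := Screen.isHypersingularOperator_of_multiplier hd hk hΓb hL hT
  refine ⟨T, hT', fun T' h => h.unique hk hΓb hT', fun φ => ?_⟩
  obtain ⟨a, ha⟩ := Screen.exists_hasFourierDensity hk φ.2.1
  rw [hT]
  exact (Screen.sobolevOnNorm_restrict_le Γ (L _).2).trans
    (Screen.sobolevNorm_symbol_le hk ha (hL ⟨φ, φ.2.1⟩ s a ha))
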